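/- For a spin $j$ (with $2j$ a non-negative integer) let $V^{(j)}$ be the complex vector space with basis $e^j_m$, $m=-j,-j+1,\dots,j$, with the $\mathrm{sl}(2)$-action $He^j_m=2m\,e^j_m$, $Z_\pm e^j_m=\sqrt{(j\mp m)(j\pm m+1)}\,e^j_{m\pm1}$. For $h\in\mathbb C$ the generators $H,X,Y$ of the Jordanian quantum algebra $\mathcal U_h(\mathrm{sl}(2))$ act on $V^{(j)}$ by this $H$ and by the $X,Y$ determined by $Z_+=\frac2h\tanh\frac{hX}2$ (that is, $X=\sum_{k\ge0}\frac{(h/2)^{2k}}{2k+1}Z_+^{2k+1}$) and $Z_-=\cosh\frac{hX}2\;Y\cosh\frac{hX}2$; for $h=0$ this means $X=Z_+$, $Y=Z_-$. On $V^{(j_1)}\otimes V^{(j_2)}$ they act by $\Delta(H)=H\otimes e^{hX}+e^{-hX}\otimes H$, $\Delta(X)=X\otimes1+1\otimes X$, $\Delta(Y)=Y\otimes e^{hX}+e^{-hX}\otimes Y$. Let $|j_1-j_2|\le j\le j_1+j_2$ with $j_1+j_2-j\in\mathbb Z$. Let $C^{j_1,j_2,j}_{n_1,n_2,m}$ be the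 usual $\mathrm{su}(2)$ Clebsch–Gordan coefficients (orthonormal coupled vectors, Condon–Shortley sign $C^{j_1,j_2,j}_{j_1,j-j_1,j}>0$). The $\mathcal U_h(\mathrm{sl}(2))$ Clebsch–Gordan coefficients $\mathcal C^{j_1,j_2,j}_{n_1,n_2,m}(h)$ are the coefficients of the coupled vectors $$e^{(j_1j_2)j}_m=\sum_{n_1,n_2}\mathcal C^{j_1,j_2,j}_{n_1,n_2,m}(h)\;e^{j_1}_{n_1}\otimes e^{j_2}_{n_2}\qquad(m=-j,\dots,j),$$ which transform under $\Delta(H),\Delta(X),\Delta(Y)$ as the vectors $e^j_m$ do under $H,X,Y$, normalized by $\sum_{n_1+n_2=j}|\mathcal C^{j_1,j_2,j}_{n_1,n_2,j}(h)|^2=1$ and $\mathcal C^{j_1,j_2,j}_{j_1,j-j_1,j}(h)>0$. Then both kinds of coefficients exist and are uniquely determined by these conditions (for every $h\in\mathbb C$), and for all $n_1\in\{-j_1,\dots,j_1\}$, $n_2\in\{-j_2,\dots,j_2\}$, $m\in\{-j,\dots,j\}$: - if $m=n_1+n_2$, then $\mathcal C^{j_1,j_2,j}_{n_1,n_2,m}(h)=C^{j_1,j_2,j}_{n_1,n_2,m}$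 for all $h$; - if $m>n_1+n_2$, then $\mathcal C^{j_1,j_2,j}_{n_1,n_2,m}(h)=0$ for all $h$; - if $m<n_1+n_2$, then $n_1+n_2-m$ is a positive integer and $\mathcal C^{j_1,j_2,j}_{n_1,n_2,m}(h)=c\,h^{\,n_1+n_2-m}$ for all $h$, with a real constant $c$ (possibly $0$) that does not depend on $h$. -/

import Mathlib

open scoped Kronecker

noncomputable section

/-- A spin `j` (a half-integer `j ≥ 0`) is encoded by the natural number `d = 2j`;
`spin d` is `j` itself. -/
def spin (d : ℕ) : ℝ := (d : ℝ) / 2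

/-- The magnetic quantum numbers `m = -j, -j+1, …, j` of spin `j = d/2` are indexed by
`Fin (d + 1)`; `wt d i = i - j` is the value of `m` that the index `i` stands for. -/
def wt (d : ℕ) (i : Fin (d + 1)) : ℝ := ((i : ℕ) : ℝ) - spin d

/-- Matrix of `H` in the basis `e^j_m`: `H e_m = 2 m e_m`.
(In all matrices the column of index `m` holds the coordinates of the image of `e_m`.) -/
def sl2H (d : ℕ) : Matrix (Fin (d + 1)) (Fin (d + 1)) ℝ :=
  Matrix.diagonal fun m => 2 * wt d m

/-- Matrix of `Z₊`: `Z₊ e_m = √((j - m)(j + m + 1)) e_{m+1}`. -/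
def sl2Zp (d : ℕ) : Matrix (Fin (d + 1)) (Fin (d + 1)) ℝ :=
  Matrix.of fun i m =>
    if (i : ℕ) = (m : ℕ) + 1 then Real.sqrt ((spin d - wt d m) * (spin d + wt d m + 1)) else 0

/-- Matrix of `Z₋`: `Z₋ e_m = √((j + m)(j - m + 1)) e_{m-1}`. -/
def sl2Zm (d : ℕ) : Matrix (Fin (d + 1)) (Fin (d + 1)) ℝ :=
  Matrix.of fun i m =>
    if (i : ℕ) + 1 = (m : ℕ) then Real.sqrt ((spin d + wt d m) * (spin d - wt d m + 1)) else 0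

/-- The undeformed coproduct `x ⊗ 1 + 1 ⊗ x` of a Lie algebra element `x` that acts by `A` on the
first and by `B` on the second tensor factor. -/
def lieCoproduct {ι κ R : Type*} [DecidableEq ι] [DecidableEq κ] [CommRing R]
    (A : Matrix ι ι R) (B : Matrix κ κ R) : Matrix (ι × κ) (ι × κ) R :=
  A ⊗ₖ (1 : Matrix κ κ R) + (1 : Matrix ι ι R) ⊗ₖ B

/-- `C (n₁, n₂) m` is the `su(2)` Clebsch–Gordan coefficient `C^{j₁,j₂,j}_{n₁,n₂,m}`: the columns
of `C` are the coupled vectors `e^{(j₁j₂)j}_m = ∑ C_{n₁,n₂,m} e_{n₁} ⊗ e_{n₂}`. They transform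
under `x ⊗ 1 + 1 ⊗ x` as the vectors `e^j_m` do under `x`, they are orthonormal, and
the sign is that of Condon and Shortley: `C_{j₁, j - j₁, j} > 0`. -/
structure IsSU2CG (d₁ d₂ d : ℕ)
    (C : Matrix (Fin (d₁ + 1) × Fin (d₂ + 1)) (Fin (d + 1)) ℝ) : Prop where
  map_H : lieCoproduct (sl2H d₁) (sl2H d₂) * C = C * sl2H d
  map_Zp : lieCoproduct (sl2Zp d₁) (sl2Zp d₂) * C = C * sl2Zp d
  map_Zm : lieCoproduct (sl2Zm d₁) (sl2Zm d₂) * C = C * sl2Zm d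
  orthonormal : C.transpose * C = 1
  condon_shortley : ∀ n₂ : Fin (d₂ + 1), spin d₁ + wt d₂ n₂ = spin d →
    0 < C (Fin.last d₁, n₂) (Fin.last d)

/-- Hyperbolic cosine of a complex matrix. -/
def matCosh {n : ℕ} (A : Matrix (Fin n) (Fin n) ℂ) : Matrix (Fin n) (Fin n) ℂ :=
  (2⁻¹ : ℂ) • (NormedSpace.exp A + NormedSpace.exp (-A))

/-- The generator `H` of `U_h(sl(2))` on `V^{(j)}`. -/
def uhH (d : ℕ) : Matrix (Fin (d + 1)) (Fin (d + 1)) ℂ :=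
  (sl2H d).map Complex.ofReal

/-- The generator `X` of `U_h(sl(2))` on `V^{(j)}`, determined by `Z₊ = (2/h) tanh (h X / 2)`, that
is `X = (2/h) artanh (h Z₊ / 2) = ∑ₖ (h/2)^{2k} Z₊^{2k+1} / (2k+1)`;
the series stops because `Z₊ ^ (d + 1) = 0`. For `h = 0` it gives `X = Z₊`. -/
def uhX (h : ℂ) (d : ℕ) : Matrix (Fin (d + 1)) (Fin (d + 1)) ℂ :=
  ∑ k ∈ Finset.range (d + 1),
    ((h / 2) ^ (2 * k) / (2 * (k : ℂ) + 1)) • ((sl2Zp d).map Complex.ofReal) ^ (2 * k + 1)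

/-- The generator `Y` of `U_h(sl(2))` on `V^{(j)}`, determined by
`Z₋ = cosh (h X / 2) Y cosh (h X / 2)`. (The matrix `X` is strictly triangular, so
`cosh (h X / 2)` is unitriangular, hence invertible.) -/
def uhY (h : ℂ) (d : ℕ) : Matrix (Fin (d + 1)) (Fin (d + 1)) ℂ :=
  (matCosh ((h / 2) • uhX h d))⁻¹ * (sl2Zm d).map Complex.ofReal *
    (matCosh ((h / 2) • uhX h d))⁻¹

/-- `Δ(H) = H ⊗ e^{hX} + e^{-hX} ⊗ H` on `V^{(j₁)} ⊗ V^{(j₂)}`. -/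
def uhDeltaH (h : ℂ) (d₁ d₂ : ℕ) :
    Matrix (Fin (d₁ + 1) × Fin (d₂ + 1)) (Fin (d₁ + 1) × Fin (d₂ + 1)) ℂ :=
  uhH d₁ ⊗ₖ NormedSpace.exp (h • uhX h d₂) + NormedSpace.exp (-(h • uhX h d₁)) ⊗ₖ uhH d₂

/-- `Δ(X) = X ⊗ 1 + 1 ⊗ X` on `V^{(j₁)} ⊗ V^{(j₂)}`. -/
def uhDeltaX (h : ℂ) (d₁ d₂ : ℕ) :
    Matrix (Fin (d₁ + 1) × Fin (d₂ + 1)) (Fin (d₁ + 1) × Fin (d₂ + 1)) ℂ :=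
  lieCoproduct (uhX h d₁) (uhX h d₂)

/-- `Δ(Y) = Y ⊗ e^{hX} + e^{-hX} ⊗ Y` on `V^{(j₁)} ⊗ V^{(j₂)}`. -/
def uhDeltaY (h : ℂ) (d₁ d₂ : ℕ) :
    Matrix (Fin (d₁ + 1) × Fin (d₂ + 1)) (Fin (d₁ + 1) × Fin (d₂ + 1)) ℂ :=
  uhY h d₁ ⊗ₖ NormedSpace.exp (h • uhX h d₂) + NormedSpace.exp (-(h • uhX h d₁)) ⊗ₖ uhY h d₂

/-- `C (n₁, n₂) m` is the Clebsch–Gordan coefficient `𝒞^{j₁,j₂,j}_{n₁,n₂,m}(h)` of `U_h(sl(2))`: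
the columns of `C` are the coupled vectors `e^{(j₁j₂)j}_m = ∑ 𝒞_{n₁,n₂,m}(h) e_{n₁} ⊗ e_{n₂}`,
which transform under `Δ(H), Δ(X), Δ(Y)` as the vectors `e^j_m` do under `H, X, Y`. This fixes them
up to one common factor. The factor is fixed by requiring that in the highest vector `e^{(j₁j₂)j}_j`
the components with `n₁ + n₂ = j` form a unit vector, and that `𝒞_{j₁, j - j₁, j}(h)` is a
positive real number (for `h = 0` this is the usual normalization with the Condon–Shortley sign). -/
structure IsUhCG (h : ℂ) (d₁ d₂ d : ℕ)
    (C : Matrix (Fin (d₁ + 1) × Fin (d₂ + 1)) (Fin (d + 1)) ℂ) : Prop where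
  map_H : uhDeltaH h d₁ d₂ * C = C * uhH d
  map_X : uhDeltaX h d₁ d₂ * C = C * uhX h d
  map_Y : uhDeltaY h d₁ d₂ * C = C * uhY h d
  unit_leading :
    ∑ n₁ : Fin (d₁ + 1), ∑ n₂ : Fin (d₂ + 1),
      (if wt d₁ n₁ + wt d₂ n₂ = spin d then ‖C (n₁, n₂) (Fin.last d)‖ ^ 2 else 0) = 1
  condon_shortley : ∀ n₂ : Fin (d₂ + 1), spin d₁ + wt d₂ n₂ = spin d →
    ∃ r : ℝ, 0 < r ∧ C (Fin.last d₁, n₂) (Fin.last d) = (r : ℂ)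

end

set_option linter.unusedSimpArgs false

/-! The nonlinear change of generators that defines `X` and `Y` turns the deformed algebra back into
`sl(2)`, also on the tensor product. Put `T = (h/2) Z₊`, `a = (1 - T)⁻¹`, `b = (1 + T)⁻¹`. Then
`e^{hX} = 2a - 1`, `e^{-hX} = 2b - 1` and `cosh² (hX/2) = ab`, so the coproducts become rational in
`Z₊`. By the addition theorems for tanh and cosh, with `W = 1 + T ⊗ T` and `Q = Z₋ ⊗ a² + b² ⊗ Z₋`,
the operators `Δ(H)`, `W⁻¹ (Z₊ ⊗ 1 + 1 ⊗ Z₊)` and `W Q W` form an ordinary `sl(2)` triple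
(`tensorH_commutator`, `tensorE_commutator`).

Existence: a classical highest weight vector of weight `d = 2j`, multiplied by `(2a - 1) a ^ d` on
the first factor, is a highest weight vector for this triple (`tensorH_mul_highest`). Lowering it
with `W Q W` gives the coupled vectors as in the classical theory. The relations for `X` and `Y`
follow from those of the triple by comparing leading terms for the degree filtration
(`uhDeltaX_mul`, `uhDeltaY_mul`).

Uniqueness: with respect to degree, `Δ(H)` is its classical diagonal part plus strictly raising
terms. Hence an eigenvector is determined by its components in the degree of its eigenvalue and has
none below it. For a highest vector these components form a classical highest weight vector, unique
up to scale; the normalization fixes the scale and `Y` determines the other columns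
(`IsUhCG.unique`).

Dependence on `h`: giving `h` degree `-1` makes `h Z₊` homogeneous of degree zero, and every
operator in the construction is homogeneous with real coefficients. An entry is therefore a real
constant times `h` to the power `n₁ + n₂ - m`, and zero if this exponent is negative. The constants
with exponent zero are the values at `h = 0`, where the conditions reduce to the `su(2)` ones. -/

/-! ### Commutators with the inverses of `1 ∓ T`. -/

theorem inv_one_sub_commutator_raise {R : Type*} [Ring R] {H T a : R}
    (h1 : a * (1 - T) = 1) (h2 : (1 - T) * a = 1) (hH : H * T - T * H = 2 * T) :
    H * a - a * H = 2 * (a * a - a) := by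
  have h3 : T * a = a - 1 := by linear_combination (norm := noncomm_ring) -h2
  have h4 : a * (H * T - T * H) * a = H * a - a * H := by
    linear_combination (norm := noncomm_ring) h1 * H * a - a * H * h2
  rw [← h4, hH]
  linear_combination (norm := noncomm_ring) 2 * a * h3

theorem inv_one_sub_commutator {R : Type*} [Ring R] {F T K a : R}
    (h1 : a * (1 - T) = 1) (h2 : (1 - T) * a = 1) (hF : T * F - F * T = K) :
    a * F - F * a = a * K * a := by
  rw [← hF]
  linear_combination (norm := noncomm_ring)  h1 * F * a - a * F * h2

variable {A B R : Type*} [Ring A] [Ring B] [Ring R]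

/-- A normal-ordering computation: all commutators are used to bring each monomial to one order of
the factors. The terms that are left over are the two sides of `hK`, which agree when `K₁` and `K₂`
are the same scalar multiple of `H₁` and `H₂`. The terms with the factor 4 are what conjugation by
`W` removes later. -/
theorem jordanian_commutator (l : A →+* R) (r : B →+* R) (hlr : ∀ x y, l x * r y = r y * l x)
  {H₁ F₁ β K₁ : A} {H₂ F₂ α K₂ : B}
  (hF₁ : H₁ * F₁ - F₁ * H₁ = -2 * F₁) (hF₂ : H₂ * F₂ - F₂ * H₂ = -2 * F₂)
  (hβ : H₁ * β - β * H₁ = 2 * (β * β - β)) (hα : H₂ * α - α * H₂ = 2 * (α * α - α))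
  (hβF : β * F₁ - F₁ * β = - (β * K₁ * β)) (hαF : α * F₂ - F₂ * α = α * K₂ * α)
  (hK : l (β * K₁ * β) * r (α * H₂ * α) = l (β * H₁ * β) * r (α * K₂ * α)) :
  (l H₁ * r (2 * α - 1) + l (2 * β - 1) * r H₂) * (l F₁ * r (α * α) + l (β * β) * r F₂)
  - (l F₁ * r (α * α) + l (β * β) * r F₂) * (l H₁ * r (2 * α - 1) + l (2 * β - 1) * r H₂)
  = - 2 * (l F₁ * r (α * α) + l (β * β) * r F₂)
    - 4 * (l (1 - β) * r (α - 1) * (l F₁ * r (α * α) + l (β * β) * r F₂) +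
      (l F₁ * r (α * α) + l (β * β) * r F₂) * (l (1 - β) * r (α - 1))) := by
  have c : ∀ x y, r y * l x = l x * r y := fun x y => (hlr x y).symm
  have c' : ∀ x y z, r y * (l x * z) = l x * (r y * z) := fun x y z => by
    rw [← mul_assoc, c, mul_assoc]
  have e1 : l H₁ * l F₁ = l F₁ * l H₁ - 2 * l F₁ := by
    have := congrArg l hF₁
    simp only [map_sub, map_mul, map_neg, map_ofNat] at this
    linear_combination (norm := noncomm_ring) this
  have e2 : r H₂ * r F₂ = r F₂ * r H₂ - 2 * r F₂ := by
    have := congrArg r hF₂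
    simp only [map_sub, map_mul, map_neg, map_ofNat] at this
    linear_combination (norm := noncomm_ring) this
  have e3 : l H₁ * l β = l β * l H₁ + 2 * (l β * l β - l β) := by
    have := congrArg l hβ
    simp only [map_sub, map_mul, map_ofNat] at this
    linear_combination (norm := noncomm_ring) this
  have e4 : r H₂ * r α = r α * r H₂ + 2 * (r α * r α - r α) := by
    have := congrArg r hα
    simp only [map_sub, map_mul, map_ofNat] at this
    linear_combination (norm := noncomm_ring) this
  have e5 : l F₁ * l β = l β * l F₁ + l β * l K₁ * l β := by
    have := congrArg l hβF
    simp only [map_sub, map_mul, map_neg] at this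
    linear_combination (norm := noncomm_ring) -this
  have e6 : r F₂ * r α = r α * r F₂ - r α * r K₂ * r α := by
    have := congrArg r hαF
    simp only [map_sub, map_mul] at this
    linear_combination (norm := noncomm_ring) -this
  have re : ∀ {x y z : R}, x * y = z → ∀ w, x * (y * w) = z * w := fun h w => by
    rw [← mul_assoc, h]
  rw [← sub_eq_zero]
  simp only [map_sub, map_add, map_mul, map_ofNat, map_one] at hK ⊢
  simp only [mul_add, add_mul, mul_sub, sub_mul, mul_assoc, c, c', e1, e2, e3, e4, e5, e6, re e1, re e2, re e3,
    re e4, re e5, re e6, one_mul, mul_one, two_mul] at hK ⊢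
  linear_combination (norm := noncomm_ring) -2 * hK

/-- The relations of the `sl(2)` triple `(H, E, F)`, together with the inverses `a` of `1 - η E` and
`b` of `1 + η E`. -/
structure SpinRel {A : Type*} [Ring A] [Algebra ℂ A] (η : ℂ) (H E F a b : A) : Prop where
  HE : H * E - E * H = 2 * E
  HF : H * F - F * H = -2 * F
  EF : E * F - F * E = H
  inv_sub : a * (1 - η • E) = 1
  sub_inv : (1 - η • E) * a = 1
  inv_add : b * (1 + η • E) = 1
  add_inv : (1 + η • E) * b = 1

namespace SpinRel

variable {A : Type*} [Ring A] [Algebra ℂ A] {η : ℂ} {H E F a b : A}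

theorem HT (s : SpinRel η H E F a b) : H * (η • E) - (η • E) * H = 2 * (η • E) := by
  rw [mul_smul_comm, smul_mul_assoc, ← smul_sub, s.HE, mul_smul_comm]

theorem TF (s : SpinRel η H E F a b) : (η • E) * F - F * (η • E) = η • H := by
  rw [mul_smul_comm, smul_mul_assoc, ← smul_sub, s.EF]

theorem commutator_a (s : SpinRel η H E F a b) : H * a - a * H = 2 * (a * a - a) :=
  inv_one_sub_commutator_raise s.inv_sub s.sub_inv s.HT

theorem commutator_b (s : SpinRel η H E F a b) : H * b - b * H = 2 * (b * b - b) :=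
  inv_one_sub_commutator_raise (T := -(η • E)) (by rw [sub_neg_eq_add, s.inv_add])
    (by rw [sub_neg_eq_add, s.add_inv]) (by linear_combination (norm := noncomm_ring) -s.HT)

theorem a_F (s : SpinRel η H E F a b) : a * F - F * a = a * (η • H) * a :=
  inv_one_sub_commutator s.inv_sub s.sub_inv s.TF

theorem b_F (s : SpinRel η H E F a b) : b * F - F * b = -(b * (η • H) * b) := by
  rw [inv_one_sub_commutator (T := -(η • E)) (K := - (η • H)) (by rw [sub_neg_eq_add, s.inv_add])
    (by rw [sub_neg_eq_add, s.add_inv]) (by linear_combination (norm := noncomm_ring) -s.TF)]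
  noncomm_ring

theorem mul_a (s : SpinRel η H E F a b) : (η • E) * a = a - 1 := by
  linear_combination (norm := noncomm_ring) -s.sub_inv

theorem a_mul (s : SpinRel η H E F a b) : a * (η • E) = a - 1 := by
  linear_combination (norm := noncomm_ring) -s.inv_sub

theorem mul_b (s : SpinRel η H E F a b) : (η • E) * b = 1 - b := by
  linear_combination (norm := noncomm_ring) s.add_inv

theorem b_mul (s : SpinRel η H E F a b) : b * (η • E) = 1 - b := by
  linear_combination (norm := noncomm_ring) s.inv_add

theorem commute_a (s : SpinRel η H E F a b) : Commute E a := by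
  have h : E * (1 - η • E) = (1 - η • E) * E := by simp [mul_sub, sub_mul]
  calc E * a = a * (1 - η • E) * E * a := by rw [s.inv_sub, one_mul]
    _ = a * (E * (1 - η • E)) * a := by rw [h, mul_assoc a]
    _ = a * E := by rw [mul_assoc, mul_assoc, s.sub_inv, mul_one]

theorem commute_b (s : SpinRel η H E F a b) : Commute E b := by
  have h : E * (1 + η • E) = (1 + η • E) * E := by simp [mul_add, add_mul]
  calc E * b = b * (1 + η • E) * E * b := by rw [s.inv_add, one_mul]
    _ = b * (E * (1 + η • E)) * b := by rw [h, mul_assoc b]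
    _ = b * E := by rw [mul_assoc, mul_assoc, s.add_inv, mul_one]

end SpinRel

/-! ### The `sl(2)` triple on the tensor product. -/

section Tensor

variable {A B R : Type*} [Ring A] [Ring B] [Ring R] [Algebra ℂ A] [Algebra ℂ B] [Algebra ℂ R]

/-- The operator `Δ(H)` in terms of `l` and `r`, the actions on the two tensor factors. -/
def tensorH (l : A →ₐ[ℂ] R) (r : B →ₐ[ℂ] R) (H₁ b₁ : A) (H₂ a₂ : B) : R :=
  l H₁ * r (2 * a₂ - 1) + l (2 * b₁ - 1) * r H₂

/-- The denominator in the addition theorem for tanh, since `T` stands for `tanh (hX/2)`. -/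
def tensorW (l : A →ₐ[ℂ] R) (r : B →ₐ[ℂ] R) (η : ℂ) (E₁ : A) (E₂ : B) : R :=
  1 + l (η • E₁) * r (η • E₂)

/-- `Δ(Y)` multiplied on both sides by `cosh (hX/2) ⊗ cosh (hX/2)`, without the further factors `W`.
-/
def tensorQ (l : A →ₐ[ℂ] R) (r : B →ₐ[ℂ] R) (F₁ b₁ : A) (F₂ a₂ : B) : R :=
  l F₁ * r (a₂ * a₂) + l (b₁ * b₁) * r F₂

variable (l : A →ₐ[ℂ] R) (r : B →ₐ[ℂ] R)
  {η : ℂ} {H₁ E₁ F₁ a₁ b₁ : A} {H₂ E₂ F₂ a₂ b₂ : B}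
  (s₁ : SpinRel η H₁ E₁ F₁ a₁ b₁) (s₂ : SpinRel η H₂ E₂ F₂ a₂ b₂)

theorem tensorH_commutator_W
    (hlr : ∀ x y, l x * r y = r y * l x)
    (s₁ : SpinRel η H₁ E₁ F₁ a₁ b₁) (s₂ : SpinRel η H₂ E₂ F₂ a₂ b₂) :
    tensorH l r H₁ b₁ H₂ a₂ * tensorW l r η E₁ E₂ - tensorW l r η E₁ E₂ * tensorH l r H₁ b₁ H₂ a₂
      = 4 * (l (1 - b₁) * r (a₂ - 1)) * tensorW l r η E₁ E₂ := by
  have c : ∀ x y, r y * l x = l x * r y := fun x y => (hlr x y).symm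
  have c' : ∀ x y z, r y * (l x * z) = l x * (r y * z) := fun x y z => by
    rw [← mul_assoc, c, mul_assoc]
  have re : ∀ {x y z : R}, x * y = z → ∀ w, x * (y * w) = z * w := fun h w => by
    rw [← mul_assoc, h]
  have e1 := congrArg l s₁.HT
  have e2 := congrArg r s₂.HT
  have e3 := congrArg l s₁.mul_b
  have e4 := congrArg l s₁.b_mul
  have e5 := congrArg r s₂.mul_a
  have e6 := congrArg r s₂.a_mul
  simp only [tensorH, tensorW]
  generalize η • E₁ = T₁ at *
  generalize η • E₂ = T₂ at *
  simp only [map_sub, map_mul, map_one, map_ofNat] at e1 e2 e3 e4 e5 e6 ⊢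
  replace e1 := sub_eq_iff_eq_add'.mp e1
  replace e2 := sub_eq_iff_eq_add'.mp e2
  rw [← sub_eq_zero]
  simp only [mul_add, add_mul, mul_sub, sub_mul, mul_assoc, c, c', e1, e2, e3, e4, e5, e6, re e1,
    re e2, re e3, re e4, re e5, re e6, one_mul, mul_one, two_mul]
  noncomm_ring

theorem W_commute_inverses
    (hlr : ∀ x y, l x * r y = r y * l x)
    (s₁ : SpinRel η H₁ E₁ F₁ a₁ b₁) (s₂ : SpinRel η H₂ E₂ F₂ a₂ b₂) :
    l (1 - b₁) * r (a₂ - 1) * tensorW l r η E₁ E₂ =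
      tensorW l r η E₁ E₂ * (l (1 - b₁) * r (a₂ - 1)) := by
  have c : ∀ x y, r y * l x = l x * r y := fun x y => (hlr x y).symm
  have c' : ∀ x y z, r y * (l x * z) = l x * (r y * z) := fun x y z => by
    rw [← mul_assoc, c, mul_assoc]
  have re : ∀ {x y z : R}, x * y = z → ∀ w, x * (y * w) = z * w := fun h w => by
    rw [← mul_assoc, h]
  have e3 := congrArg l s₁.mul_b
  have e4 := congrArg l s₁.b_mul
  have e5 := congrArg r s₂.mul_a
  have e6 := congrArg r s₂.a_mul
  simp only [tensorW]
  generalize η • E₁ = T₁ at *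
  generalize η • E₂ = T₂ at *
  simp only [map_sub, map_mul, map_one] at e3 e4 e5 e6 ⊢
  simp only [mul_add, add_mul, mul_sub, sub_mul, mul_assoc, c, c', e3, e4, e5, e6,
    re e3, re e4, re e5, re e6, one_mul, mul_one]
  noncomm_ring

/-- With `P = (1 - b₁) ⊗ (a₂ - 1)`, the commutator of `Δ(H)` with `W` is `4 P W`, and the one with
`Q` is `-2 Q - 4 (P Q + Q P)`. As `P` commutes with `W`, the terms with `P` cancel in `W Q W`. -/
theorem tensorH_commutator
    (hlr : ∀ x y, l x * r y = r y * l x)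
    (s₁ : SpinRel η H₁ E₁ F₁ a₁ b₁) (s₂ : SpinRel η H₂ E₂ F₂ a₂ b₂) :
    tensorH l r H₁ b₁ H₂ a₂ *
        (tensorW l r η E₁ E₂ * tensorQ l r F₁ b₁ F₂ a₂ * tensorW l r η E₁ E₂)
      - (tensorW l r η E₁ E₂ * tensorQ l r F₁ b₁ F₂ a₂ * tensorW l r η E₁ E₂) *
        tensorH l r H₁ b₁ H₂ a₂
      = -2 * (tensorW l r η E₁ E₂ * tensorQ l r F₁ b₁ F₂ a₂ * tensorW l r η E₁ E₂) := by
  have hW := tensorH_commutator_W l r hlr s₁ s₂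
  have hP := W_commute_inverses l r hlr s₁ s₂
  have hQ : tensorH l r H₁ b₁ H₂ a₂ * tensorQ l r F₁ b₁ F₂ a₂
      - tensorQ l r F₁ b₁ F₂ a₂ * tensorH l r H₁ b₁ H₂ a₂ = -2 * tensorQ l r F₁ b₁ F₂ a₂ -
      4 * (l (1 - b₁) * r (a₂ - 1) * tensorQ l r F₁ b₁ F₂ a₂ +
      tensorQ l r F₁ b₁ F₂ a₂ * (l (1 - b₁) * r (a₂ - 1))) :=
    jordanian_commutator l.toRingHom r.toRingHom hlr s₁.HF s₂.HF s₁.commutator_b s₂.commutator_a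
      s₁.b_F s₂.a_F (by simp)
  generalize tensorW l r η E₁ E₂ = W at *
  generalize tensorQ l r F₁ b₁ F₂ a₂ = Q at *
  generalize tensorH l r H₁ b₁ H₂ a₂ = H at *
  generalize l (1 - b₁) * r (a₂ - 1) = P at *
  linear_combination (norm := noncomm_ring) hW * Q * W + W * Q * hW + W * hQ * W + 4 * hP * Q * W

/-- This is `[Δ(Z₊), Δ(Z₋)] = Δ(H)` for `Δ(Z₊) = W⁻¹ (E₁ + E₂)` and `Δ(Z₋) = W Q W`, in a form free
of `W⁻¹`, which is possible because `W` commutes with `E₁ + E₂`. -/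
theorem tensorE_commutator
    (hlr : ∀ x y, l x * r y = r y * l x)
    (s₁ : SpinRel η H₁ E₁ F₁ a₁ b₁) (s₂ : SpinRel η H₂ E₂ F₂ a₂ b₂) :
    (l E₁ + r E₂) * tensorQ l r F₁ b₁ F₂ a₂ * tensorW l r η E₁ E₂
      - tensorW l r η E₁ E₂ * tensorQ l r F₁ b₁ F₂ a₂ * (l E₁ + r E₂) =
    tensorH l r H₁ b₁ H₂ a₂ := by
  have c : ∀ x y, r y * l x = l x * r y := fun x y => (hlr x y).symm
  have c' : ∀ x y z, r y * (l x * z) = l x * (r y * z) := fun x y z => by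
    rw [← mul_assoc, c, mul_assoc]
  have re : ∀ {x y z : R}, x * y = z → ∀ w, x * (y * w) = z * w := fun h w => by
    rw [← mul_assoc, h]
  have e1 := congrArg l s₁.EF
  have e2 := congrArg r s₂.EF
  have e3 := congrArg l s₁.mul_b
  have e4 := congrArg l s₁.b_mul
  have e5 := congrArg r s₂.mul_a
  have e6 := congrArg r s₂.a_mul
  have e7 := congrArg l s₁.TF
  have e8 := congrArg r s₂.TF
  have f1 : E₁ * b₁ = b₁ * E₁ := s₁.commute_b
  have f2 : a₂ * E₂ = E₂ * a₂ := s₂.commute_a.symm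
  have f3 : E₁ * η • E₁ = η • E₁ * E₁ := by simp
  have f4 : η • E₂ * E₂ = E₂ * η • E₂ := by simp
  have f5 : η • H₁ * E₁ = H₁ * η • E₁ := by simp
  have f6 : η • H₂ * E₂ = H₂ * η • E₂ := by simp
  simp only [tensorH, tensorW, tensorQ]

  have e10 : l (η • H₁) * r E₂ = l H₁ * r (η • E₂) := by simp
  have e11 : l E₁ * r (η • H₂) = l (η • E₁) * r H₂ := by simp
  generalize η • E₁ = T₁ at *
  generalize η • E₂ = T₂ at *
  generalize η • H₁ = K₁ at *
  generalize η • H₂ = K₂ at *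
  replace f1 := congrArg l f1
  replace f2 := congrArg r f2
  replace f3 := congrArg l f3
  replace f4 := congrArg r f4
  replace f5 := congrArg l f5
  replace f6 := congrArg r f6
  simp only [map_sub, map_mul, map_one, map_ofNat] at f1 f2 f3 f4 f5 f6 e1 e2 e3 e4 e5 e6 e7 e8 e10 e11 ⊢
  replace e1 := sub_eq_iff_eq_add'.mp e1
  replace e2 := sub_eq_iff_eq_add'.mp e2
  replace e7 := sub_eq_iff_eq_add'.mp e7
  replace e8 := sub_eq_iff_eq_add'.mp e8
  rw [← sub_eq_zero]
  simp only [mul_add, add_mul, mul_sub, sub_mul, mul_assoc, c, c', e1, e2, e3, e4, e5, e6, re e1,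
    re e2, re e3, re e4, re e5, re e6, one_mul, mul_one, two_mul, e7, e8, re e7, re e8,
    f1, f2, f3, f4, f5, f6, re f1, re f2, re f3, re f4, re f5, re f6, e10, e11, re e10, re e11]
  noncomm_ring

end Tensor

/-! ### Functions of `Z₊` on the tensor product, and the twist of highest vectors. -/

namespace SpinRel

variable {A : Type*} [Ring A] [Algebra ℂ A] {η : ℂ} {H E F a b : A}

theorem commutator_a_pow (s : SpinRel η H E F a b) (n : ℕ) :
    H * a ^ n - a ^ n * H = (2 * n : ℂ) • (a ^ n * (a - 1)) := by
  induction n with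
  | zero => simp
  | succ n ih =>
    have h := s.commutator_a
    rw [pow_succ]
    have : H * (a ^ n * a) - a ^ n * a * H =
      (H * a ^ n - a ^ n * H) * a + a ^ n * (H * a - a * H) := by noncomm_ring
    rw [this, ih, h]
    have h2 : a ^ n * (2 * (a * a - a)) = (2 : ℂ) • (a ^ n * (a * (a - 1))) := by
      rw [two_smul]; noncomm_ring
    rw [h2, smul_mul_assoc, mul_assoc, mul_assoc, show (a - 1) * a = a * (a - 1) by noncomm_ring,
      ← add_smul]
    push_cast; ring_nf

/-- Partial fractions: `2 / (1 - T²) = 1 / (1 - T) + 1 / (1 + T)`. -/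
theorem two_mul_a_mul_b (s : SpinRel η H E F a b) : 2 * (a * b) = a + b := by
  have h1 := s.mul_b
  have h2 := s.a_mul
  generalize η • E = T at *
  linear_combination (norm := noncomm_ring) a * h1 - h2 * b

theorem two_mul_b_mul_a (s : SpinRel η H E F a b) : 2 * (b * a) = a + b := by
  have h1 := s.b_mul
  have h2 := s.mul_a
  generalize η • E = T at *
  linear_combination (norm := noncomm_ring) h1 * a - b * h2

theorem a_mul_b_mul (s : SpinRel η H E F a b) : a * b * (1 - (η • E) * (η • E)) = 1 := by
  have h1 := s.inv_add
  have h2 := s.inv_sub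
  generalize η • E = T at *
  linear_combination (norm := noncomm_ring) a * h1 * (1 - T) + h2

end SpinRel

section Tensor

variable {A B R : Type*} [Ring A] [Ring B] [Ring R] [Algebra ℂ A] [Algebra ℂ B] [Algebra ℂ R]
  (l : A →ₐ[ℂ] R) (r : B →ₐ[ℂ] R)
  {η : ℂ} {H₁ E₁ F₁ a₁ b₁ : A} {H₂ E₂ F₂ a₂ b₂ : B}

theorem tensorW_sq_sub (hlr : ∀ x y, l x * r y = r y * l x) (E₁ : A) (E₂ : B) :
    tensorW l r η E₁ E₂ * tensorW l r η E₁ E₂ -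
      (η • (l E₁ + r E₂)) * (η • (l E₁ + r E₂)) =
    l (1 - (η • E₁) * (η • E₁)) * r (1 - (η • E₂) * (η • E₂)) := by
  have c : ∀ x y, r y * l x = l x * r y := fun x y => (hlr x y).symm
  have c' : ∀ x y z, r y * (l x * z) = l x * (r y * z) := fun x y z => by
    rw [← mul_assoc, c, mul_assoc]
  rw [smul_add, ← map_smul, ← map_smul]
  simp only [tensorW]
  generalize η • E₁ = T₁ at *
  generalize η • E₂ = T₂ at *
  simp only [map_sub, map_mul, map_one]
  simp only [mul_add, add_mul, mul_sub, sub_mul, mul_assoc, c, c', one_mul, mul_one]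
  noncomm_ring

theorem tensorW_commute_add (hlr : ∀ x y, l x * r y = r y * l x) (E₁ : A) (E₂ : B) :
    Commute (tensorW l r η E₁ E₂) (l E₁ + r E₂) := by
  have c : ∀ x y, r y * l x = l x * r y := fun x y => (hlr x y).symm
  have c' : ∀ x y z, r y * (l x * z) = l x * (r y * z) := fun x y z => by
    rw [← mul_assoc, c, mul_assoc]
  simp only [commute_iff_eq, tensorW, map_smul, mul_add, add_mul, smul_mul_assoc, mul_smul_comm,
    mul_assoc, c, c', one_mul, mul_one]
  module

/-- Here `S = E / (1 - T²)` is half of `[H, X]`. Together with `tensorW_sq_sub`, the identity says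
that half of `[Δ(H), Δ(X)]` is the same function of `W⁻¹ (E₁ + E₂)` as `S` is of `E`. -/
theorem tensorS_mul (hlr : ∀ x y, l x * r y = r y * l x)
    (s₁ : SpinRel η H₁ E₁ F₁ a₁ b₁) (s₂ : SpinRel η H₂ E₂ F₂ a₂ b₂) {S₁ : A} {S₂ : B}
    (hS₁ : S₁ * (1 - (η • E₁) * (η • E₁)) = E₁) (hS₂ : S₂ * (1 - (η • E₂) * (η • E₂)) = E₂) :
    (l S₁ * r (2 * a₂ - 1) + l (2 * b₁ - 1) * r S₂) *
      (l (1 - (η • E₁) * (η • E₁)) * r (1 - (η • E₂) * (η • E₂))) =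
    (l E₁ + r E₂) * tensorW l r η E₁ E₂ := by
  have c : ∀ x y, r y * l x = l x * r y := fun x y => (hlr x y).symm
  have mm : ∀ x y x' y', (l x * r y) * (l x' * r y') = l (x * x') * r (y * y') := by
    intro x y x' y'
    rw [map_mul, map_mul, mul_assoc, ← mul_assoc (r y), ← hlr]; noncomm_ring
  have h₁ : (2 * b₁ - 1) * (1 - (η • E₁) * (η • E₁)) = (1 - η • E₁) * (1 - η • E₁) := by
    have := s₁.inv_add
    generalize η • E₁ = T at *
    linear_combination (norm := noncomm_ring) 2 * this * (1 - T)
  have h₂ : (2 * a₂ - 1) * (1 - (η • E₂) * (η • E₂)) = (1 + η • E₂) * (1 + η • E₂) := by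
    have := s₂.inv_sub
    generalize η • E₂ = T at *
    linear_combination (norm := noncomm_ring) 2 * this * (1 + T)
  rw [add_mul, mm, mm, hS₁, hS₂, h₁, h₂]
  have c' : ∀ x y z, r y * (l x * z) = l x * (r y * z) := fun x y z => by
    rw [← mul_assoc, c, mul_assoc]
  simp only [tensorW, map_smul, map_add, map_sub, map_mul, map_one, mul_add, add_mul, mul_sub,
    sub_mul, smul_mul_assoc, mul_smul_comm, mul_assoc, c, c', one_mul, mul_one]
  module

/-- Modulo the left ideal generated by `E₁ + E₂` one may replace `E₂` by `-E₁`, that is `a₂` by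
`b₁`. Since `2 b₁ - 1` is inverse to `2 a₁ - 1`, what remains is `a₁ ^ n (H₁ + H₂)` plus the
commutator of `H₁` with `a₁ ^ n`. On weight `n` the sum is `n (2 a₁ - 1) a₁ ^ n`, which explains the
form of the twist. -/
theorem tensorH_mul_highest (hlr : ∀ x y, l x * r y = r y * l x)
    (s₁ : SpinRel η H₁ E₁ F₁ a₁ b₁) (s₂ : SpinRel η H₂ E₂ F₂ a₂ b₂) (n : ℕ) :
    ∃ Y₁ Y₂ : R, tensorH l r H₁ b₁ H₂ a₂ * l ((2 * a₁ - 1) * a₁ ^ n) =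
      (n : ℂ) • l ((2 * a₁ - 1) * a₁ ^ n) + Y₁ * (l E₁ + r E₂) +
        Y₂ * (l H₁ + r H₂ - (n : ℂ) • 1) := by
  have c : ∀ x y, r y * l x = l x * r y := fun x y => (hlr x y).symm
  have hg : Commute E₁ ((2 * a₁ - 1) * a₁ ^ n) :=
    (((Nat.cast_commute 2 E₁).symm.mul_right s₁.commute_a).sub_right (Commute.one_right _)).mul_right
        (s₁.commute_a.pow_right n)
  have hinv : (2 * b₁ - 1) * (2 * a₁ - 1) = 1 := by
    have := s₁.two_mul_b_mul_a
    linear_combination (norm := noncomm_ring) 2 * this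
  -- The resolvent identity for `a₂ - b₁`: the difference of the inverted elements is a multiple of
  -- `E₁ + E₂`.
  have hα : r a₂ = l b₁ + η • (r a₂ * l b₁ * (l E₁ + r E₂)) := by
    have h1 := s₁.b_mul
    have h2 := s₂.a_mul
    have h3 : r a₂ * l b₁ * (η • (l E₁ + r E₂)) =
        r a₂ * l (b₁ * (η • E₁)) + l b₁ * r (a₂ * (η • E₂)) := by
      have c' : ∀ x y z, r y * (l x * z) = l x * (r y * z) := fun x y z => by
        rw [← mul_assoc, c, mul_assoc]
      simp only [map_mul, map_smul, smul_add, mul_add, mul_smul_comm, mul_assoc, c, c']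
    rw [← mul_smul_comm, h3, h1, h2, map_sub, map_sub, mul_sub, mul_sub, c b₁ a₂, map_one, map_one]
    noncomm_ring
  have hα' : r (2 * a₂ - 1) = l (2 * b₁ - 1) + (2 * η) • (r a₂ * l b₁ * (l E₁ + r E₂)) := by
    rw [map_sub, map_mul, map_one, map_ofNat, map_sub, map_mul, map_one, map_ofNat, two_mul,
      two_mul, mul_smul, two_smul, add_sub_right_comm, add_sub_right_comm]
    nth_rewrite 1 [hα]
    nth_rewrite 2 [hα]
    abel
  set g := (2 * a₁ - 1) * a₁ ^ n with hgd
  have hEg : (l E₁ + r E₂) * l g = l g * (l E₁ + r E₂) := by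
    rw [add_mul, mul_add, ← map_mul, hg.eq, map_mul, c]
  have hBg : (2 * b₁ - 1) * g = a₁ ^ n := by rw [hgd, ← mul_assoc, hinv, one_mul]
  have hHa : H₁ * a₁ ^ n = a₁ ^ n * H₁ + (2 * n : ℂ) • (a₁ ^ n * (a₁ - 1)) := by
    rw [← s₁.commutator_a_pow]; abel
  refine ⟨(2 * η) • (l H₁ * (r a₂ * l b₁ * l g)), l (a₁ ^ n), ?_⟩
  have h1 : tensorH l r H₁ b₁ H₂ a₂ * l g = l (H₁ * ((2 * b₁ - 1) * g)) +
      (2 * η) • (l H₁ * (r a₂ * l b₁ * ((l E₁ + r E₂) * l g))) +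
      l ((2 * b₁ - 1) * g) * r H₂ := by
    rw [tensorH, add_mul, mul_assoc _ (r H₂), c, hα']
    simp only [mul_add, add_mul, mul_assoc, map_mul, mul_smul_comm, smul_mul_assoc]
  rw [h1, hBg, hHa, hEg, map_add, map_smul, map_mul]
  have h2 : g = (2 : ℂ) • (a₁ ^ n * a₁) - a₁ ^ n := by
    rw [hgd, two_smul, sub_mul, two_mul, add_mul, one_mul, ← pow_succ', ← pow_succ]
  have h3 : (n : ℂ) • l g = (2 * n : ℂ) • l (a₁ ^ n * (a₁ - 1)) + (n : ℂ) • l (a₁ ^ n) := by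
    rw [h2]
    simp only [mul_sub, map_sub, map_smul, mul_one]
    module
  rw [h3]
  simp only [mul_add, add_mul, mul_sub, smul_mul_assoc, mul_smul_comm, mul_assoc, mul_one]
  module

end Tensor

/-! ### Matrices filtered by degree. -/

section Filtered

variable {ι κ μ R : Type*} [CommRing R]

/-- `M` raises the degree by at least `s`, where the basis vectors have degrees `p` and `q`. -/
def IsFiltered (p : ι → ℤ) (q : κ → ℤ) (s : ℤ) (M : Matrix ι κ R) : Prop :=
  ∀ i j, p i < q j + s → M i j = 0

namespace IsFiltered

variable {p : ι → ℤ} {q : κ → ℤ} {w : μ → ℤ} {s t : ℤ}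

theorem mono {M : Matrix ι κ R} (h : IsFiltered p q s M) (hst : t ≤ s) : IsFiltered p q t M :=
  fun i j hij => h i j (by lia)

theorem add {M N : Matrix ι κ R} (hM : IsFiltered p q s M) (hN : IsFiltered p q s N) :
    IsFiltered p q s (M + N) := fun i j hij => by
  rw [Matrix.add_apply, hM i j hij, hN i j hij, add_zero]

theorem neg {M : Matrix ι κ R} (hM : IsFiltered p q s M) : IsFiltered p q s (-M) :=
  fun i j hij => by rw [Matrix.neg_apply, hM i j hij, neg_zero]

theorem sub {M N : Matrix ι κ R} (hM : IsFiltered p q s M) (hN : IsFiltered p q s N) :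
    IsFiltered p q s (M - N) := sub_eq_add_neg M N ▸ hM.add hN.neg

theorem smul {M : Matrix ι κ R} (hM : IsFiltered p q s M) (c : R) : IsFiltered p q s (c • M) :=
  fun i j hij => by rw [Matrix.smul_apply, hM i j hij, smul_zero]

theorem zero : IsFiltered p q s (0 : Matrix ι κ R) := fun _ _ _ => rfl

theorem sum {α : Type*} {S : Finset α} {M : α → Matrix ι κ R}
    (hM : ∀ a ∈ S, IsFiltered p q s (M a)) : IsFiltered p q s (∑ a ∈ S, M a) := fun i j hij => by
  rw [Matrix.sum_apply]
  exact Finset.sum_eq_zero fun a ha => hM a ha i j hij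

theorem one [DecidableEq ι] : IsFiltered p p 0 (1 : Matrix ι ι R) := fun i j hij => by
  rw [Matrix.one_apply_ne]
  rintro rfl
  lia

theorem mul [Fintype κ] {M : Matrix ι κ R} {N : Matrix κ μ R} (hM : IsFiltered p q s M)
    (hN : IsFiltered q w t N) : IsFiltered p w (s + t) (M * N) := fun i j hij => by
  rw [Matrix.mul_apply]
  refine Finset.sum_eq_zero fun k _ => ?_
  by_cases h : p i < q k + s
  · rw [hM i k h, zero_mul]
  · rw [hN k j (by lia), mul_zero]

theorem pow [Fintype ι] [DecidableEq ι] {M : Matrix ι ι R} (hM : IsFiltered p p s M) (n : ℕ) :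
    IsFiltered p p (n * s) (M ^ n) := by
  induction n with
  | zero => simpa using one
  | succ n ih =>
    rw [pow_succ]
    exact (ih.mul hM).mono (by push_cast; lia)

theorem eq_zero {M : Matrix ι κ R} (hM : IsFiltered p q s M) (h : ∀ i j, p i < q j + s) : M = 0 :=
  Matrix.ext fun i j => hM i j (h i j)

end IsFiltered

end Filtered

/-! ### Families of matrices homogeneous in `h`. -/

section Homogeneous

variable {ι κ μ : Type*}

/-- The entries of `M h` are real multiples of powers of `h`, with the exponent given by the
difference of the degrees `p` and `q` of the basis vectors, diminished by `s`. -/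
def IsHomogeneousFamily (p : ι → ℤ) (q : κ → ℤ) (s : ℤ) (M : ℂ → Matrix ι κ ℂ) : Prop :=
  ∃ m : Matrix ι κ ℝ, ∀ h i j,
    M h i j = if q j + s ≤ p i then (m i j : ℂ) * h ^ (p i - q j - s).toNat else 0

namespace IsHomogeneousFamily

variable {p : ι → ℤ} {q : κ → ℤ} {w : μ → ℤ} {s t : ℤ}

theorem add {M N : ℂ → Matrix ι κ ℂ} (hM : IsHomogeneousFamily p q s M)
    (hN : IsHomogeneousFamily p q s N) : IsHomogeneousFamily p q s (fun h => M h + N h) := by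
  obtain ⟨m, hm⟩ := hM
  obtain ⟨n, hn⟩ := hN
  refine ⟨m + n, fun h i j => ?_⟩
  beta_reduce
  rw [Matrix.add_apply, hm, hn]
  split_ifs
  · rw [Matrix.add_apply]; push_cast; ring
  · simp

theorem real_smul {M : ℂ → Matrix ι κ ℂ} (hM : IsHomogeneousFamily p q s M) (r : ℝ) :
    IsHomogeneousFamily p q s (fun h => (r : ℂ) • M h) := by
  obtain ⟨m, hm⟩ := hM
  refine ⟨r • m, fun h i j => ?_⟩
  beta_reduce
  rw [Matrix.smul_apply, hm]
  split_ifs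
  · rw [Matrix.smul_apply, smul_eq_mul, smul_eq_mul]; push_cast; ring
  · simp

/-- A factor `h` adds one to every exponent, so it lowers the shift `s` by one; this is how `h Z₊ /
2` gets shift zero. -/
theorem half_smul {M : ℂ → Matrix ι κ ℂ} (hM : IsHomogeneousFamily p q s M) :
    IsHomogeneousFamily p q (s - 1) (fun h => (h / 2) • M h) := by
  obtain ⟨m, hm⟩ := hM
  -- The lower shift admits one more degree, in which the old coefficient is unconstrained and has
  -- to be set to zero.
  refine ⟨Matrix.of fun i j => if q j + s ≤ p i then m i j / 2 else 0, fun h i j => ?_⟩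
  beta_reduce
  rw [Matrix.smul_apply, hm]
  by_cases h1 : q j + s ≤ p i
  · rw [if_pos h1, if_pos (by lia), Matrix.of_apply, if_pos h1,
      show (p i - q j - (s - 1)).toNat = (p i - q j - s).toNat + 1 by lia]
    rw [pow_succ, smul_eq_mul]; push_cast; ring
  · simp [h1]

theorem zero : IsHomogeneousFamily p q s (fun _ => 0) := ⟨0, fun h i j => by simp⟩

theorem sum {α : Type*} {S : Finset α} {M : α → ℂ → Matrix ι κ ℂ}
    (hM : ∀ a, IsHomogeneousFamily p q s (M a)) :
    IsHomogeneousFamily p q s (fun h => ∑ a ∈ S, M a h) := by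
  classical
  induction S using Finset.induction_on with
  | empty => simpa using zero
  | insert a S ha ih => simpa only [Finset.sum_insert ha] using (hM a).add ih

theorem one [DecidableEq ι] : IsHomogeneousFamily p p 0 (fun _ => (1 : Matrix ι ι ℂ)) := by
  refine ⟨1, fun h i j => ?_⟩
  by_cases hij : i = j
  · subst hij; simp
  · simp [Matrix.one_apply_ne hij]

theorem mul [Fintype κ] {M : ℂ → Matrix ι κ ℂ} {N : ℂ → Matrix κ μ ℂ}
    (hM : IsHomogeneousFamily p q s M) (hN : IsHomogeneousFamily q w t N) :
    IsHomogeneousFamily p w (s + t) (fun h => M h * N h) := by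
  obtain ⟨m, hm⟩ := hM
  obtain ⟨n, hn⟩ := hN
  refine ⟨Matrix.of fun i j => ∑ k, if q k + s ≤ p i ∧ w j + t ≤ q k then m i k * n k j else 0,
    fun h i j => ?_⟩
  simp only [Matrix.mul_apply, hm, hn, Matrix.of_apply]
  split_ifs with h1
  · push_cast
    rw [Finset.sum_mul]
    refine Finset.sum_congr rfl fun k _ => ?_
    by_cases h2 : q k + s ≤ p i
    · by_cases h3 : w j + t ≤ q k
      · rw [if_pos h2, if_pos h3, if_pos ⟨h2, h3⟩, show (p i - w j - (s + t)).toNat =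
          (p i - q k - s).toNat + (q k - w j - t).toNat by lia, pow_add]
        push_cast; ring
      · simp [h3]
    · simp [h2]
  · refine Finset.sum_eq_zero fun k _ => ?_
    by_cases h2 : q k + s ≤ p i
    · rw [if_neg (show ¬ (w j + t ≤ q k) by lia), mul_zero]
    · rw [if_neg h2, zero_mul]

theorem pow [Fintype ι] [DecidableEq ι] {M : ℂ → Matrix ι ι ℂ} (hM : IsHomogeneousFamily p p 0 M)
    (n : ℕ) : IsHomogeneousFamily p p 0 (fun h => M h ^ n) := by
  induction n with
  | zero => simpa using one
  | succ n ih => simpa only [pow_succ] using add_zero (0 : ℤ) ▸ ih.mul hM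

theorem const {m : Matrix ι κ ℝ} (hm : ∀ i j, p i ≠ q j + s → m i j = 0) :
    IsHomogeneousFamily p q s (fun _ => m.map Complex.ofReal) := by
  refine ⟨m, fun h i j => ?_⟩
  by_cases hij : p i = q j + s
  · rw [if_pos hij.ge, hij]; simp
  · simp [hm i j hij]

end IsHomogeneousFamily

end Homogeneous

/-! ### Exponentials of nilpotent matrices. -/

section MatrixExp

variable {m : Type*} [Fintype m] [DecidableEq m]

theorem Matrix.exp_eq_sum_of_pow_eq_zero {A : Matrix m m ℂ} {n : ℕ} (h : A ^ n = 0) :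
    NormedSpace.exp A = ∑ k ∈ Finset.range n, ((k.factorial : ℂ)⁻¹) • A ^ k := by
  rw [NormedSpace.exp_eq_tsum ℂ]
  refine tsum_eq_sum fun k hk => ?_
  rw [pow_eq_zero_of_le (by simpa using hk) h, smul_zero]

/-- The commutator with `H` is a derivation and `B` commutes with `A`, so the exponential series can
be differentiated termwise as in the scalar case. -/
theorem Matrix.commutator_exp_of_pow_eq_zero {A H B : Matrix m m ℂ} {n : ℕ} (h : A ^ n = 0)
    (hH : H * A - A * H = B) (hAB : Commute A B) :
    H * NormedSpace.exp A - NormedSpace.exp A * H = B * NormedSpace.exp A := by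
  have hp : ∀ k : ℕ, H * A ^ (k + 1) - A ^ (k + 1) * H = ((k + 1 : ℕ) : ℂ) • (B * A ^ k) := by
    intro k
    induction k with
    | zero => simpa using hH
    | succ k ih =>
      have : H * A ^ (k + 1 + 1) - A ^ (k + 1 + 1) * H =
          (H * A ^ (k + 1) - A ^ (k + 1) * H) * A + A ^ (k + 1) * (H * A - A * H) := by
        rw [pow_succ _ (k + 1)]; noncomm_ring
      rw [this, ih, hH, (hAB.pow_left (k + 1)).eq, smul_mul_assoc, mul_assoc, ← pow_succ,
        Nat.cast_succ (k + 1), add_smul, one_smul]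
  -- The left side gets one more term than the right: its constant term drops out and the index
  -- shifts by one.
  have h1 : A ^ (n + 1) = 0 := by rw [pow_succ, h, zero_mul]
  have e1 := Matrix.exp_eq_sum_of_pow_eq_zero h1
  have e2 := Matrix.exp_eq_sum_of_pow_eq_zero h
  conv_lhs => rw [e1]
  conv_rhs => rw [e2]
  rw [Finset.mul_sum, Finset.sum_mul, ← Finset.sum_sub_distrib, Finset.sum_range_succ',
    Finset.mul_sum]
  simp only [mul_smul_comm, smul_mul_assoc, ← smul_sub, hp]
  simp only [pow_zero, mul_one, one_mul, sub_self, smul_zero, add_zero]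
  refine Finset.sum_congr rfl fun k _ => ?_
  rw [smul_smul]
  congr 1
  rw [Nat.factorial_succ]
  have : (k.factorial : ℂ) ≠ 0 := by exact_mod_cast k.factorial_ne_zero
  have : ((k + 1 : ℕ) : ℂ) ≠ 0 := by exact_mod_cast k.succ_ne_zero
  push_cast at *
  field_simp

theorem IsFiltered.exp_sub_one {p : m → ℤ} {A : Matrix m m ℂ} {n : ℕ} (h : A ^ n = 0)
    (hA : IsFiltered p p 1 A) : IsFiltered p p 1 (NormedSpace.exp A - 1) := by
  have h1 : A ^ (n + 1) = 0 := by rw [pow_succ, h, zero_mul]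
  rw [Matrix.exp_eq_sum_of_pow_eq_zero h1, Finset.sum_range_succ']
  simp only [Nat.factorial_zero, Nat.cast_one, inv_one, pow_zero, one_smul, add_sub_cancel_right]
  exact IsFiltered.sum fun k _ => ((hA.pow (k + 1)).smul _).mono (by push_cast; lia)

theorem Matrix.commute_exp_of_pow_eq_zero {A B : Matrix m m ℂ} {n : ℕ} (h : A ^ n = 0)
    (hAB : Commute A B) : Commute (NormedSpace.exp A) B := by
  rw [Matrix.exp_eq_sum_of_pow_eq_zero h]
  exact Commute.sum_left _ _ _ fun k _ => (hAB.pow_left k).smul_left _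

end MatrixExp

/-! ### The `sl(2)` triple on a single spin. -/

/-- The matrix element `√((j - m)(j + m + 1))` of `Z₊` for `d = 2j` and `i = j + m`. -/
noncomputable def ladder (d i : ℕ) : ℝ := Real.sqrt (((d : ℝ) - i) * (i + 1))

theorem ladder_pos {d i : ℕ} (h : i < d) : 0 < ladder d i := by
  have : (i : ℝ) < d := by exact_mod_cast h
  exact Real.sqrt_pos.mpr (mul_pos (by linarith) (by positivity))

theorem ladder_sq {d i : ℕ} (h : i ≤ d) : ladder d i * ladder d i = ((d : ℝ) - i) * (i + 1) := by
  have : (i : ℝ) ≤ d := by exact_mod_cast h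
  exact Real.mul_self_sqrt (mul_nonneg (by linarith) (by positivity))

theorem ladder_sq_complex {d i : ℕ} (h : i ≤ d) :
    (ladder d i : ℂ) * ladder d i = ((d : ℂ) - i) * (i + 1) := by
  exact_mod_cast ladder_sq h

theorem sl2Zp_apply (d : ℕ) (i j : Fin (d + 1)) :
    sl2Zp d i j = if (i : ℕ) = j + 1 then ladder d j else 0 := by
  simp only [sl2Zp, Matrix.of_apply, ladder, spin, wt]
  congr 2; ring_nf

theorem sl2Zm_apply (d : ℕ) (i j : Fin (d + 1)) :
    sl2Zm d i j = if (i : ℕ) + 1 = j then ladder d i else 0 := by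
  simp only [sl2Zm, Matrix.of_apply, ladder, spin, wt]
  split_ifs with h
  · rw [← h]; push_cast; ring_nf
  · rfl

theorem sl2H_apply_self (d : ℕ) (i : Fin (d + 1)) : sl2H d i i = 2 * i - d := by
  rw [sl2H, Matrix.diagonal_apply_eq, wt, spin]; ring

theorem sl2Zm_eq_transpose (d : ℕ) : sl2Zm d = (sl2Zp d).transpose := by
  ext i j
  rw [Matrix.transpose_apply, sl2Zm_apply, sl2Zp_apply]
  simp only [eq_comm]

/-- `Z₊` as a complex matrix. -/
noncomputable abbrev raise (d : ℕ) : Matrix (Fin (d + 1)) (Fin (d + 1)) ℂ := (sl2Zp d).map Complex.ofReal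

/-- `Z₋` as a complex matrix. -/
noncomputable abbrev lower (d : ℕ) : Matrix (Fin (d + 1)) (Fin (d + 1)) ℂ := (sl2Zm d).map Complex.ofReal

theorem raise_apply (d : ℕ) (i j : Fin (d + 1)) :
    raise d i j = if (i : ℕ) = j + 1 then (ladder d j : ℂ) else 0 := by
  simp only [raise, Matrix.map_apply, sl2Zp_apply]; split_ifs <;> simp

theorem lower_apply (d : ℕ) (i j : Fin (d + 1)) :
    lower d i j = if (i : ℕ) + 1 = j then (ladder d i : ℂ) else 0 := by
  simp only [lower, Matrix.map_apply, sl2Zm_apply]; split_ifs <;> simp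

theorem uhH_eq_diagonal (d : ℕ) : uhH d = Matrix.diagonal fun i : Fin (d + 1) => (2 * (i : ℕ) - d : ℂ) := by
  ext i j
  by_cases h : i = j
  · subst h
    rw [uhH, Matrix.map_apply, sl2H_apply_self, Matrix.diagonal_apply_eq]; push_cast; rfl
  · rw [uhH, Matrix.map_apply, sl2H, Matrix.diagonal_apply_ne _ h, Matrix.diagonal_apply_ne _ h]
    rfl

/-- The degree on `V^{(j)}`. -/
abbrev finDeg (d : ℕ) (i : Fin (d + 1)) : ℤ := (i : ℕ)

theorem raise_isFiltered (d : ℕ) : IsFiltered (finDeg d) (finDeg d) 1 (raise d) := fun i j hij => by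
  rw [raise_apply, if_neg]; simp only [finDeg] at hij; omega

theorem lower_isFiltered (d : ℕ) : IsFiltered (finDeg d) (finDeg d) (-1) (lower d) :=
  fun i j hij => by
  rw [lower_apply, if_neg]; simp only [finDeg] at hij; omega

theorem IsFiltered.pow_eq_zero {d : ℕ} {M : Matrix (Fin (d + 1)) (Fin (d + 1)) ℂ}
    (hM : IsFiltered (finDeg d) (finDeg d) 1 M) {n : ℕ} (hn : d < n) : M ^ n = 0 :=
  (hM.pow n).eq_zero fun i j => by simp only [finDeg]; omega

theorem uhH_raise (d : ℕ) : uhH d * raise d - raise d * uhH d = 2 * raise d := by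
  ext i j
  rw [uhH_eq_diagonal, Matrix.sub_apply, Matrix.diagonal_mul, Matrix.mul_diagonal,
    two_mul (raise d), Matrix.add_apply, raise_apply]
  split_ifs with h
  · rw [h]; push_cast; ring
  · ring

theorem uhH_lower (d : ℕ) : uhH d * lower d - lower d * uhH d = -2 * lower d := by
  ext i j
  rw [uhH_eq_diagonal, Matrix.sub_apply, Matrix.diagonal_mul, Matrix.mul_diagonal, neg_mul,
    two_mul (lower d), Matrix.neg_apply, Matrix.add_apply, lower_apply]
  split_ifs with h
  · rw [← h]; push_cast; ring
  · ring

theorem raise_mul_lower (d : ℕ) :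
    raise d * lower d = Matrix.diagonal fun i : Fin (d + 1) => ((i : ℕ) * (d - (i : ℕ) + 1) : ℂ) := by
  ext ⟨i, hi⟩ k
  rw [Matrix.mul_apply]
  simp only [raise_apply, lower_apply]
  cases i with
  | zero =>
    rw [Finset.sum_eq_zero fun x _ => by simp]
    by_cases h : (⟨0, hi⟩ : Fin (d + 1)) = k
    · subst h; simp
    · rw [Matrix.diagonal_apply_ne _ h]
  | succ i =>
    rw [Finset.sum_eq_single ⟨i, by omega⟩]
    · by_cases h : (⟨i + 1, hi⟩ : Fin (d + 1)) = k
      · subst h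
        rw [Matrix.diagonal_apply_eq]
        simp only [if_true]
        rw [ladder_sq_complex (by omega)]; push_cast; ring
      · rw [Matrix.diagonal_apply_ne _ h, if_neg (c := i + 1 = (k : ℕ)), mul_zero]
        simpa [Fin.ext_iff] using h
    · intro j _ hj
      rw [if_neg, zero_mul]
      simp only [ne_eq, Fin.ext_iff] at hj ⊢
      omega
    · simp

theorem lower_mul_raise (d : ℕ) :
    lower d * raise d = Matrix.diagonal fun i : Fin (d + 1) => ((d - (i : ℕ)) * ((i : ℕ) + 1) : ℂ) := by
  ext i k
  rw [Matrix.mul_apply]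
  simp only [raise_apply, lower_apply]
  by_cases hi : (i : ℕ) < d
  · rw [Finset.sum_eq_single ⟨i + 1, by omega⟩]
    · by_cases h : i = k
      · subst h
        rw [Matrix.diagonal_apply_eq]
        simp only [if_true]
        rw [ladder_sq_complex (by omega)]
      · rw [Matrix.diagonal_apply_ne _ h, if_neg (c := (i : ℕ) + 1 = k + 1), mul_zero]
        simpa [Fin.ext_iff] using h
    · intro j _ hj
      rw [if_neg, zero_mul]
      simp only [ne_eq, Fin.ext_iff] at hj ⊢
      omega
    · simp
  · rw [Finset.sum_eq_zero fun x _ => by rw [if_neg (by omega), zero_mul]]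
    by_cases h : i = k
    · subst h
      rw [Matrix.diagonal_apply_eq, show (i : ℕ) = d by omega]; ring
    · rw [Matrix.diagonal_apply_ne _ h]

theorem raise_lower (d : ℕ) : raise d * lower d - lower d * raise d = uhH d := by
  rw [raise_mul_lower, lower_mul_raise, uhH_eq_diagonal, Matrix.diagonal_sub]
  congr 1; funext i; ring

/-! ### The operators `X`, `e^{hX}`, `cosh (hX/2)` and `Y` on a single spin. -/

/-- The inverse `∑ η^k Z₊^k` of `1 - η Z₊`. -/
noncomputable def geom (η : ℂ) (d : ℕ) : Matrix (Fin (d + 1)) (Fin (d + 1)) ℂ :=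
  ∑ k ∈ Finset.range (d + 1), (η • raise d) ^ k

theorem spinRel (η : ℂ) (d : ℕ) :
    SpinRel η (uhH d) (raise d) (lower d) (geom η d) (geom (-η) d) := by
  have hn : ∀ ξ : ℂ, (ξ • raise d) ^ (d + 1) = 0 := fun ξ =>
    ((raise_isFiltered d).smul ξ).pow_eq_zero (Nat.lt_succ_self d)
  have h1 : ∀ ξ : ℂ, geom ξ d * (1 - ξ • raise d) = 1 := fun ξ => by
    rw [geom, geom_sum_mul_neg, hn, sub_zero]
  have h2 : ∀ ξ : ℂ, (1 - ξ • raise d) * geom ξ d = 1 := fun ξ => by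
    rw [geom, mul_neg_geom_sum, hn, sub_zero]
  exact ⟨uhH_raise d, uhH_lower d, raise_lower d, h1 η, h2 η,
    by have := h1 (-η); rwa [neg_smul, sub_neg_eq_add] at this,
    by have := h2 (-η); rwa [neg_smul, sub_neg_eq_add] at this⟩

theorem uhH_raise_pow (d n : ℕ) :
    uhH d * raise d ^ n - raise d ^ n * uhH d = (2 * n : ℂ) • raise d ^ n := by
  induction n with
  | zero => simp
  | succ n ih =>
    have : uhH d * raise d ^ (n + 1) - raise d ^ (n + 1) * uhH d =
        (uhH d * raise d ^ n - raise d ^ n * uhH d) * raise d +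
        raise d ^ n * (uhH d * raise d - raise d * uhH d) := by
      rw [pow_succ]; noncomm_ring
    rw [this, ih, uhH_raise, smul_mul_assoc, ← pow_succ, two_mul (raise d), mul_add, ← pow_succ]
    push_cast
    module

/-- `Z₊ (1 - η² Z₊²)⁻¹`, which is half of the commutator of `H` and `X`. -/
noncomputable def uhS (h : ℂ) (d : ℕ) : Matrix (Fin (d + 1)) (Fin (d + 1)) ℂ :=
  ∑ k ∈ Finset.range (d + 1), ((h / 2) ^ (2 * k)) • raise d ^ (2 * k + 1)

theorem uhH_uhX (h : ℂ) (d : ℕ) : uhH d * uhX h d - uhX h d * uhH d = 2 * uhS h d := by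
  rw [uhX, uhS, Finset.mul_sum, Finset.sum_mul, ← Finset.sum_sub_distrib, Finset.mul_sum]
  refine Finset.sum_congr rfl fun k _ => ?_
  rw [mul_smul_comm, smul_mul_assoc, ← smul_sub, uhH_raise_pow, smul_smul,
    two_mul (_ • _), ← two_smul ℂ, smul_smul]
  congr 1
  have : (2 * (k : ℂ) + 1) ≠ 0 := by exact_mod_cast (2 * k).succ_ne_zero
  push_cast
  field_simp

theorem uhS_mul (h : ℂ) (d : ℕ) :
    uhS h d * (1 - ((h / 2) • raise d) * ((h / 2) • raise d)) = raise d := by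
  -- Multiplying by `1 - T²` makes the series telescope; the end term is a power of `Z₊` beyond the
  -- nilpotency order.
  have := Finset.sum_range_sub' (fun k => ((h / 2) ^ (2 * k)) • raise d ^ (2 * k + 1)) (d + 1)
  rw [(raise_isFiltered d).pow_eq_zero (n := 2 * (d + 1) + 1) (by omega)] at this
  simp only [mul_zero, pow_zero, zero_add, pow_one, one_smul, smul_zero, sub_zero] at this
  rw [uhS, Finset.sum_mul]
  refine Eq.trans ?_ this
  refine Finset.sum_congr rfl fun k _ => ?_
  rw [mul_sub, mul_one, smul_mul_smul_comm, smul_mul_smul_comm, ← pow_two, ← pow_two, ← pow_add,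
    ← pow_add]
  ring_nf

theorem uhX_neg (h : ℂ) (d : ℕ) : uhX (-h) d = uhX h d := by
  simp only [uhX]
  refine Finset.sum_congr rfl fun k _ => ?_
  rw [neg_div, pow_mul, neg_sq, ← pow_mul]

theorem uhX_isFiltered (h : ℂ) (d : ℕ) : IsFiltered (finDeg d) (finDeg d) 1 (uhX h d) :=
  IsFiltered.sum fun k _ => (((raise_isFiltered d).pow (2 * k + 1)).smul _).mono (by push_cast; omega)

theorem uhX_sub_raise_isFiltered (h : ℂ) (d : ℕ) :
    IsFiltered (finDeg d) (finDeg d) 2 (uhX h d - raise d) := by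
  rw [uhX, Finset.sum_range_succ']
  simp only [mul_zero, pow_zero, Nat.cast_zero, zero_add, div_one, one_smul, pow_one,
    add_sub_cancel_right]
  exact IsFiltered.sum fun k _ =>
    (((raise_isFiltered d).pow (2 * (k + 1) + 1)).smul _).mono (by push_cast; omega)

theorem Commute.uhX {h : ℂ} {d : ℕ} {M : Matrix (Fin (d + 1)) (Fin (d + 1)) ℂ}
    (hM : Commute (raise d) M) : Commute (uhX h d) M :=
  Commute.sum_left _ _ _ fun _ _ => (hM.pow_left _).smul_left _

theorem Commute.uhS {h : ℂ} {d : ℕ} {M : Matrix (Fin (d + 1)) (Fin (d + 1)) ℂ}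
    (hM : Commute (raise d) M) : Commute (uhS h d) M :=
  Commute.sum_left _ _ _ fun _ _ => (hM.pow_left _).smul_left _

/-- The eigenvalues of `H` are distinct, so its commutant is diagonal, and the filtration condition
makes the diagonal entries 1. -/
theorem eq_one_of_commute_uhH {d : ℕ} {N : Matrix (Fin (d + 1)) (Fin (d + 1)) ℂ}
    (hN : uhH d * N = N * uhH d) (h1 : IsFiltered (finDeg d) (finDeg d) 1 (N - 1)) : N = 1 := by
  ext i j
  by_cases hij : i = j
  · subst hij
    have := h1 i i (by omega)
    rwa [Matrix.sub_apply, sub_eq_zero] at this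
  · have := congrFun (congrFun hN i) j
    rw [uhH_eq_diagonal, Matrix.diagonal_mul, Matrix.mul_diagonal] at this
    rw [Matrix.one_apply_ne hij]
    have h2 : ((i : ℕ) - (j : ℕ) : ℂ) * N i j = 0 := by linear_combination this / 2
    refine (mul_eq_zero.mp h2).resolve_left fun h3 => hij (Fin.ext ?_)
    exact_mod_cast sub_eq_zero.mp h3

theorem geom_sub_one_isFiltered (η : ℂ) (d : ℕ) :
    IsFiltered (finDeg d) (finDeg d) 1 (geom η d - 1) := by
  rw [geom, Finset.sum_range_succ', pow_zero, add_sub_cancel_right]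
  exact IsFiltered.sum fun k _ => (((raise_isFiltered d).smul η).pow (k + 1)).mono (by push_cast; omega)

/-- This is `e^{2 artanh T} = (1 + T) / (1 - T)`. The commutator with `H` plays the role of the
derivative: `e^{hX} (2b - 1)` commutes with `H` and is unipotent, hence equals 1, and `2b - 1` has
the inverse `2a - 1`. -/
theorem exp_smul_uhX (h : ℂ) (d : ℕ) :
    NormedSpace.exp (h • uhX h d) = 2 * geom (h / 2) d - 1 := by
  have s := spinRel (h / 2) d
  have hnil : (h • uhX h d) ^ (d + 1) = 0 :=
    ((uhX_isFiltered h d).smul h).pow_eq_zero (Nat.lt_succ_self d)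
  have hEX : Commute (raise d) (uhX h d) := (Commute.refl (raise d)).uhX.symm
  have hSX : Commute (h • uhX h d) (h • (2 * uhS h d)) :=
    ((((Nat.cast_commute 2 _).symm.mul_right (Commute.uhS hEX).symm).smul_right h).smul_left h)
  have hcomm := Matrix.commutator_exp_of_pow_eq_zero hnil (H := uhH d) (B := h • (2 * uhS h d))
    (by rw [mul_smul_comm, smul_mul_assoc, ← smul_sub, uhH_uhX]) hSX
  have hG1 := IsFiltered.exp_sub_one hnil ((uhX_isFiltered h d).smul h)
  have hEG : Commute (NormedSpace.exp (h • uhX h d)) (raise d) :=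
    Matrix.commute_exp_of_pow_eq_zero hnil (hEX.symm.smul_left h)
  have hB := s.commutator_b
  have hb1 := geom_sub_one_isFiltered (-(h / 2)) d
  have hGa := s.two_mul_b_mul_a
  set G := NormedSpace.exp (h • uhX h d)
  set a := geom (h / 2) d
  set b := geom (-(h / 2)) d
  -- The equality of logarithmic derivatives that makes the commutator of `H` with `G (2b - 1)`
  -- vanish.
  have hS : (h / 2) • uhS h d * (2 * b - 1) = b - b * b := by
    have h0 := congrArg ((h / 2) • ·) (uhS_mul h d)
    simp only [← smul_mul_assoc] at h0
    have h1 := s.inv_add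
    have h2 := s.add_inv
    have h3 := s.mul_b
    generalize (h / 2) • raise d = T at *
    generalize (h / 2) • uhS h d = S at *
    have h5 : (1 - T * T) * b * b = 2 * b - 1 := by
      linear_combination (norm := noncomm_ring) -T * h3 * b + h3 * b - h3
    linear_combination (norm := noncomm_ring) -S * h5 + h0 * b * b + h3 * b
  have hN : G * (2 * b - 1) = 1 := by
    refine eq_one_of_commute_uhH ?_ ?_
    · have h6 : uhH d * (G * (2 * b - 1)) - G * (2 * b - 1) * uhH d =
        (uhH d * G - G * uhH d) * (2 * b - 1) + G * (2 * (uhH d * b - b * uhH d)) := by noncomm_ring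
      have h8 : h • (2 * uhS h d) = 4 * ((h / 2) • uhS h d) := by
        rw [show (4 : Matrix (Fin (d + 1)) (Fin (d + 1)) ℂ) = 2 * 2 by norm_num]
        rw [mul_assoc]
        simp only [two_mul]
        module
      have h9 : (h / 2) • uhS h d * G = G * ((h / 2) • uhS h d) := by
        rw [smul_mul_assoc, mul_smul_comm, (Commute.uhS hEG.symm).eq]
      rw [← sub_eq_zero, h6, hcomm, hB, h8, mul_assoc 4, h9]
      generalize (h / 2) • uhS h d = S at *
      linear_combination (norm := noncomm_ring) 4 * G * hS
    · have : G * (2 * b - 1) - 1 = (G - 1) * (1 + 2 * (b - 1)) + 2 * (b - 1) := by noncomm_ring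
      have hb2 : IsFiltered (finDeg d) (finDeg d) 1 (2 * (b - 1)) := by
        rw [two_mul]; exact hb1.add hb1
      rw [this]
      exact (hG1.mul (t := 0) (IsFiltered.one.add (hb2.mono (by omega)))).add hb2
  have h7 : (2 * b - 1) * (2 * a - 1) = 1 := by
    linear_combination (norm := noncomm_ring) 2 * hGa
  calc G = G * ((2 * b - 1) * (2 * a - 1)) := by rw [h7, mul_one]
    _ = 2 * a - 1 := by rw [← mul_assoc, hN, one_mul]

theorem exp_neg_smul_uhX (h : ℂ) (d : ℕ) :
    NormedSpace.exp (-(h • uhX h d)) = 2 * geom (-(h / 2)) d - 1 := by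
  rw [← neg_smul, ← uhX_neg, exp_smul_uhX, neg_div]

/-- `cosh (h X / 2)`. -/
noncomputable abbrev coshX (h : ℂ) (d : ℕ) : Matrix (Fin (d + 1)) (Fin (d + 1)) ℂ :=
  matCosh ((h / 2) • uhX h d)

/-- Half-angle formula: the square is `(e^{hX} + 2 + e^{-hX}) / 4 = (a + b) / 2`, which is `ab` by
partial fractions. -/
theorem coshX_mul_self (h : ℂ) (d : ℕ) :
    coshX h d * coshX h d = geom (h / 2) d * geom (-(h / 2)) d := by
  have h1 : NormedSpace.exp ((h / 2) • uhX h d) * NormedSpace.exp ((h / 2) • uhX h d) =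
      2 * geom (h / 2) d - 1 := by
    rw [← Matrix.exp_add_of_commute _ _ (Commute.refl _), ← exp_smul_uhX, ← add_smul, add_halves]
  have h2 : NormedSpace.exp (-((h / 2) • uhX h d)) * NormedSpace.exp (-((h / 2) • uhX h d)) =
      2 * geom (-(h / 2)) d - 1 := by
    rw [← Matrix.exp_add_of_commute _ _ (Commute.refl _), ← exp_neg_smul_uhX, ← neg_add,
      ← add_smul, add_halves]
  have h3 : NormedSpace.exp ((h / 2) • uhX h d) * NormedSpace.exp (-((h / 2) • uhX h d)) = 1 := by
    rw [← Matrix.exp_add_of_commute _ _ (Commute.refl ((h / 2) • uhX h d)).neg_right, add_neg_cancel,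
      NormedSpace.exp_zero]
  have h4 : NormedSpace.exp (-((h / 2) • uhX h d)) * NormedSpace.exp ((h / 2) • uhX h d) = 1 := by
    rw [← Matrix.exp_add_of_commute _ _ (Commute.refl ((h / 2) • uhX h d)).neg_left, neg_add_cancel,
      NormedSpace.exp_zero]
  have h5 := (spinRel (h / 2) d).two_mul_a_mul_b
  rw [coshX, matCosh, smul_mul_smul_comm, add_mul, mul_add, mul_add, h1, h2, h3, h4]
  have h6 : 2 * geom (h / 2) d - 1 + 1 + (1 + (2 * geom (-(h / 2)) d - 1)) =
      (4 : ℂ) • (geom (h / 2) d * geom (-(h / 2)) d) := by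
    rw [show (4 : ℂ) = 2 * 2 by norm_num, mul_smul, two_smul ℂ (_ * _), ← two_mul, h5, two_smul]
    noncomm_ring
  rw [h6, smul_smul]
  norm_num

theorem smul_uhX_pow_eq_zero (c h : ℂ) (d : ℕ) : (c • uhX h d) ^ (d + 1) = 0 :=
  ((uhX_isFiltered h d).smul c).pow_eq_zero (Nat.lt_succ_self d)

theorem coshX_sub_one_isFiltered (h : ℂ) (d : ℕ) :
    IsFiltered (finDeg d) (finDeg d) 1 (coshX h d - 1) := by
  have h1 := IsFiltered.exp_sub_one (smul_uhX_pow_eq_zero (h / 2) h d)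
    ((uhX_isFiltered h d).smul _)
  have h2 := IsFiltered.exp_sub_one (smul_uhX_pow_eq_zero (-(h / 2)) h d)
    ((uhX_isFiltered h d).smul _)
  have h3 : coshX h d - 1 = (2⁻¹ : ℂ) • ((NormedSpace.exp ((h / 2) • uhX h d) - 1) +
      (NormedSpace.exp (-(h / 2) • uhX h d) - 1)) := by
    rw [coshX, matCosh, ← neg_smul]; module
  rw [h3]
  exact (h1.add h2).smul _

theorem commute_coshX (h : ℂ) (d : ℕ) : Commute (raise d) (coshX h d) := by
  have hEX : Commute (raise d) (uhX h d) := (Commute.refl (raise d)).uhX.symm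
  have h1 := Matrix.commute_exp_of_pow_eq_zero (smul_uhX_pow_eq_zero (h / 2) h d)
    (hEX.symm.smul_left _)
  have h2 := Matrix.commute_exp_of_pow_eq_zero (smul_uhX_pow_eq_zero (-(h / 2)) h d)
    (hEX.symm.smul_left _)
  rw [neg_smul] at h2
  exact (h1.add_left h2).symm.smul_right _

theorem coshX_mul (h : ℂ) (d : ℕ) :
    coshX h d * (coshX h d * (1 - ((h / 2) • raise d) * ((h / 2) • raise d))) = 1 := by
  rw [← mul_assoc, coshX_mul_self, (spinRel (h / 2) d).a_mul_b_mul]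

theorem inv_coshX (h : ℂ) (d : ℕ) :
    (coshX h d)⁻¹ = coshX h d * (1 - ((h / 2) • raise d) * ((h / 2) • raise d)) :=
  Matrix.inv_eq_right_inv (coshX_mul h d)

theorem isUnit_coshX (h : ℂ) (d : ℕ) : IsUnit (coshX h d) :=
  IsUnit.of_mul_eq_one _ (coshX_mul h d)

theorem coshX_uhY (h : ℂ) (d : ℕ) : coshX h d * uhY h d * coshX h d = lower d := by
  have hdet := (Matrix.isUnit_iff_isUnit_det _).mp (isUnit_coshX h d)
  rw [uhY, Matrix.mul_assoc, Matrix.mul_assoc, Matrix.nonsing_inv_mul _ hdet, Matrix.mul_one,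
    ← Matrix.mul_assoc, Matrix.mul_nonsing_inv _ hdet, Matrix.one_mul]

/-- `Y` differs from `Z₋` by unipotent factors on both sides, so its part of lowest degree is `Z₋`
itself. -/
theorem uhY_sub_lower_isFiltered (h : ℂ) (d : ℕ) :
    IsFiltered (finDeg d) (finDeg d) 0 (uhY h d - lower d) := by
  have h1 : IsFiltered (finDeg d) (finDeg d) 1 ((coshX h d)⁻¹ - 1) := by
    have hT := (raise_isFiltered d).smul (h / 2)
    have hc := coshX_sub_one_isFiltered h d
    have : (coshX h d)⁻¹ - 1 = (coshX h d - 1) -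
        ((coshX h d - 1) + 1) * (((h / 2) • raise d) * ((h / 2) • raise d)) := by
      rw [inv_coshX]; noncomm_ring
    rw [this]
    exact hc.sub ((((hc.mono (t := 0) (by omega)).add IsFiltered.one).mul (hT.mul hT)).mono
      (by omega))
  have hF := lower_isFiltered d
  have : uhY h d - lower d = ((coshX h d)⁻¹ - 1) * lower d * (((coshX h d)⁻¹ - 1) + 1) +
      lower d * ((coshX h d)⁻¹ - 1) := by
    rw [uhY]; noncomm_ring
  rw [this]
  exact ((h1.mul hF).mul ((h1.mono (by omega)).add IsFiltered.one)).add (hF.mul h1)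

/-! ### Degrees and algebra actions on a tensor product. -/

section Kronecker

variable {ι κ : Type*}

theorem IsFiltered.kronecker {p : ι → ℤ} {q : κ → ℤ} {s t : ℤ} {M : Matrix ι ι ℂ}
    {N : Matrix κ κ ℂ} (hM : IsFiltered p p s M) (hN : IsFiltered q q t N) :
    IsFiltered (fun x : ι × κ => p x.1 + q x.2) (fun x => p x.1 + q x.2) (s + t) (M ⊗ₖ N) := by
  intro x y hxy
  beta_reduce at hxy
  rw [Matrix.kronecker_apply]
  by_cases h : p x.1 < p y.1 + s
  · rw [hM _ _ h, zero_mul]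
  · rw [hN _ _ (by omega), mul_zero]

theorem IsHomogeneousFamily.kronecker {p : ι → ℤ} {q : κ → ℤ} {s t : ℤ} {M : ℂ → Matrix ι ι ℂ}
    {N : ℂ → Matrix κ κ ℂ} (hM : IsHomogeneousFamily p p s M) (hN : IsHomogeneousFamily q q t N) :
    IsHomogeneousFamily (fun x : ι × κ => p x.1 + q x.2) (fun x => p x.1 + q x.2) (s + t)
      (fun h => M h ⊗ₖ N h) := by
  obtain ⟨m, hm⟩ := hM
  obtain ⟨n, hn⟩ := hN
  refine ⟨Matrix.of fun x y => if p y.1 + s ≤ p x.1 ∧ q y.2 + t ≤ q x.2 then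
    m x.1 y.1 * n x.2 y.2 else 0, fun h x y => ?_⟩
  beta_reduce
  rw [Matrix.kronecker_apply, hm, hn, Matrix.of_apply]
  by_cases h1 : p y.1 + s ≤ p x.1
  · by_cases h2 : q y.2 + t ≤ q x.2
    · rw [if_pos h1, if_pos h2, if_pos (by omega), if_pos ⟨h1, h2⟩,
        show (p x.1 + q x.2 - (p y.1 + q y.2) - (s + t)).toNat =
          (p x.1 - p y.1 - s).toNat + (q x.2 - q y.2 - t).toNat by omega, pow_add]
      push_cast; ring
    · simp [h2]
  · simp [h1]

end Kronecker

section TensorAct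

variable {ι κ : Type*} [Fintype ι] [Fintype κ] [DecidableEq ι] [DecidableEq κ]

/-- The action on the first tensor factor. -/
noncomputable def leftAct (ι κ : Type*) [Fintype ι] [Fintype κ] [DecidableEq ι] [DecidableEq κ] :
    Matrix ι ι ℂ →ₐ[ℂ] Matrix (ι × κ) (ι × κ) ℂ :=
  AlgHom.ofLinearMap
    { toFun := fun x => x ⊗ₖ (1 : Matrix κ κ ℂ)
      map_add' := fun x y => Matrix.add_kronecker x y 1
      map_smul' := fun c x => Matrix.smul_kronecker c x 1 }
    Matrix.one_kronecker_one
    (fun x y => by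
      change (x * y) ⊗ₖ (1 : Matrix κ κ ℂ) = (x ⊗ₖ 1) * (y ⊗ₖ 1)
      rw [← Matrix.mul_kronecker_mul, Matrix.mul_one])

/-- The action on the second tensor factor. -/
noncomputable def rightAct (ι κ : Type*) [Fintype ι] [Fintype κ] [DecidableEq ι] [DecidableEq κ] :
    Matrix κ κ ℂ →ₐ[ℂ] Matrix (ι × κ) (ι × κ) ℂ :=
  AlgHom.ofLinearMap
    { toFun := fun y => (1 : Matrix ι ι ℂ) ⊗ₖ y
      map_add' := fun x y => Matrix.kronecker_add 1 x y
      map_smul' := fun c x => Matrix.kronecker_smul c 1 x }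
    Matrix.one_kronecker_one
    (fun x y => by
      change (1 : Matrix ι ι ℂ) ⊗ₖ (x * y) = (1 ⊗ₖ x) * (1 ⊗ₖ y)
      rw [← Matrix.mul_kronecker_mul, Matrix.mul_one])

theorem leftAct_apply (x : Matrix ι ι ℂ) : leftAct ι κ x = x ⊗ₖ (1 : Matrix κ κ ℂ) := rfl

theorem rightAct_apply (y : Matrix κ κ ℂ) : rightAct ι κ y = (1 : Matrix ι ι ℂ) ⊗ₖ y := rfl

theorem leftAct_mul_rightAct (x : Matrix ι ι ℂ) (y : Matrix κ κ ℂ) :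
    leftAct ι κ x * rightAct ι κ y = x ⊗ₖ y := by
  rw [leftAct_apply, rightAct_apply, ← Matrix.mul_kronecker_mul, Matrix.mul_one, Matrix.one_mul]

theorem rightAct_mul_leftAct (x : Matrix ι ι ℂ) (y : Matrix κ κ ℂ) :
    rightAct ι κ y * leftAct ι κ x = x ⊗ₖ y := by
  rw [leftAct_apply, rightAct_apply, ← Matrix.mul_kronecker_mul, Matrix.mul_one, Matrix.one_mul]

theorem leftAct_comm_rightAct (x : Matrix ι ι ℂ) (y : Matrix κ κ ℂ) :
    leftAct ι κ x * rightAct ι κ y = rightAct ι κ y * leftAct ι κ x := by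
  rw [leftAct_mul_rightAct, rightAct_mul_leftAct]

end TensorAct

/-! ### The deformed operators on the tensor product and the eigenvectors of `Δ(H)`. -/

section Pair

variable (h : ℂ) (d₁ d₂ : ℕ)

/-- The degree on `V^{(j₁)} ⊗ V^{(j₂)}`. -/
abbrev pairDeg (d₁ d₂ : ℕ) (x : Fin (d₁ + 1) × Fin (d₂ + 1)) : ℤ :=
  finDeg d₁ x.1 + finDeg d₂ x.2

abbrev PairMatrix (d₁ d₂ : ℕ) : Type :=
  Matrix (Fin (d₁ + 1) × Fin (d₂ + 1)) (Fin (d₁ + 1) × Fin (d₂ + 1)) ℂ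

noncomputable abbrev lAct (d₁ d₂ : ℕ) :
    Matrix (Fin (d₁ + 1)) (Fin (d₁ + 1)) ℂ →ₐ[ℂ] PairMatrix d₁ d₂ :=
  leftAct (Fin (d₁ + 1)) (Fin (d₂ + 1))

noncomputable abbrev rAct (d₁ d₂ : ℕ) :
    Matrix (Fin (d₂ + 1)) (Fin (d₂ + 1)) ℂ →ₐ[ℂ] PairMatrix d₁ d₂ :=
  rightAct (Fin (d₁ + 1)) (Fin (d₂ + 1))

/-- The undeformed coproduct of `Z₊`. -/
noncomputable def pairE : PairMatrix d₁ d₂ := lAct d₁ d₂ (raise d₁) + rAct d₁ d₂ (raise d₂)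

noncomputable def pairW : PairMatrix d₁ d₂ :=
  tensorW (lAct d₁ d₂) (rAct d₁ d₂) (h / 2) (raise d₁) (raise d₂)

noncomputable def pairQ : PairMatrix d₁ d₂ :=
  tensorQ (lAct d₁ d₂) (rAct d₁ d₂) (lower d₁) (geom (-(h / 2)) d₁) (lower d₂) (geom (h / 2) d₂)

/-- The action of `Z₋` on the tensor product. -/
noncomputable def pairF : PairMatrix d₁ d₂ := pairW h d₁ d₂ * pairQ h d₁ d₂ * pairW h d₁ d₂

theorem uhDeltaH_eq : uhDeltaH h d₁ d₂ = tensorH (lAct d₁ d₂) (rAct d₁ d₂) (uhH d₁)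
    (geom (-(h / 2)) d₁) (uhH d₂) (geom (h / 2) d₂) := by
  rw [tensorH, leftAct_mul_rightAct, leftAct_mul_rightAct, uhDeltaH, exp_smul_uhX,
    exp_neg_smul_uhX]

theorem uhDeltaX_eq : uhDeltaX h d₁ d₂ = lAct d₁ d₂ (uhX h d₁) + rAct d₁ d₂ (uhX h d₂) := rfl

theorem uhDeltaY_eq : uhDeltaY h d₁ d₂ =
    lAct d₁ d₂ (uhY h d₁) * rAct d₁ d₂ (2 * geom (h / 2) d₂ - 1) +
      lAct d₁ d₂ (2 * geom (-(h / 2)) d₁ - 1) * rAct d₁ d₂ (uhY h d₂) := by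
  rw [leftAct_mul_rightAct, leftAct_mul_rightAct, uhDeltaY, exp_smul_uhX, exp_neg_smul_uhX]

theorem uhDeltaH_pairF :
    uhDeltaH h d₁ d₂ * pairF h d₁ d₂ - pairF h d₁ d₂ * uhDeltaH h d₁ d₂ = -2 * pairF h d₁ d₂ := by
  rw [uhDeltaH_eq]
  exact tensorH_commutator _ _ leftAct_comm_rightAct (spinRel (h / 2) d₁) (spinRel (h / 2) d₂)

theorem pairE_pairQ_pairW :
    pairE d₁ d₂ * pairQ h d₁ d₂ * pairW h d₁ d₂ - pairW h d₁ d₂ * pairQ h d₁ d₂ * pairE d₁ d₂ =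
      uhDeltaH h d₁ d₂ := by
  rw [uhDeltaH_eq]
  exact tensorE_commutator _ _ leftAct_comm_rightAct (spinRel (h / 2) d₁) (spinRel (h / 2) d₂)

theorem pairW_commute_pairE : Commute (pairW h d₁ d₂) (pairE d₁ d₂) :=
  tensorW_commute_add _ _ leftAct_comm_rightAct _ _

theorem pairE_pairF : pairE d₁ d₂ * pairF h d₁ d₂ =
    pairW h d₁ d₂ * (pairW h d₁ d₂ * pairQ h d₁ d₂ * pairE d₁ d₂ + uhDeltaH h d₁ d₂) := by
  rw [← pairE_pairQ_pairW, pairF, add_sub_cancel, ← mul_assoc, ← mul_assoc,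
    ← (pairW_commute_pairE h d₁ d₂).eq]
  simp only [mul_assoc]

theorem pairW_sub_one : pairW h d₁ d₂ - 1 = ((h / 2) • raise d₁) ⊗ₖ ((h / 2) • raise d₂) := by
  rw [pairW, tensorW, add_sub_cancel_left, leftAct_mul_rightAct]

theorem pairW_sub_one_isFiltered :
    IsFiltered (pairDeg d₁ d₂) (pairDeg d₁ d₂) 1 (pairW h d₁ d₂ - 1) := by
  rw [pairW_sub_one]
  exact (((raise_isFiltered d₁).smul _).kronecker ((raise_isFiltered d₂).smul _)).mono (by omega)

/-- Degrees lie between 0 and `d₁ + d₂`, so a strictly raising matrix is nilpotent and 1 plus it is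
invertible. -/
theorem isUnit_of_isFiltered_sub_one {M : PairMatrix d₁ d₂}
    (hM : IsFiltered (pairDeg d₁ d₂) (pairDeg d₁ d₂) 1 (M - 1)) : IsUnit M := by
  have : IsNilpotent (M - 1) := ⟨d₁ + d₂ + 1, (hM.pow _).eq_zero fun x y => by
    have := x.1.2; have := x.2.2; simp only [pairDeg, finDeg]; push_cast; omega⟩
  simpa using this.isUnit_one_add

theorem isUnit_pairW : IsUnit (pairW h d₁ d₂) :=
  isUnit_of_isFiltered_sub_one d₁ d₂ (pairW_sub_one_isFiltered h d₁ d₂)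

theorem uhH_isFiltered (d : ℕ) : IsFiltered (finDeg d) (finDeg d) 0 (uhH d) := fun i j hij => by
  rw [uhH_eq_diagonal, Matrix.diagonal_apply_ne]
  rintro rfl
  omega

/-- The undeformed action of `H` on the tensor product. -/
theorem lAct_uhH_add_rAct_uhH : lAct d₁ d₂ (uhH d₁) + rAct d₁ d₂ (uhH d₂) =
    Matrix.diagonal fun x => (2 * (pairDeg d₁ d₂ x : ℂ) - (d₁ + d₂)) := by
  rw [leftAct_apply, rightAct_apply, uhH_eq_diagonal, uhH_eq_diagonal]
  ext x y
  rw [Matrix.add_apply, Matrix.kronecker_apply, Matrix.kronecker_apply]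
  by_cases hxy : x = y
  · subst hxy
    simp only [Matrix.diagonal_apply_eq, Matrix.one_apply_eq, pairDeg, finDeg]
    push_cast; ring
  · rw [Matrix.diagonal_apply_ne _ hxy]
    by_cases h1 : x.1 = y.1
    · have h2 : x.2 ≠ y.2 := fun h2 => hxy (Prod.ext h1 h2)
      rw [Matrix.one_apply_ne h2, Matrix.diagonal_apply_ne _ h2]; ring
    · rw [Matrix.one_apply_ne h1, Matrix.diagonal_apply_ne _ h1]; ring

theorem uhDeltaH_sub_diagonal_isFiltered :
    IsFiltered (pairDeg d₁ d₂) (pairDeg d₁ d₂) 1 (uhDeltaH h d₁ d₂ -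
      Matrix.diagonal fun x => (2 * (pairDeg d₁ d₂ x : ℂ) - (d₁ + d₂))) := by
  have h1 : uhDeltaH h d₁ d₂ - (lAct d₁ d₂ (uhH d₁) + rAct d₁ d₂ (uhH d₂)) =
      uhH d₁ ⊗ₖ ((2 : ℂ) • (geom (h / 2) d₂ - 1)) +
        ((2 : ℂ) • (geom (-(h / 2)) d₁ - 1)) ⊗ₖ uhH d₂ := by
    rw [uhDeltaH_eq, tensorH, ← leftAct_mul_rightAct, ← leftAct_mul_rightAct]
    simp only [two_smul, two_mul, map_add, map_sub, map_one]
    noncomm_ring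
  rw [← lAct_uhH_add_rAct_uhH, h1]
  exact ((uhH_isFiltered d₁).kronecker ((geom_sub_one_isFiltered _ d₂).smul 2)).add
    (((geom_sub_one_isFiltered _ d₁).smul 2).kronecker (uhH_isFiltered d₂))

variable {h d₁ d₂}

/-- Once the lower components vanish, the strictly raising part of `Δ(H)` contributes nothing at
`x`; there `Δ(H)` acts by its diagonal entry, which is the eigenvalue only in degree `k`. -/
theorem eigenvector_apply_eq_zero {u : Fin (d₁ + 1) × Fin (d₂ + 1) → ℂ} {k : ℤ}
    (hu : (uhDeltaH h d₁ d₂).mulVec u = (2 * (k : ℂ) - (d₁ + d₂)) • u)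
    {x : Fin (d₁ + 1) × Fin (d₂ + 1)} (hx : pairDeg d₁ d₂ x ≠ k)
    (hlow : ∀ y, pairDeg d₁ d₂ y < pairDeg d₁ d₂ x → u y = 0) : u x = 0 := by
  have h1 := uhDeltaH_sub_diagonal_isFiltered h d₁ d₂
  set D : PairMatrix d₁ d₂ := Matrix.diagonal fun x => (2 * (pairDeg d₁ d₂ x : ℂ) - (d₁ + d₂))
    with hD
  have h2 : ((uhDeltaH h d₁ d₂ - D).mulVec u) x = 0 := by
    refine Finset.sum_eq_zero fun y _ => ?_
    beta_reduce
    by_cases hy : pairDeg d₁ d₂ y < pairDeg d₁ d₂ x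
    · rw [hlow y hy, mul_zero]
    · rw [h1 x y (by omega), zero_mul]
  rw [Matrix.sub_mulVec, hu, Pi.sub_apply, hD, Matrix.mulVec_diagonal, Pi.smul_apply,
    smul_eq_mul] at h2
  have h3 : ((k - pairDeg d₁ d₂ x : ℤ) : ℂ) * u x = 0 := by
    push_cast at h2 ⊢
    linear_combination h2 / 2
  refine (mul_eq_zero.mp h3).resolve_left fun h4 => hx ?_
  have : k - pairDeg d₁ d₂ x = 0 := by exact_mod_cast h4
  omega

theorem eigenvector_apply_eq_zero_of_lt {u : Fin (d₁ + 1) × Fin (d₂ + 1) → ℂ} {k : ℤ}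
    (hu : (uhDeltaH h d₁ d₂).mulVec u = (2 * (k : ℂ) - (d₁ + d₂)) • u)
    {x : Fin (d₁ + 1) × Fin (d₂ + 1)} (hx : pairDeg d₁ d₂ x < k) : u x = 0 := by
  suffices H : ∀ n : ℕ, ∀ x : Fin (d₁ + 1) × Fin (d₂ + 1), pairDeg d₁ d₂ x = n →
      pairDeg d₁ d₂ x < k → u x = 0 from
    H (pairDeg d₁ d₂ x).toNat x (by simp only [pairDeg, finDeg]; omega) hx
  intro n
  induction n using Nat.strong_induction_on with
  | _ n ih =>
    intro x hn hx
    refine eigenvector_apply_eq_zero hu hx.ne fun y hy => ?_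
    exact ih (pairDeg d₁ d₂ y).toNat (by simp only [pairDeg, finDeg] at *; omega) y
      (by simp only [pairDeg, finDeg]; omega) (by omega)

/-- An eigenvector is determined by its components in the degree of its eigenvalue: all others
vanish successively, from the lowest degree upwards. -/
theorem eigenvector_eq_zero {u : Fin (d₁ + 1) × Fin (d₂ + 1) → ℂ} {k : ℤ}
    (hu : (uhDeltaH h d₁ d₂).mulVec u = (2 * (k : ℂ) - (d₁ + d₂)) • u)
    (hk : ∀ x, pairDeg d₁ d₂ x = k → u x = 0) : u = 0 := by
  suffices H : ∀ n : ℕ, ∀ x : Fin (d₁ + 1) × Fin (d₂ + 1), pairDeg d₁ d₂ x = n → u x = 0 from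
    funext fun x => H (pairDeg d₁ d₂ x).toNat x (by simp only [pairDeg, finDeg]; omega)
  intro n
  induction n using Nat.strong_induction_on with
  | _ n ih =>
    intro x hn
    by_cases hx : pairDeg d₁ d₂ x = k
    · exact hk x hx
    refine eigenvector_apply_eq_zero hu hx fun y hy => ?_
    exact ih (pairDeg d₁ d₂ y).toNat (by simp only [pairDeg, finDeg] at *; omega) y
      (by simp only [pairDeg, finDeg]; omega)

end Pair

/-! ### Classical and deformed highest weight vectors. -/

section HighestWeight

theorem uhX_last (h : ℂ) (d : ℕ) (i : Fin (d + 1)) : uhX h d i (Fin.last d) = 0 :=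
  uhX_isFiltered h d i _ (by simp only [finDeg, Fin.val_last]; omega)

/-- The coordinates of `u` extended by zero to all pairs of natural numbers. -/
def extendZero {d₁ d₂ : ℕ} (u : Fin (d₁ + 1) × Fin (d₂ + 1) → ℂ) (p q : ℕ) : ℂ :=
  if h : p < d₁ + 1 ∧ q < d₂ + 1 then u (⟨p, h.1⟩, ⟨q, h.2⟩) else 0

variable {d₁ d₂ : ℕ}

theorem extendZero_coe (u : Fin (d₁ + 1) × Fin (d₂ + 1) → ℂ) (x : Fin (d₁ + 1) × Fin (d₂ + 1)) :
    extendZero u x.1 x.2 = u x := by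
  rw [extendZero, dif_pos ⟨x.1.2, x.2.2⟩]

theorem raise_mulVec_apply {d : ℕ} (f : Fin (d + 1) → ℂ) (p : Fin (d + 1)) :
    (raise d).mulVec f p = if hp : (p : ℕ) = 0 then 0 else
      (ladder d (p - 1) : ℂ) * f ⟨p - 1, by omega⟩ := by
  rw [Matrix.mulVec, dotProduct]
  split_ifs with hp
  · exact Finset.sum_eq_zero fun j _ => by rw [raise_apply, if_neg (by omega), zero_mul]
  · rw [Finset.sum_eq_single ⟨p - 1, by omega⟩]
    · rw [raise_apply, if_pos (by simp only; omega)]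
    · intro j _ hj
      rw [raise_apply, if_neg, zero_mul]
      simp only [ne_eq, Fin.ext_iff] at hj
      omega
    · simp

theorem lAct_mulVec_apply (M : Matrix (Fin (d₁ + 1)) (Fin (d₁ + 1)) ℂ)
    (u : Fin (d₁ + 1) × Fin (d₂ + 1) → ℂ) (x : Fin (d₁ + 1) × Fin (d₂ + 1)) :
    (lAct d₁ d₂ M).mulVec u x = M.mulVec (fun i => u (i, x.2)) x.1 := by
  rw [leftAct_apply, Matrix.mulVec, dotProduct, Matrix.mulVec, dotProduct, Fintype.sum_prod_type]
  refine Finset.sum_congr rfl fun i _ => ?_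
  rw [Finset.sum_eq_single x.2]
  · rw [Matrix.kronecker_apply, Matrix.one_apply_eq, mul_one]
  · intro j _ hj
    rw [Matrix.kronecker_apply, Matrix.one_apply_ne hj.symm, mul_zero, zero_mul]
  · simp

theorem rAct_mulVec_apply (M : Matrix (Fin (d₂ + 1)) (Fin (d₂ + 1)) ℂ)
    (u : Fin (d₁ + 1) × Fin (d₂ + 1) → ℂ) (x : Fin (d₁ + 1) × Fin (d₂ + 1)) :
    (rAct d₁ d₂ M).mulVec u x = M.mulVec (fun j => u (x.1, j)) x.2 := by
  rw [rightAct_apply, Matrix.mulVec, dotProduct, Matrix.mulVec, dotProduct,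
    Fintype.sum_prod_type_right]
  refine Finset.sum_congr rfl fun i _ => ?_
  rw [Finset.sum_eq_single x.1]
  · rw [Matrix.kronecker_apply, Matrix.one_apply_eq, one_mul]
  · intro j _ hj
    rw [Matrix.kronecker_apply, Matrix.one_apply_ne hj.symm, zero_mul, zero_mul]
  · simp

theorem pairE_mulVec_apply (u : Fin (d₁ + 1) × Fin (d₂ + 1) → ℂ) (p q : ℕ)
    (hp : p < d₁ + 1) (hq : q < d₂ + 1) :
    (pairE d₁ d₂).mulVec u (⟨p, hp⟩, ⟨q, hq⟩) =
      (if p = 0 then 0 else (ladder d₁ (p - 1) : ℂ) * extendZero u (p - 1) q) +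
      (if q = 0 then 0 else (ladder d₂ (q - 1) : ℂ) * extendZero u p (q - 1)) := by
  rw [pairE, Matrix.add_mulVec, Pi.add_apply, lAct_mulVec_apply, rAct_mulVec_apply,
    raise_mulVec_apply, raise_mulVec_apply]
  congr 1
  · by_cases h0 : p = 0
    · simp [h0]
    · rw [dif_neg h0, if_neg h0, extendZero, dif_pos ⟨by omega, hq⟩]
  · by_cases h0 : q = 0
    · simp [h0]
    · rw [dif_neg h0, if_neg h0, extendZero, dif_pos ⟨hp, by omega⟩]

/-- A vector of degree `k` killed by `Z₊ ⊗ 1 + 1 ⊗ Z₊` vanishes if its component with the largest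
`n₁` does. -/
theorem eq_zero_of_pairE_of_top {u : Fin (d₁ + 1) × Fin (d₂ + 1) → ℂ} {k : ℤ}
    (hu : ∀ x, pairDeg d₁ d₂ x = k + 1 → (pairE d₁ d₂).mulVec u x = 0)
    (htop : ∀ j, pairDeg d₁ d₂ (Fin.last d₁, j) = k → u (Fin.last d₁, j) = 0)
    (x : Fin (d₁ + 1) × Fin (d₂ + 1)) (hx : pairDeg d₁ d₂ x = k) : u x = 0 := by
  suffices H : ∀ n p q : ℕ, p + n = d₁ → (p + q : ℤ) = k → q < d₂ + 1 → extendZero u p q = 0 by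
    rw [← extendZero_coe u x]
    exact H (d₁ - x.1) x.1 x.2 (by omega) hx x.2.2
  intro n
  induction n with
  | zero =>
    intro p q hp hk hq
    obtain rfl : p = d₁ := by omega
    rw [extendZero, dif_pos ⟨by omega, hq⟩]
    exact htop ⟨q, hq⟩ (by simpa [pairDeg, finDeg] using hk)
  | succ n ih =>
    intro p q hp hk hq
    -- At `(p + 1, q)` the image has two terms, from `(p, q)` and from `(p + 1, q - 1)`; the latter
    -- vanishes by induction.
    have h1 := hu (⟨p + 1, by omega⟩, ⟨q, hq⟩) (by simp only [pairDeg, finDeg]; push_cast; omega)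
    rw [pairE_mulVec_apply, if_neg (by omega), Nat.add_sub_cancel] at h1
    have h2 : (if q = 0 then 0 else (ladder d₂ (q - 1) : ℂ) * extendZero u (p + 1) (q - 1)) = 0 := by
      split_ifs with h0
      · rfl
      · rw [ih (p + 1) (q - 1) (by omega) (by omega) (by omega), mul_zero]
    rw [h2, add_zero] at h1
    refine (mul_eq_zero.mp h1).resolve_left ?_
    exact_mod_cast (ladder_pos (show p < d₁ by omega)).ne'

/-- `Z₊ ⊗ 1 + 1 ⊗ Z₊` is injective in low degrees. -/
theorem eq_zero_of_pairE_of_lt {u : Fin (d₁ + 1) × Fin (d₂ + 1) → ℂ} {k : ℤ}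
    (hu : ∀ x, pairDeg d₁ d₂ x = k + 1 → (pairE d₁ d₂).mulVec u x = 0) (hk : k < d₁)
    (x : Fin (d₁ + 1) × Fin (d₂ + 1)) (hx : pairDeg d₁ d₂ x = k) : u x = 0 :=
  eq_zero_of_pairE_of_top hu
    (fun j hj => by simp only [pairDeg, finDeg, Fin.val_last] at hj; omega) x hx

/-- The classical highest weight vector of degree `k = d₁ + d₂ - r`. -/
theorem exists_classical_highest {d r : ℕ} (hd : d₁ + d₂ = d + 2 * r) (h₁ : r ≤ d₁) (h₂ : r ≤ d₂) :
    ∃ w : Fin (d₁ + 1) × Fin (d₂ + 1) → ℝ,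
      (∀ x, pairDeg d₁ d₂ x ≠ d + r → w x = 0) ∧
      (pairE d₁ d₂).mulVec (fun x => (w x : ℂ)) = 0 ∧
      ∑ x, w x ^ 2 = 1 ∧ ∀ j, pairDeg d₁ d₂ (Fin.last d₁, j) = d + r → 0 < w (Fin.last d₁, j) := by
  set A : ℕ → ℕ → ℝ := fun d i => ∏ l ∈ Finset.range i, ladder d l with hA
  have hAs : ∀ d i, i ≠ 0 → A d i = A d (i - 1) * ladder d (i - 1) := fun d i hi => by
    obtain ⟨i, rfl⟩ := Nat.exists_eq_succ_of_ne_zero hi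
    simp only [hA, Finset.prod_range_succ, Nat.succ_eq_add_one, Nat.add_sub_cancel]
  have hApos : ∀ d i, i ≤ d → 0 < A d i := fun d i hi =>
    Finset.prod_pos fun l hl => ladder_pos (by have := Finset.mem_range.mp hl; omega)
  -- The products of ladder coefficients absorb the coefficients of `Z₊`, so the alternating sign
  -- makes the two terms of the image cancel. At `n₁ = j₁` the sign is positive, as Condon and
  -- Shortley require.
  set v : Fin (d₁ + 1) × Fin (d₂ + 1) → ℝ := fun x =>
    if pairDeg d₁ d₂ x = d + r then (-1) ^ (d₁ - x.1) * A d₁ x.1 * A d₂ x.2 else 0 with hv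
  have htop : ∀ j, pairDeg d₁ d₂ (Fin.last d₁, j) = d + r → 0 < v (Fin.last d₁, j) := fun j hj => by
    simp only [hv]
    rw [if_pos hj]
    simp only [Fin.val_last, Nat.sub_self, pow_zero, one_mul]
    exact mul_pos (hApos _ _ le_rfl) (hApos _ _ (by omega))
  have hE : (pairE d₁ d₂).mulVec (fun x => (v x : ℂ)) = 0 := by
    funext ⟨⟨p, hp⟩, ⟨q, hq⟩⟩
    rw [pairE_mulVec_apply, Pi.zero_apply]
    by_cases hpq : (p + q : ℤ) = d + r + 1
    · rw [if_neg (by omega), if_neg (by omega), extendZero, extendZero, dif_pos ⟨by omega, hq⟩,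
        dif_pos ⟨hp, by omega⟩]
      simp only [hv, pairDeg, finDeg]
      rw [if_pos (by omega), if_pos (by omega), hAs d₁ p (by omega), hAs d₂ q (by omega),
        show d₁ - (p - 1) = d₁ - p + 1 by omega]
      push_cast
      ring
    · have e1 : ∀ p q : ℕ, (p + q : ℤ) ≠ d + r → extendZero (fun x : Fin (d₁ + 1) × Fin (d₂ + 1) =>
          (v x : ℂ)) p q = 0 := fun p q h => by
        rw [extendZero]
        split_ifs with h0
        · simp only [hv, pairDeg, finDeg]
          rw [if_neg h, Complex.ofReal_zero]
        · rfl
      have e2 : (if p = 0 then 0 else (ladder d₁ (p - 1) : ℂ) *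
          extendZero (fun x : Fin (d₁ + 1) × Fin (d₂ + 1) => (v x : ℂ)) (p - 1) q) = 0 := by
        split_ifs
        · rfl
        · rw [e1 _ _ (by omega), mul_zero]
      have e3 : (if q = 0 then 0 else (ladder d₂ (q - 1) : ℂ) *
          extendZero (fun x : Fin (d₁ + 1) × Fin (d₂ + 1) => (v x : ℂ)) p (q - 1)) = 0 := by
        split_ifs
        · rfl
        · rw [e1 _ _ (by omega), mul_zero]
      rw [e2, e3, add_zero]
  set n : ℝ := ∑ x, v x ^ 2 with hn
  have hnpos : 0 < n := by
    refine Finset.sum_pos' (fun x _ => sq_nonneg _)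
      ⟨(Fin.last d₁, ⟨d₂ - r, by omega⟩), Finset.mem_univ _, pow_pos (htop _ ?_) 2⟩
    simp only [pairDeg, finDeg, Fin.val_last]
    omega
  refine ⟨fun x => (Real.sqrt n)⁻¹ * v x, fun x hx => ?_, ?_, ?_, fun j hj => ?_⟩
  · simp only [hv]
    rw [if_neg hx, mul_zero]
  · have : (fun x => (((Real.sqrt n)⁻¹ * v x : ℝ) : ℂ)) =
        (((Real.sqrt n)⁻¹ : ℝ) : ℂ) • (fun x => (v x : ℂ)) := by
      funext x; simp
    rw [this, Matrix.mulVec_smul, hE, smul_zero]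
  · simp only [mul_pow]
    rw [← Finset.mul_sum, inv_pow, Real.sq_sqrt hnpos.le, inv_mul_cancel₀ hnpos.ne']
  · exact mul_pos (inv_pos.mpr (Real.sqrt_pos.mpr hnpos)) (htop j hj)

/-- The operator that deforms a classical highest weight vector. -/
noncomputable def highestTwist (h : ℂ) (d₁ d₂ d : ℕ) : PairMatrix d₁ d₂ :=
  lAct d₁ d₂ ((2 * geom (h / 2) d₁ - 1) * geom (h / 2) d₁ ^ d)

/-- The twist is unipotent, so it leaves the leading components of the classical vector, and with
them the normalization, unchanged. -/
theorem highestTwist_sub_one_isFiltered (h : ℂ) (d₁ d₂ d : ℕ) :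
    IsFiltered (pairDeg d₁ d₂) (pairDeg d₁ d₂) 1 (highestTwist h d₁ d₂ d - 1) := by
  have h1 := geom_sub_one_isFiltered (h / 2) d₁
  set a := geom (h / 2) d₁
  have ha : IsFiltered (finDeg d₁) (finDeg d₁) 0 a := by
    have := (h1.mono (t := 0) (by omega)).add IsFiltered.one
    rwa [sub_add_cancel] at this
  have h2 : ∀ n : ℕ, IsFiltered (finDeg d₁) (finDeg d₁) 1 (a ^ n - 1) := fun n => by
    induction n with
    | zero => simpa using IsFiltered.zero
    | succ n ih =>
      have : a ^ (n + 1) - 1 = a ^ n * (a - 1) + (a ^ n - 1) := by rw [pow_succ]; noncomm_ring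
      rw [this]
      exact (((ha.pow n).mul h1).mono (by simp)).add ih
  have h3 : (2 * a - 1) * a ^ d - 1 = (2 : ℂ) • ((a - 1) * a ^ d) + (a ^ d - 1) := by
    rw [two_smul]; noncomm_ring
  have h4 : IsFiltered (finDeg d₁) (finDeg d₁) 1 ((2 * a - 1) * a ^ d - 1) := by
    rw [h3]
    exact (((h1.mul (ha.pow d)).mono (by simp)).smul 2).add (h2 d)
  have h5 : highestTwist h d₁ d₂ d - 1 = ((2 * a - 1) * a ^ d - 1) ⊗ₖ 1 := by
    rw [← leftAct_apply, map_sub, map_one]; rfl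
  rw [h5]
  exact h4.kronecker IsFiltered.one

theorem pairE_highestTwist (h : ℂ) (d₁ d₂ d : ℕ) :
    Commute (pairE d₁ d₂) (highestTwist h d₁ d₂ d) := by
  have h1 := (spinRel (h / 2) d₁).commute_a
  have h2 : Commute (raise d₁) ((2 * geom (h / 2) d₁ - 1) * geom (h / 2) d₁ ^ d) :=
    (((Nat.cast_commute 2 _).symm.mul_right h1).sub_right (Commute.one_right _)).mul_right
      (h1.pow_right d)
  exact (h2.map (lAct d₁ d₂)).add_left (leftAct_comm_rightAct _ _).symm

theorem uhDeltaH_highestTwist (h : ℂ) {d₁ d₂ d : ℕ} {v : Fin (d₁ + 1) × Fin (d₂ + 1) → ℂ}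
    (hE : (pairE d₁ d₂).mulVec v = 0)
    (hH : (lAct d₁ d₂ (uhH d₁) + rAct d₁ d₂ (uhH d₂)).mulVec v = (d : ℂ) • v) :
    (uhDeltaH h d₁ d₂).mulVec ((highestTwist h d₁ d₂ d).mulVec v) =
      (d : ℂ) • (highestTwist h d₁ d₂ d).mulVec v := by
  obtain ⟨Y₁, Y₂, hY⟩ := tensorH_mul_highest (lAct d₁ d₂) (rAct d₁ d₂) leftAct_comm_rightAct
    (spinRel (h / 2) d₁) (spinRel (h / 2) d₂) d
  rw [Matrix.mulVec_mulVec, uhDeltaH_eq, highestTwist, hY, Matrix.add_mulVec, Matrix.add_mulVec,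
    ← Matrix.mulVec_mulVec, ← Matrix.mulVec_mulVec, Matrix.sub_mulVec, hH, Matrix.smul_mulVec,
    Matrix.smul_mulVec, Matrix.one_mulVec, sub_self, Matrix.mulVec_zero, add_zero]
  erw [hE]
  rw [Matrix.mulVec_zero, add_zero]

end HighestWeight

/-! ### The tower of coupled vectors below the highest one. -/

section Tower

/-- The coupled vectors, from the highest one down. -/
noncomputable def coupledVec (h : ℂ) (d₁ d₂ d : ℕ) (v : Fin (d₁ + 1) × Fin (d₂ + 1) → ℂ) :
    ℕ → Fin (d₁ + 1) × Fin (d₂ + 1) → ℂ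
  | 0 => (highestTwist h d₁ d₂ d).mulVec v
  | n + 1 => (((ladder d (d - 1 - n))⁻¹ : ℝ) : ℂ) •
      (pairF h d₁ d₂).mulVec (coupledVec h d₁ d₂ d v n)

variable {h : ℂ} {d₁ d₂ d r : ℕ} {v : Fin (d₁ + 1) × Fin (d₂ + 1) → ℂ}

theorem uhDeltaH_pairF_mulVec {u : Fin (d₁ + 1) × Fin (d₂ + 1) → ℂ} {c : ℂ}
    (hu : (uhDeltaH h d₁ d₂).mulVec u = c • u) :
    (uhDeltaH h d₁ d₂).mulVec ((pairF h d₁ d₂).mulVec u) = (c - 2) • (pairF h d₁ d₂).mulVec u := by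
  have h1 : uhDeltaH h d₁ d₂ * pairF h d₁ d₂ =
      pairF h d₁ d₂ * uhDeltaH h d₁ d₂ - (2 : ℂ) • pairF h d₁ d₂ := by
    rw [two_smul]
    linear_combination (norm := noncomm_ring) uhDeltaH_pairF h d₁ d₂
  rw [Matrix.mulVec_mulVec, h1, Matrix.sub_mulVec, ← Matrix.mulVec_mulVec, hu, Matrix.mulVec_smul,
    Matrix.smul_mulVec, sub_smul]

theorem uhDeltaH_coupledVec (hE : (pairE d₁ d₂).mulVec v = 0)
    (hH : (lAct d₁ d₂ (uhH d₁) + rAct d₁ d₂ (uhH d₂)).mulVec v = (d : ℂ) • v) (n : ℕ) :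
    (uhDeltaH h d₁ d₂).mulVec (coupledVec h d₁ d₂ d v n) =
      (d - 2 * n : ℂ) • coupledVec h d₁ d₂ d v n := by
  induction n with
  | zero => simpa [coupledVec] using uhDeltaH_highestTwist h hE hH
  | succ n ih =>
    rw [coupledVec, Matrix.mulVec_smul, uhDeltaH_pairF_mulVec ih, smul_comm]
    congr 1
    push_cast; ring

theorem pairE_coupledVec_zero (hE : (pairE d₁ d₂).mulVec v = 0) :
    (pairE d₁ d₂).mulVec (coupledVec h d₁ d₂ d v 0) = 0 := by
  rw [coupledVec, Matrix.mulVec_mulVec, (pairE_highestTwist h d₁ d₂ d).eq, ← Matrix.mulVec_mulVec,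
    hE, Matrix.mulVec_zero]

theorem pairF_coupledVec {n : ℕ} (hn : n < d) : (pairF h d₁ d₂).mulVec (coupledVec h d₁ d₂ d v n) =
    (ladder d (d - 1 - n) : ℂ) • coupledVec h d₁ d₂ d v (n + 1) := by
  have : (ladder d (d - 1 - n) : ℂ) ≠ 0 := by
    exact_mod_cast (ladder_pos (show d - 1 - n < d by omega)).ne'
  rw [coupledVec, smul_smul]
  push_cast
  rw [mul_inv_cancel₀ this, one_smul]

theorem ladder_rev_sq {n : ℕ} (hn : n < d) :
    (ladder d (d - 1 - n) : ℂ) * ladder d (d - 1 - n) = (n + 1) * (d - n) := by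
  rw [ladder_sq_complex (by omega), Nat.sub_sub, Nat.cast_sub (by omega)]
  push_cast; ring

/-- The usual `sl(2)` induction for `Z₊ Z₋` on the `n`-th lowered vector. The factor `W` appears
because the undeformed `E₁ + E₂` equals `W` times the deformed raising operator. -/
theorem pairE_pairF_coupledVec (hE : (pairE d₁ d₂).mulVec v = 0)
    (hH : (lAct d₁ d₂ (uhH d₁) + rAct d₁ d₂ (uhH d₂)).mulVec v = (d : ℂ) • v) {n : ℕ}
    (hn : n ≤ d) : (pairE d₁ d₂).mulVec ((pairF h d₁ d₂).mulVec (coupledVec h d₁ d₂ d v n)) =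
      ((n + 1) * (d - n) : ℂ) • (pairW h d₁ d₂).mulVec (coupledVec h d₁ d₂ d v n) := by
  induction n with
  | zero =>
    rw [Matrix.mulVec_mulVec, pairE_pairF, ← Matrix.mulVec_mulVec, Matrix.add_mulVec,
      ← Matrix.mulVec_mulVec, pairE_coupledVec_zero hE, Matrix.mulVec_zero, zero_add,
      uhDeltaH_coupledVec hE hH, Matrix.mulVec_smul]
    congr 1
    push_cast; ring
  | succ n ih =>
    have h1 : (pairE d₁ d₂).mulVec (coupledVec h d₁ d₂ d v (n + 1)) =
        (ladder d (d - 1 - n) : ℂ) • (pairW h d₁ d₂).mulVec (coupledVec h d₁ d₂ d v n) := by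
      have h0 : (ladder d (d - 1 - n) : ℂ) ≠ 0 := by
        exact_mod_cast (ladder_pos (show d - 1 - n < d by omega)).ne'
      rw [coupledVec, Matrix.mulVec_smul, ih (by omega), smul_smul, ← ladder_rev_sq (by omega)]
      push_cast
      rw [inv_mul_cancel_left₀ h0]
    rw [Matrix.mulVec_mulVec, pairE_pairF, ← Matrix.mulVec_mulVec, Matrix.add_mulVec,
      ← Matrix.mulVec_mulVec, h1, Matrix.mulVec_smul, Matrix.mulVec_mulVec, ← pairF,
      pairF_coupledVec (by omega), uhDeltaH_coupledVec hE hH, smul_smul, ladder_rev_sq (by omega),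
      ← add_smul, Matrix.mulVec_smul]
    congr 1
    push_cast; ring

theorem pairE_coupledVec_succ (hE : (pairE d₁ d₂).mulVec v = 0)
    (hH : (lAct d₁ d₂ (uhH d₁) + rAct d₁ d₂ (uhH d₂)).mulVec v = (d : ℂ) • v) {n : ℕ}
    (hn : n < d) : (pairE d₁ d₂).mulVec (coupledVec h d₁ d₂ d v (n + 1)) =
      (ladder d (d - 1 - n) : ℂ) • (pairW h d₁ d₂).mulVec (coupledVec h d₁ d₂ d v n) := by
  have h0 : (ladder d (d - 1 - n) : ℂ) ≠ 0 := by
    exact_mod_cast (ladder_pos (show d - 1 - n < d by omega)).ne'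
  rw [coupledVec, Matrix.mulVec_smul, pairE_pairF_coupledVec hE hH hn.le, smul_smul,
    ← ladder_rev_sq (by omega)]
  push_cast
  rw [inv_mul_cancel_left₀ h0]

/-- The image is killed by `E₁ + E₂` and its eigenvalue belongs to degree `r - 1`. As `r - 1 < d₁`,
the map `E₁ + E₂` is injective in that degree, so the leading components vanish, and with them the
eigenvector. -/
theorem pairF_coupledVec_last (hd : d₁ + d₂ = d + 2 * r) (h₁ : r ≤ d₁)
    (hE : (pairE d₁ d₂).mulVec v = 0)
    (hH : (lAct d₁ d₂ (uhH d₁) + rAct d₁ d₂ (uhH d₂)).mulVec v = (d : ℂ) • v) :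
    (pairF h d₁ d₂).mulVec (coupledVec h d₁ d₂ d v d) = 0 := by
  have h1 := pairE_pairF_coupledVec (h := h) hE hH le_rfl
  rw [sub_self, mul_zero, zero_smul] at h1
  have h2 : (uhDeltaH h d₁ d₂).mulVec ((pairF h d₁ d₂).mulVec (coupledVec h d₁ d₂ d v d)) =
      (2 * ((r - 1 : ℤ) : ℂ) - (d₁ + d₂)) •
        (pairF h d₁ d₂).mulVec (coupledVec h d₁ d₂ d v d) := by
    rw [uhDeltaH_pairF_mulVec (uhDeltaH_coupledVec hE hH d)]
    congr 1
    have : (d₁ + d₂ : ℂ) = d + 2 * r := by exact_mod_cast hd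
    rw [this]; push_cast; ring
  exact eigenvector_eq_zero h2
    (eq_zero_of_pairE_of_lt (fun x _ => congrFun h1 x) (by omega))

/-- The matrix whose columns are the coupled vectors. -/
noncomputable def coupledMatrix (h : ℂ) (d₁ d₂ d : ℕ) (v : Fin (d₁ + 1) × Fin (d₂ + 1) → ℂ) :
    Matrix (Fin (d₁ + 1) × Fin (d₂ + 1)) (Fin (d + 1)) ℂ :=
  Matrix.of fun x m => coupledVec h d₁ d₂ d v (d - m) x

theorem mul_coupledMatrix_apply (M : PairMatrix d₁ d₂) (x : Fin (d₁ + 1) × Fin (d₂ + 1))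
    (m : Fin (d + 1)) : (M * coupledMatrix h d₁ d₂ d v) x m =
      M.mulVec (coupledVec h d₁ d₂ d v (d - m)) x := rfl

theorem coupledMatrix_map_H (hE : (pairE d₁ d₂).mulVec v = 0)
    (hH : (lAct d₁ d₂ (uhH d₁) + rAct d₁ d₂ (uhH d₂)).mulVec v = (d : ℂ) • v) :
    uhDeltaH h d₁ d₂ * coupledMatrix h d₁ d₂ d v = coupledMatrix h d₁ d₂ d v * uhH d := by
  ext x m
  rw [mul_coupledMatrix_apply, uhDeltaH_coupledVec hE hH, uhH_eq_diagonal, Matrix.mul_diagonal,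
    Pi.smul_apply, smul_eq_mul, mul_comm, coupledMatrix, Matrix.of_apply, Nat.cast_sub (by omega)]
  ring

theorem mul_raise_apply {ι : Type*} (C : Matrix ι (Fin (d + 1)) ℂ) (x : ι) (m : Fin (d + 1)) :
    (C * raise d) x m = if hm : (m : ℕ) < d then C x ⟨m + 1, by omega⟩ * ladder d m else 0 := by
  rw [Matrix.mul_apply]
  split_ifs with hm
  · rw [Finset.sum_eq_single ⟨m + 1, by omega⟩]
    · rw [raise_apply, if_pos rfl]
    · intro j _ hj
      rw [raise_apply, if_neg, mul_zero]
      simpa [Fin.ext_iff] using hj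
    · simp
  · exact Finset.sum_eq_zero fun j _ => by rw [raise_apply, if_neg (by omega), mul_zero]

theorem mul_lower_apply {ι : Type*} (C : Matrix ι (Fin (d + 1)) ℂ) (x : ι) (m : Fin (d + 1)) :
    (C * lower d) x m = if (m : ℕ) = 0 then 0 else C x ⟨m - 1, by omega⟩ * ladder d (m - 1) := by
  rw [Matrix.mul_apply]
  split_ifs with hm
  · exact Finset.sum_eq_zero fun j _ => by rw [lower_apply, if_neg (by omega), mul_zero]
  · rw [Finset.sum_eq_single ⟨m - 1, by omega⟩]
    · rw [lower_apply, if_pos (by simp only; omega)]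
    · intro j _ hj
      rw [lower_apply, if_neg, mul_zero]
      simp only [ne_eq, Fin.ext_iff] at hj
      omega
    · simp

theorem coupledMatrix_map_E (hE : (pairE d₁ d₂).mulVec v = 0)
    (hH : (lAct d₁ d₂ (uhH d₁) + rAct d₁ d₂ (uhH d₂)).mulVec v = (d : ℂ) • v) :
    pairE d₁ d₂ * coupledMatrix h d₁ d₂ d v =
      pairW h d₁ d₂ * coupledMatrix h d₁ d₂ d v * raise d := by
  ext x m
  rw [mul_coupledMatrix_apply, mul_raise_apply]
  split_ifs with hm
  · rw [mul_coupledMatrix_apply, show d - (m : ℕ) = d - ((m : ℕ) + 1) + 1 by omega,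
      pairE_coupledVec_succ hE hH (by omega), Pi.smul_apply, smul_eq_mul, mul_comm]
    congr 3
    omega
  · rw [show d - (m : ℕ) = 0 by omega, pairE_coupledVec_zero hE, Pi.zero_apply]

theorem coupledMatrix_map_F (hd : d₁ + d₂ = d + 2 * r) (h₁ : r ≤ d₁)
    (hE : (pairE d₁ d₂).mulVec v = 0)
    (hH : (lAct d₁ d₂ (uhH d₁) + rAct d₁ d₂ (uhH d₂)).mulVec v = (d : ℂ) • v) :
    pairF h d₁ d₂ * coupledMatrix h d₁ d₂ d v = coupledMatrix h d₁ d₂ d v * lower d := by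
  ext x m
  rw [mul_coupledMatrix_apply, mul_lower_apply]
  split_ifs with hm
  · rw [hm, Nat.sub_zero, pairF_coupledVec_last hd h₁ hE hH, Pi.zero_apply]
  · rw [pairF_coupledVec (by omega), Pi.smul_apply, smul_eq_mul, mul_comm, coupledMatrix,
      Matrix.of_apply, show d - ((m : ℕ) - 1) = d - m + 1 by omega]
    congr 3
    omega

end Tower

/-! ### From intertwining `H`, `Z₊`, `Z₋` to intertwining `H`, `X`, `Y`. -/

section Intertwiner

variable {h : ℂ} {d₁ d₂ d r : ℕ} {C : Matrix (Fin (d₁ + 1) × Fin (d₂ + 1)) (Fin (d + 1)) ℂ}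

/-- The degree on `V^{(j)}`, shifted so that it matches the one on the tensor product. -/
abbrev shiftDeg (d r : ℕ) (m : Fin (d + 1)) : ℤ := finDeg d m + r

theorem IsFiltered.shift {s : ℤ} {M : Matrix (Fin (d + 1)) (Fin (d + 1)) ℂ}
    (hM : IsFiltered (finDeg d) (finDeg d) s M) :
    IsFiltered (shiftDeg d r) (shiftDeg d r) s M := fun i j hij => hM i j (by
  simp only [shiftDeg] at hij; omega)

theorem mulVec_col_eq_smul {M : Matrix (Fin (d₁ + 1) × Fin (d₂ + 1)) (Fin (d + 1)) ℂ}
    (hd : d₁ + d₂ = d + 2 * r) (hM : uhDeltaH h d₁ d₂ * M = M * uhH d) (m : Fin (d + 1)) :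
    (uhDeltaH h d₁ d₂).mulVec (M.col m) = (2 * (shiftDeg d r m : ℂ) - (d₁ + d₂)) • M.col m := by
  funext x
  have h1 := congrFun (congrFun hM x) m
  rw [uhH_eq_diagonal, Matrix.mul_diagonal] at h1
  have h2 : (d₁ + d₂ : ℂ) = d + 2 * r := by exact_mod_cast hd
  calc _ = (uhDeltaH h d₁ d₂ * M) x m := rfl
    _ = _ := by
      rw [h1, Pi.smul_apply, h2, smul_eq_mul, mul_comm, Matrix.col_apply]
      simp only [shiftDeg, finDeg]
      push_cast; ring

theorem isFiltered_of_map_H (hd : d₁ + d₂ = d + 2 * r)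
    (hC : uhDeltaH h d₁ d₂ * C = C * uhH d) : IsFiltered (pairDeg d₁ d₂) (shiftDeg d r) 0 C :=
  fun x m hxm => eigenvector_apply_eq_zero_of_lt (mulVec_col_eq_smul hd hC m) (by omega)

/-- The columns are eigenvectors of `Δ(H)` without leading components. This reduces an identity
between intertwiners of `H` to its leading terms. -/
theorem eq_zero_of_map_H (hd : d₁ + d₂ = d + 2 * r)
    (hC : uhDeltaH h d₁ d₂ * C = C * uhH d)
    (h1 : IsFiltered (pairDeg d₁ d₂) (shiftDeg d r) 1 C) : C = 0 := by
  ext x m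
  exact congrFun (eigenvector_eq_zero (mulVec_col_eq_smul hd hC m)
    fun y hy => h1 y m (by omega)) x

end Intertwiner

section Intertwiner

variable {h : ℂ} {d₁ d₂ d r : ℕ} {C : Matrix (Fin (d₁ + 1) × Fin (d₂ + 1)) (Fin (d + 1)) ℂ}

/-- Half of the commutator of `Δ(H)` and `Δ(X)`. -/
noncomputable def pairS (h : ℂ) (d₁ d₂ : ℕ) : PairMatrix d₁ d₂ :=
  lAct d₁ d₂ (uhS h d₁) * rAct d₁ d₂ (2 * geom (h / 2) d₂ - 1) +
    lAct d₁ d₂ (2 * geom (-(h / 2)) d₁ - 1) * rAct d₁ d₂ (uhS h d₂)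

/-- The product of the operators `1 - (h / 2)² Z₊²` on the two factors. -/
noncomputable def pairZ (h : ℂ) (d₁ d₂ : ℕ) : PairMatrix d₁ d₂ :=
  lAct d₁ d₂ (1 - ((h / 2) • raise d₁) * ((h / 2) • raise d₁)) *
    rAct d₁ d₂ (1 - ((h / 2) • raise d₂) * ((h / 2) • raise d₂))

theorem pairW_sq_sub (h : ℂ) (d₁ d₂ : ℕ) : pairW h d₁ d₂ * pairW h d₁ d₂ -
    ((h / 2) • pairE d₁ d₂) * ((h / 2) • pairE d₁ d₂) = pairZ h d₁ d₂ :=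
  tensorW_sq_sub _ _ leftAct_comm_rightAct _ _

theorem pairS_mul_pairZ (h : ℂ) (d₁ d₂ : ℕ) :
    pairS h d₁ d₂ * pairZ h d₁ d₂ = pairE d₁ d₂ * pairW h d₁ d₂ :=
  tensorS_mul _ _ leftAct_comm_rightAct (spinRel (h / 2) d₁) (spinRel (h / 2) d₂)
    (uhS_mul h d₁) (uhS_mul h d₂)

theorem uhDeltaH_uhDeltaX (h : ℂ) (d₁ d₂ : ℕ) :
    uhDeltaH h d₁ d₂ * uhDeltaX h d₁ d₂ - uhDeltaX h d₁ d₂ * uhDeltaH h d₁ d₂ =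
      2 * pairS h d₁ d₂ := by
  have h1 : Commute (uhX h d₁) (2 * geom (-(h / 2)) d₁ - 1) :=
    (((Nat.cast_commute 2 _).symm.mul_right (spinRel (h / 2) d₁).commute_b).sub_right
      (Commute.one_right _)).uhX
  have h2 : Commute (uhX h d₂) (2 * geom (h / 2) d₂ - 1) :=
    (((Nat.cast_commute 2 _).symm.mul_right (spinRel (h / 2) d₂).commute_a).sub_right
      (Commute.one_right _)).uhX
  have e1 := congrArg (lAct d₁ d₂) (uhH_uhX h d₁)
  have e2 := congrArg (rAct d₁ d₂) (uhH_uhX h d₂)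
  have e3 := congrArg (lAct d₁ d₂) h1.eq
  have e4 := congrArg (rAct d₁ d₂) h2.eq
  have c : ∀ x y, lAct d₁ d₂ x * rAct d₁ d₂ y = rAct d₁ d₂ y * lAct d₁ d₂ x :=
    leftAct_comm_rightAct
  rw [uhDeltaH_eq, tensorH, uhDeltaX_eq, pairS]
  have c1 := c (uhX h d₁) (2 * geom (h / 2) d₂ - 1)
  have c2 := c (uhX h d₁) (uhH d₂)
  have c3 := c (uhH d₁) (uhX h d₂)
  have c4 := c (2 * geom (-(h / 2)) d₁ - 1) (uhX h d₂)
  generalize 2 * geom (h / 2) d₂ - 1 = A at *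
  generalize 2 * geom (-(h / 2)) d₁ - 1 = B at *
  simp only [map_sub, map_mul, map_ofNat] at e1 e2 e3 e4
  generalize lAct d₁ d₂ B = lB at *
  generalize rAct d₁ d₂ A = rA at *
  generalize lAct d₁ d₂ (uhH d₁) = lH at *
  generalize rAct d₁ d₂ (uhH d₂) = rH at *
  generalize lAct d₁ d₂ (uhX h d₁) = lX at *
  generalize rAct d₁ d₂ (uhX h d₂) = rX at *
  linear_combination (norm := noncomm_ring) e1 * rA + lB * e2 - lH * c1 + c3 * rA - lH * e4 +
    c4 * rH - lB * c2 - e3 * rH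

theorem commute_raise_geom (η : ℂ) (d : ℕ) : Commute (raise d) (geom η d) :=
  (spinRel η d).commute_a

theorem pairW_commute_pairS (h : ℂ) (d₁ d₂ : ℕ) : Commute (pairW h d₁ d₂) (pairS h d₁ d₂) := by
  have h1 : ∀ (d : ℕ) (η : ℂ), Commute (raise d) (2 * geom η d - 1) := fun d η =>
    ((Nat.cast_commute 2 _).symm.mul_right (commute_raise_geom η d)).sub_right
      (Commute.one_right _)
  have h2 : ∀ d : ℕ, Commute (raise d) (uhS h d) := fun d => (Commute.refl (raise d)).uhS.symm
  have h3 : ∀ (x : Matrix (Fin (d₁ + 1)) (Fin (d₁ + 1)) ℂ)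
      (y : Matrix (Fin (d₂ + 1)) (Fin (d₂ + 1)) ℂ), Commute (raise d₁) x → Commute (raise d₂) y →
      Commute (pairW h d₁ d₂) (lAct d₁ d₂ x * rAct d₁ d₂ y) := by
    intro x y hx hy
    rw [pairW, tensorW, leftAct_mul_rightAct, leftAct_mul_rightAct]
    refine (Commute.one_left _).add_left ?_
    rw [commute_iff_eq, ← Matrix.mul_kronecker_mul, ← Matrix.mul_kronecker_mul,
      (hx.smul_left _).eq, (hy.smul_left _).eq]
  exact (h3 _ _ (h2 d₁) (h1 d₂ _)).add_right (h3 _ _ (h1 d₁ _) (h2 d₂))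

theorem isUnit_one_sub (h : ℂ) (d : ℕ) :
    IsUnit (1 - ((h / 2) • raise d) * ((h / 2) • raise d)) :=
  (spinRel (h / 2) d).a_mul_b_mul |> fun e => IsUnit.of_mul_eq_one_right _ e

theorem IsUnit.matrix_mul_left_cancel {ι κ : Type*} [Fintype ι] [DecidableEq ι] {M : Matrix ι ι ℂ}
    (hM : IsUnit M) {A B : Matrix ι κ ℂ} (hAB : M * A = M * B) : A = B := by
  obtain ⟨N, hN⟩ := hM.exists_left_inv
  rw [← Matrix.one_mul A, ← hN, Matrix.mul_assoc, hAB, ← Matrix.mul_assoc, hN, Matrix.one_mul]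

theorem IsUnit.matrix_mul_right_cancel {ι κ : Type*} [Fintype ι] [DecidableEq ι] {M : Matrix ι ι ℂ}
    (hM : IsUnit M) {A B : Matrix κ ι ℂ} (hAB : A * M = B * M) : A = B := by
  obtain ⟨N, hN⟩ := hM.exists_right_inv
  rw [← Matrix.mul_one A, ← hN, ← Matrix.mul_assoc, hAB, Matrix.mul_assoc, hN, Matrix.mul_one]

/-- The relation `1 - T²` transported through `C`: by `hE`, the square of `(h/2) (E₁ + E₂)` becomes
`W²` times `T²` on the right, and `W²` minus that square is `pairZ`. -/
theorem pairZ_mul (hE : pairE d₁ d₂ * C = pairW h d₁ d₂ * C * raise d) :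
    pairW h d₁ d₂ * pairW h d₁ d₂ *
      (C * (1 - ((h / 2) • raise d) * ((h / 2) • raise d))) = pairZ h d₁ d₂ * C := by
  have hWE := (pairW_commute_pairE h d₁ d₂).eq
  have h1 : ((h / 2) • pairE d₁ d₂) * ((h / 2) • pairE d₁ d₂) * C =
      pairW h d₁ d₂ * pairW h d₁ d₂ * (C * (((h / 2) • raise d) * ((h / 2) • raise d))) := by
    simp only [Matrix.smul_mul, Matrix.mul_smul]
    congr 2
    calc pairE d₁ d₂ * pairE d₁ d₂ * C = pairE d₁ d₂ * pairW h d₁ d₂ * C * raise d := by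
          rw [Matrix.mul_assoc, hE]; simp only [Matrix.mul_assoc]
      _ = pairW h d₁ d₂ * (pairE d₁ d₂ * C) * raise d := by
          rw [← hWE]; simp only [Matrix.mul_assoc]
      _ = _ := by rw [hE]; simp only [Matrix.mul_assoc]
  rw [← pairW_sq_sub, Matrix.sub_mul, h1, Matrix.mul_sub, Matrix.mul_sub, Matrix.mul_one]

/-- The halves of `[Δ(H), Δ(X)]` and `[H, X]` are the same rational function of the raising
operators, so `C` intertwines them. Hence `Δ(X) C - C X` intertwines `H`; since it raises the degree
by at least one, it is zero. -/
theorem uhDeltaX_mul (hd : d₁ + d₂ = d + 2 * r) (hH : uhDeltaH h d₁ d₂ * C = C * uhH d)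
    (hE : pairE d₁ d₂ * C = pairW h d₁ d₂ * C * raise d) :
    uhDeltaX h d₁ d₂ * C = C * uhX h d := by
  have hW := isUnit_pairW h d₁ d₂
  have hWS := (pairW_commute_pairS h d₁ d₂).eq
  have hS : pairS h d₁ d₂ * C = C * uhS h d := by
    refine (isUnit_one_sub h d).matrix_mul_right_cancel ((hW.mul hW).matrix_mul_left_cancel ?_)
    rw [Matrix.mul_assoc C, uhS_mul]
    calc _ = pairS h d₁ d₂ * (pairW h d₁ d₂ * pairW h d₁ d₂ *
          (C * (1 - ((h / 2) • raise d) * ((h / 2) • raise d)))) := by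
          have : pairW h d₁ d₂ * pairW h d₁ d₂ * pairS h d₁ d₂ =
            pairS h d₁ d₂ * (pairW h d₁ d₂ * pairW h d₁ d₂) := by
            rw [mul_assoc, hWS, ← mul_assoc, hWS, mul_assoc]
          simp only [← Matrix.mul_assoc]
          rw [this]
          simp only [Matrix.mul_assoc]
      _ = pairW h d₁ d₂ * (pairE d₁ d₂ * C) := by
          rw [pairZ_mul hE, ← Matrix.mul_assoc, pairS_mul_pairZ, ← Matrix.mul_assoc,
            (pairW_commute_pairE h d₁ d₂).eq]
      _ = _ := by rw [hE]; simp only [Matrix.mul_assoc]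
  rw [← sub_eq_zero]
  refine eq_zero_of_map_H (h := h) hd ?_ ?_
  · have h1 := congrArg (· * C) (uhDeltaH_uhDeltaX h d₁ d₂)
    have h2 := congrArg (C * ·) (uhH_uhX h d)
    simp only [Matrix.sub_mul, Matrix.mul_sub, two_mul, Matrix.add_mul, Matrix.mul_add] at h1 h2
    have k1 : uhDeltaH h d₁ d₂ * (uhDeltaX h d₁ d₂ * C) =
        uhDeltaX h d₁ d₂ * C * uhH d + (C * uhS h d + C * uhS h d) := by
      rw [← hS, ← h1, Matrix.mul_assoc _ C, ← hH]
      simp only [Matrix.mul_assoc]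
      abel
    have k2 : uhDeltaH h d₁ d₂ * (C * uhX h d) =
        C * uhX h d * uhH d + (C * uhS h d + C * uhS h d) := by
      rw [← h2, ← Matrix.mul_assoc, hH]
      simp only [Matrix.mul_assoc]
      abel
    rw [Matrix.mul_sub, Matrix.sub_mul, k1, k2]
    abel
  · have hC := isFiltered_of_map_H hd hH
    have hX : IsFiltered (pairDeg d₁ d₂) (pairDeg d₁ d₂) 1 (uhDeltaX h d₁ d₂) :=
      ((uhX_isFiltered h d₁).kronecker IsFiltered.one).add
        (IsFiltered.one.kronecker (uhX_isFiltered h d₂))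
    exact (hX.mul hC).sub (hC.mul (uhX_isFiltered h d).shift)

/-- `cosh (h Δ(X) / 2)`. -/
noncomputable def pairCosh (h : ℂ) (d₁ d₂ : ℕ) : PairMatrix d₁ d₂ :=
  pairW h d₁ d₂ * (lAct d₁ d₂ (coshX h d₁) * rAct d₁ d₂ (coshX h d₂))

theorem pairW_commute_coshX (h : ℂ) (d₁ d₂ : ℕ) : Commute (pairW h d₁ d₂)
    (lAct d₁ d₂ (coshX h d₁) * rAct d₁ d₂ (coshX h d₂)) := by
  rw [pairW, tensorW, leftAct_mul_rightAct, leftAct_mul_rightAct]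
  refine (Commute.one_left _).add_left ?_
  rw [commute_iff_eq, ← Matrix.mul_kronecker_mul, ← Matrix.mul_kronecker_mul,
    ((commute_coshX h d₁).smul_left _).eq, ((commute_coshX h d₂).smul_left _).eq]

theorem pairCosh_sub_one_isFiltered (h : ℂ) (d₁ d₂ : ℕ) :
    IsFiltered (pairDeg d₁ d₂) (pairDeg d₁ d₂) 1 (pairCosh h d₁ d₂ - 1) := by
  have h1 := coshX_sub_one_isFiltered h d₁
  have h2 := coshX_sub_one_isFiltered h d₂
  have h3 := pairW_sub_one_isFiltered h d₁ d₂
  have h4 : IsFiltered (pairDeg d₁ d₂) (pairDeg d₁ d₂) 1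
      (lAct d₁ d₂ (coshX h d₁) * rAct d₁ d₂ (coshX h d₂) - 1) := by
    have : lAct d₁ d₂ (coshX h d₁) * rAct d₁ d₂ (coshX h d₂) - 1 =
        (coshX h d₁ - 1) ⊗ₖ (coshX h d₂ - 1) + ((coshX h d₁ - 1) ⊗ₖ 1 + 1 ⊗ₖ (coshX h d₂ - 1)) := by
      rw [← leftAct_mul_rightAct, ← leftAct_apply, ← rightAct_apply]
      simp only [map_sub, map_one]
      noncomm_ring
    rw [this]
    exact ((h1.kronecker h2).mono (by omega)).add
      ((h1.kronecker IsFiltered.one).add (IsFiltered.one.kronecker h2))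
  have h5 : pairCosh h d₁ d₂ - 1 = (pairW h d₁ d₂ - 1) *
      (lAct d₁ d₂ (coshX h d₁) * rAct d₁ d₂ (coshX h d₂) - 1) + ((pairW h d₁ d₂ - 1) +
      (lAct d₁ d₂ (coshX h d₁) * rAct d₁ d₂ (coshX h d₂) - 1)) := by
    rw [pairCosh]; noncomm_ring
  rw [h5]
  exact ((h3.mul h4).mono (by omega)).add (h3.add h4)

theorem Commute.geom {η : ℂ} {d : ℕ} {M : Matrix (Fin (d + 1)) (Fin (d + 1)) ℂ}
    (hM : Commute (raise d) M) : Commute (geom η d) M :=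
  Commute.sum_left _ _ _ fun k _ => (hM.smul_left η).pow_left k

/-- All factors commute, and `ab (2a - 1) = a (a + b) - ab = a²`. -/
theorem coshX_conj_left (h : ℂ) (d : ℕ) :
    coshX h d * (2 * geom (h / 2) d - 1) * coshX h d = geom (h / 2) d * geom (h / 2) d := by
  have h1 : coshX h d * geom (h / 2) d = geom (h / 2) d * coshX h d :=
    (commute_coshX h d).geom.eq.symm
  have h2 := coshX_mul_self h d
  have h3 := (spinRel (h / 2) d).two_mul_a_mul_b
  have h4 := (spinRel (h / 2) d).two_mul_b_mul_a
  generalize geom (h / 2) d = a at *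
  generalize geom (-(h / 2)) d = b at *
  generalize coshX h d = c at *
  linear_combination (norm := noncomm_ring) 2 * h1 * c + 2 * a * h2 - h2 + a * h3

theorem coshX_conj_right (h : ℂ) (d : ℕ) :
    coshX h d * (2 * geom (-(h / 2)) d - 1) * coshX h d =
      geom (-(h / 2)) d * geom (-(h / 2)) d := by
  have h1 : coshX h d * geom (-(h / 2)) d = geom (-(h / 2)) d * coshX h d :=
    (commute_coshX h d).geom.eq.symm
  have h2 := coshX_mul_self h d
  have h4 := (spinRel (h / 2) d).two_mul_b_mul_a
  generalize geom (h / 2) d = a at *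
  generalize geom (-(h / 2)) d = b at *
  generalize coshX h d = c at *
  linear_combination (norm := noncomm_ring) 2 * h1 * c + 2 * b * h2 - h2 + h4 * b

/-- The coproduct version of `Z₋ = cosh (hX/2) Y cosh (hX/2)`, with `cosh (x + y) = cosh x cosh y (1
+ tanh x tanh y)` built into `pairCosh`. -/
theorem pairCosh_uhDeltaY (h : ℂ) (d₁ d₂ : ℕ) :
    pairCosh h d₁ d₂ * uhDeltaY h d₁ d₂ * pairCosh h d₁ d₂ = pairF h d₁ d₂ := by
  have h1 : lAct d₁ d₂ (coshX h d₁) * rAct d₁ d₂ (coshX h d₂) * uhDeltaY h d₁ d₂ *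
      (lAct d₁ d₂ (coshX h d₁) * rAct d₁ d₂ (coshX h d₂)) = pairQ h d₁ d₂ := by
    rw [uhDeltaY_eq, pairQ, tensorQ]
    simp only [leftAct_mul_rightAct]
    rw [Matrix.mul_add, Matrix.add_mul]
    simp only [← Matrix.mul_kronecker_mul]
    rw [coshX_conj_left, coshX_conj_right, coshX_uhY, coshX_uhY]
  have h2 : pairCosh h d₁ d₂ = lAct d₁ d₂ (coshX h d₁) * rAct d₁ d₂ (coshX h d₂) *
      pairW h d₁ d₂ := (pairW_commute_coshX h d₁ d₂).eq
  rw [pairF, ← h1]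
  nth_rewrite 2 [h2]
  rw [pairCosh]
  simp only [mul_assoc]

theorem pairCosh_sq_mul_pairZ (h : ℂ) (d₁ d₂ : ℕ) :
    (lAct d₁ d₂ (coshX h d₁) * rAct d₁ d₂ (coshX h d₂)) *
      ((lAct d₁ d₂ (coshX h d₁) * rAct d₁ d₂ (coshX h d₂)) * pairZ h d₁ d₂) = 1 := by
  rw [pairZ, leftAct_mul_rightAct, leftAct_mul_rightAct]
  simp only [← Matrix.mul_kronecker_mul]
  rw [coshX_mul, coshX_mul, Matrix.one_kronecker_one]

/-- The squares of both hyperbolic cosines are rational in the raising operators, so `C` intertwines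
them. Uniqueness of unipotent square roots then gives the claim for the cosines themselves. -/
theorem pairCosh_mul (hd : d₁ + d₂ = d + 2 * r) (hH : uhDeltaH h d₁ d₂ * C = C * uhH d)
    (hE : pairE d₁ d₂ * C = pairW h d₁ d₂ * C * raise d) :
    pairCosh h d₁ d₂ * C = C * coshX h d := by
  have h1 : pairCosh h d₁ d₂ * pairCosh h d₁ d₂ * C = C * (coshX h d * coshX h d) := by
    refine (isUnit_one_sub h d).matrix_mul_right_cancel ?_
    rw [Matrix.mul_assoc C, Matrix.mul_assoc (coshX h d), coshX_mul, Matrix.mul_one]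
    have h2 : pairCosh h d₁ d₂ * pairCosh h d₁ d₂ =
        (lAct d₁ d₂ (coshX h d₁) * rAct d₁ d₂ (coshX h d₂)) *
        ((lAct d₁ d₂ (coshX h d₁) * rAct d₁ d₂ (coshX h d₂)) *
          (pairW h d₁ d₂ * pairW h d₁ d₂)) := by
      rw [pairCosh, (pairW_commute_coshX h d₁ d₂).eq]
      simp only [mul_assoc]
      rw [← mul_assoc (pairW h d₁ d₂) (lAct d₁ d₂ _), ← mul_assoc (pairW h d₁ d₂ * _),
        mul_assoc (pairW h d₁ d₂) (lAct d₁ d₂ _), (pairW_commute_coshX h d₁ d₂).eq]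
      simp only [mul_assoc]
    have h6 := pairCosh_sq_mul_pairZ h d₁ d₂
    rw [h2]
    generalize lAct d₁ d₂ (coshX h d₁) * rAct d₁ d₂ (coshX h d₂) = L at *
    rw [Matrix.mul_assoc _ C, Matrix.mul_assoc L, Matrix.mul_assoc L, pairZ_mul hE,
      ← Matrix.mul_assoc L _ C, ← Matrix.mul_assoc L _ C, h6, Matrix.one_mul]
  have hC := isFiltered_of_map_H hd hH
  have hp := pairCosh_sub_one_isFiltered h d₁ d₂
  have hc := (coshX_sub_one_isFiltered h d).shift (r := r)
  rw [← sub_eq_zero]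
  set c := coshX h d
  set p := pairCosh h d₁ d₂
  set N := p * C - C * c with hN
  -- From `p² C = C c²`. As `p` and `c` are unipotent, this says that `2 N` equals strictly raising
  -- terms applied to `N`, so the filtration degree of `N` can be increased until `N` vanishes.
  have h3 : p * N = - (N * c) := by
    rw [hN, Matrix.mul_sub, Matrix.sub_mul, ← Matrix.mul_assoc, h1]
    simp only [Matrix.mul_assoc]
    abel
  have h4 : N = -(2⁻¹ : ℂ) • ((p - 1) * N + N * (c - 1)) := by
    rw [Matrix.sub_mul, Matrix.mul_sub N, h3, Matrix.one_mul, Matrix.mul_one]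
    module
  have h5 : ∀ n : ℕ, IsFiltered (pairDeg d₁ d₂) (shiftDeg d r) n N := by
    intro n
    induction n with
    | zero =>
      have : N = (p - 1) * C - C * (c - 1) := by
        rw [hN, Matrix.sub_mul, Matrix.mul_sub, Matrix.one_mul, Matrix.mul_one]; abel
      rw [this]
      exact ((hp.mul hC).sub (hC.mul hc)).mono (by simp)
    | succ n ih =>
      rw [h4]
      exact (((hp.mul ih).mono (by push_cast; omega)).add
        ((ih.mul hc).mono (by push_cast; omega))).smul _
  exact (h5 (d₁ + d₂ + 1)).eq_zero fun x m => by
    have := x.1.2; have := x.2.2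
    simp only [pairDeg, finDeg, shiftDeg]; push_cast; omega

theorem isUnit_pairCosh (h : ℂ) (d₁ d₂ : ℕ) : IsUnit (pairCosh h d₁ d₂) :=
  isUnit_of_isFiltered_sub_one d₁ d₂ (pairCosh_sub_one_isFiltered h d₁ d₂)

theorem uhDeltaY_mul (hd : d₁ + d₂ = d + 2 * r) (hH : uhDeltaH h d₁ d₂ * C = C * uhH d)
    (hE : pairE d₁ d₂ * C = pairW h d₁ d₂ * C * raise d)
    (hF : pairF h d₁ d₂ * C = C * lower d) : uhDeltaY h d₁ d₂ * C = C * uhY h d := by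
  have hc := pairCosh_mul hd hH hE
  refine (isUnit_coshX h d).matrix_mul_right_cancel
    ((isUnit_pairCosh h d₁ d₂).matrix_mul_left_cancel ?_)
  calc _ = pairCosh h d₁ d₂ * uhDeltaY h d₁ d₂ * (C * coshX h d) := by
        simp only [Matrix.mul_assoc]
    _ = C * (coshX h d * uhY h d * coshX h d) := by
        rw [← hc, ← Matrix.mul_assoc, pairCosh_uhDeltaY, hF, coshX_uhY]
    _ = C * coshX h d * (uhY h d * coshX h d) := by simp only [Matrix.mul_assoc]
    _ = _ := by rw [← hc]; simp only [Matrix.mul_assoc]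

end Intertwiner

/-! ### Translation between magnetic quantum numbers and degrees. -/

section Weights

variable {d₁ d₂ d r : ℕ}

theorem wt_add_wt_sub_wt (hd : d₁ + d₂ = d + 2 * r) (x : Fin (d₁ + 1) × Fin (d₂ + 1))
    (m : Fin (d + 1)) : wt d₁ x.1 + wt d₂ x.2 - wt d m =
      ((pairDeg d₁ d₂ x - shiftDeg d r m : ℤ) : ℝ) := by
  have h : (d₁ + d₂ : ℝ) = d + 2 * r := by exact_mod_cast hd
  simp only [wt, spin, pairDeg, shiftDeg, finDeg]
  push_cast
  linarith

theorem wt_last (d : ℕ) : wt d (Fin.last d) = spin d := by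
  rw [wt, spin, Fin.val_last]; ring

theorem wt_add_wt_eq_spin_iff (hd : d₁ + d₂ = d + 2 * r) (x : Fin (d₁ + 1) × Fin (d₂ + 1)) :
    wt d₁ x.1 + wt d₂ x.2 = spin d ↔ pairDeg d₁ d₂ x = d + r := by
  rw [← wt_last, ← sub_eq_zero, wt_add_wt_sub_wt hd]
  simp only [shiftDeg, finDeg, Fin.val_last]
  rw [Int.cast_eq_zero]
  omega

theorem unit_leading_iff (hd : d₁ + d₂ = d + 2 * r) (f : Fin (d₁ + 1) × Fin (d₂ + 1) → ℂ) :
    ∑ n₁ : Fin (d₁ + 1), ∑ n₂ : Fin (d₂ + 1),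
      (if wt d₁ n₁ + wt d₂ n₂ = spin d then ‖f (n₁, n₂)‖ ^ 2 else 0) =
    ∑ x, if pairDeg d₁ d₂ x = d + r then ‖f x‖ ^ 2 else 0 := by
  rw [Fintype.sum_prod_type]
  refine Finset.sum_congr rfl fun i _ => Finset.sum_congr rfl fun j _ => ?_
  simp only [← wt_add_wt_eq_spin_iff hd]

end Weights

/-! ### Uniqueness of the deformed coefficients. -/

section Uniqueness

variable {h : ℂ} {d₁ d₂ d r : ℕ} {C C' : Matrix (Fin (d₁ + 1) × Fin (d₂ + 1)) (Fin (d + 1)) ℂ}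

theorem uhDeltaX_sub_pairE_isFiltered (h : ℂ) (d₁ d₂ : ℕ) :
    IsFiltered (pairDeg d₁ d₂) (pairDeg d₁ d₂) 2 (uhDeltaX h d₁ d₂ - pairE d₁ d₂) := by
  have : uhDeltaX h d₁ d₂ - pairE d₁ d₂ =
      (uhX h d₁ - raise d₁) ⊗ₖ 1 + 1 ⊗ₖ (uhX h d₂ - raise d₂) := by
    rw [uhDeltaX_eq, pairE, ← leftAct_apply, ← rightAct_apply, map_sub, map_sub]
    abel
  rw [this]
  exact ((uhX_sub_raise_isFiltered h d₁).kronecker IsFiltered.one).add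
    (IsFiltered.one.kronecker (uhX_sub_raise_isFiltered h d₂))

/-- A vector of weight `d` killed by `Δ(X)` is determined by one of its components. -/
theorem highest_eq_zero (hd : d₁ + d₂ = d + 2 * r) {u : Fin (d₁ + 1) × Fin (d₂ + 1) → ℂ}
    (hX : (uhDeltaX h d₁ d₂).mulVec u = 0)
    (hH : (uhDeltaH h d₁ d₂).mulVec u = (d : ℂ) • u)
    (htop : ∀ j, pairDeg d₁ d₂ (Fin.last d₁, j) = d + r → u (Fin.last d₁, j) = 0) : u = 0 := by
  have h2 : (d₁ + d₂ : ℂ) = d + 2 * r := by exact_mod_cast hd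
  have hH' : (uhDeltaH h d₁ d₂).mulVec u = (2 * ((d + r : ℤ) : ℂ) - (d₁ + d₂)) • u := by
    rw [hH, h2]; congr 1; push_cast; ring
  refine eigenvector_eq_zero hH' (eq_zero_of_pairE_of_top (fun x hx => ?_) htop)
  -- One degree above the leading one, only the leading components of `u` contribute, and there
  -- `Δ(X)` acts as the undeformed `E₁ + E₂`.
  have h3 : ((uhDeltaX h d₁ d₂ - pairE d₁ d₂).mulVec u) x = 0 := by
    refine Finset.sum_eq_zero fun y _ => ?_
    beta_reduce
    by_cases hy : pairDeg d₁ d₂ y < d + r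
    · rw [eigenvector_apply_eq_zero_of_lt hH' hy, mul_zero]
    · rw [uhDeltaX_sub_pairE_isFiltered h d₁ d₂ x y (by omega), zero_mul]
  rw [Matrix.sub_mulVec, hX, zero_sub, Pi.neg_apply, neg_eq_zero] at h3
  exact h3

theorem IsUhCG.last_X (hC : IsUhCG h d₁ d₂ d C) :
    (uhDeltaX h d₁ d₂).mulVec (C.col (Fin.last d)) = 0 := by
  funext x
  calc _ = (uhDeltaX h d₁ d₂ * C) x (Fin.last d) := rfl
    _ = 0 := by
      rw [hC.map_X, Matrix.mul_apply]
      exact Finset.sum_eq_zero fun j _ => by rw [uhX_last, mul_zero]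

theorem IsUhCG.last_H (hC : IsUhCG h d₁ d₂ d C) :
    (uhDeltaH h d₁ d₂).mulVec (C.col (Fin.last d)) = (d : ℂ) • C.col (Fin.last d) := by
  funext x
  calc _ = (uhDeltaH h d₁ d₂ * C) x (Fin.last d) := rfl
    _ = _ := by
      rw [hC.map_H, uhH_eq_diagonal, Matrix.mul_diagonal, Pi.smul_apply, Matrix.col_apply,
        Fin.val_last, smul_eq_mul]
      ring

/-- Columns vanish one by one from the last: in column `m + 1` of `N Y` only column `m` of `N` is
left, with the nonzero coefficient that `Y` shares with `Z₋`. -/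
theorem eq_zero_of_map_Y {N : Matrix (Fin (d₁ + 1) × Fin (d₂ + 1)) (Fin (d + 1)) ℂ}
    (hN : uhDeltaY h d₁ d₂ * N = N * uhY h d) (hlast : ∀ x, N x (Fin.last d) = 0) : N = 0 := by
  suffices H : ∀ n : ℕ, ∀ m : Fin (d + 1), d - (m : ℕ) = n → ∀ x, N x m = 0 from
    Matrix.ext fun x m => H _ m rfl x
  intro n
  induction n using Nat.strong_induction_on with
  | _ n ih =>
    intro m hm x
    by_cases hmd : (m : ℕ) = d
    · rw [show m = Fin.last d from Fin.ext hmd]; exact hlast x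
    have hm1 : (m : ℕ) + 1 < d + 1 := by omega
    have h1 := congrFun (congrFun hN x) ⟨m + 1, hm1⟩
    have h2 : (uhDeltaY h d₁ d₂ * N) x ⟨m + 1, hm1⟩ = 0 := by
      rw [Matrix.mul_apply]
      exact Finset.sum_eq_zero fun y _ => by
        rw [ih (d - (m + 1)) (by omega) ⟨m + 1, hm1⟩ rfl y, mul_zero]
    rw [h2, Matrix.mul_apply, Finset.sum_eq_single m] at h1
    · have h3 := uhY_sub_lower_isFiltered h d m ⟨m + 1, hm1⟩ (by simp only [finDeg]; omega)
      rw [Matrix.sub_apply, sub_eq_zero, lower_apply, if_pos rfl] at h3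
      rw [h3] at h1
      refine (mul_eq_zero.mp h1.symm).resolve_right ?_
      exact_mod_cast (ladder_pos (show (m : ℕ) < d by omega)).ne'
    · intro j _ hj
      by_cases hjm : (m : ℕ) < j
      · rw [ih (d - j) (by omega) j rfl x, zero_mul]
      · have hj' : (j : ℕ) < m := by
          have : (j : ℕ) ≠ m := fun h => hj (Fin.ext h)
          omega
        have h3 := uhY_sub_lower_isFiltered h d j ⟨m + 1, hm1⟩ (by simp only [finDeg]; omega)
        rw [Matrix.sub_apply, sub_eq_zero, lower_apply, if_neg (by simp only; omega)] at h3
        rw [h3, mul_zero]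
    · simp

theorem IsUhCG.unique (hd : d₁ + d₂ = d + 2 * r) (h₂ : r ≤ d₂)
    (hC : IsUhCG h d₁ d₂ d C) (hC' : IsUhCG h d₁ d₂ d C') : C = C' := by
  set j₀ : Fin (d₂ + 1) := ⟨d₂ - r, by omega⟩ with hj₀
  have hdeg : pairDeg d₁ d₂ (Fin.last d₁, j₀) = d + r := by
    simp only [pairDeg, finDeg, Fin.val_last, hj₀]; omega
  have hj : ∀ j, pairDeg d₁ d₂ (Fin.last d₁, j) = d + r → j = j₀ := fun j hj => by
    refine Fin.ext ?_
    simp only [pairDeg, finDeg, Fin.val_last, hj₀] at hj ⊢; omega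
  have hwt : spin d₁ + wt d₂ j₀ = spin d := by
    rw [← wt_last d₁]
    exact (wt_add_wt_eq_spin_iff hd (Fin.last d₁, j₀)).mpr hdeg
  obtain ⟨s, hs, hsC⟩ := hC.condon_shortley j₀ hwt
  obtain ⟨t, ht, htC⟩ := hC'.condon_shortley j₀ hwt
  -- This combination has zero component at `n₁ = j₁`, where the two highest vectors take the values
  -- `s` and `t`.
  have h1 : (t : ℂ) • C.col (Fin.last d) - (s : ℂ) • C'.col (Fin.last d) = 0 := by
    refine highest_eq_zero (h := h) hd ?_ ?_ fun j hj' => ?_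
    · rw [Matrix.mulVec_sub, Matrix.mulVec_smul, Matrix.mulVec_smul, hC.last_X, hC'.last_X,
        smul_zero, smul_zero, sub_zero]
    · rw [Matrix.mulVec_sub, Matrix.mulVec_smul, Matrix.mulVec_smul, hC.last_H, hC'.last_H,
        smul_sub, smul_comm, smul_comm (s : ℂ)]
    · rw [hj j hj']
      simp only [Pi.sub_apply, Pi.smul_apply, Matrix.col_apply, smul_eq_mul, hsC, htC]
      ring
  have h2 : ∀ x, (t : ℂ) * C x (Fin.last d) = s * C' x (Fin.last d) := fun x => by
    have := congrFun h1 x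
    simpa [sub_eq_zero] using this
  have h3 := hC.unit_leading
  have h4 := hC'.unit_leading
  rw [unit_leading_iff hd fun x => C x (Fin.last d)] at h3
  rw [unit_leading_iff hd fun x => C' x (Fin.last d)] at h4
  have h5 : t ^ 2 * (∑ x, if pairDeg d₁ d₂ x = d + r then ‖C x (Fin.last d)‖ ^ 2 else 0) =
      s ^ 2 * ∑ x, if pairDeg d₁ d₂ x = d + r then ‖C' x (Fin.last d)‖ ^ 2 else 0 := by
    rw [Finset.mul_sum, Finset.mul_sum]
    refine Finset.sum_congr rfl fun x _ => ?_
    have h6 := congrArg (fun z => ‖z‖ ^ 2) (h2 x)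
    simp only [norm_mul, Complex.norm_real, Real.norm_eq_abs, mul_pow, sq_abs] at h6
    split_ifs
    · exact h6
    · rw [mul_zero, mul_zero]
  rw [h3, h4, mul_one, mul_one] at h5
  have hts : t = s := (pow_left_inj₀ ht.le hs.le two_ne_zero).mp h5
  rw [← sub_eq_zero]
  refine eq_zero_of_map_Y (h := h) ?_ fun x => ?_
  · rw [Matrix.mul_sub, Matrix.sub_mul, hC.map_Y, hC'.map_Y]
  · have h6 := h2 x
    rw [hts] at h6
    have hs0 : (s : ℂ) ≠ 0 := by exact_mod_cast hs.ne'
    rw [Matrix.sub_apply, mul_left_cancel₀ hs0 h6, sub_self]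

end Uniqueness

/-! ### Existence and homogeneity in `h`. -/

section Existence

variable {d₁ d₂ d r : ℕ}

theorem IsHomogeneousFamily.reindex {ι κ : Type*} {p : ι → ℤ} {q q' : κ → ℤ} {s s' : ℤ}
    {M : ℂ → Matrix ι κ ℂ} (hM : IsHomogeneousFamily p q s M) (h : ∀ j, q j + s = q' j + s') :
    IsHomogeneousFamily p q' s' M := by
  obtain ⟨m, hm⟩ := hM
  refine ⟨m, fun c i j => ?_⟩
  rw [hm, h j, sub_sub, h j, ← sub_sub]

theorem raise_isHomogeneous (d : ℕ) :
    IsHomogeneousFamily (finDeg d) (finDeg d) 1 (fun _ => raise d) :=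
  IsHomogeneousFamily.const fun i j hij => by
    rw [sl2Zp_apply, if_neg]; simp only [finDeg] at hij; omega

theorem lower_isHomogeneous (d : ℕ) :
    IsHomogeneousFamily (finDeg d) (finDeg d) (-1) (fun _ => lower d) :=
  IsHomogeneousFamily.const fun i j hij => by
    rw [sl2Zm_apply, if_neg]; simp only [finDeg] at hij; omega

theorem geom_isHomogeneous (d : ℕ) :
    IsHomogeneousFamily (finDeg d) (finDeg d) 0 (fun h => geom (h / 2) d) :=
  IsHomogeneousFamily.sum fun k => ((raise_isHomogeneous d).half_smul.pow k)

theorem geom_neg_isHomogeneous (d : ℕ) :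
    IsHomogeneousFamily (finDeg d) (finDeg d) 0 (fun h => geom (-(h / 2)) d) := by
  refine IsHomogeneousFamily.sum fun k => IsHomogeneousFamily.pow ?_ k
  have := (raise_isHomogeneous d).half_smul.real_smul (-1)
  simpa using this

theorem pairW_isHomogeneous (d₁ d₂ : ℕ) :
    IsHomogeneousFamily (pairDeg d₁ d₂) (pairDeg d₁ d₂) 0 (fun h => pairW h d₁ d₂) := by
  simp only [pairW, tensorW, leftAct_mul_rightAct]
  exact IsHomogeneousFamily.one.add
    ((raise_isHomogeneous d₁).half_smul.kronecker (raise_isHomogeneous d₂).half_smul)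

theorem pairF_isHomogeneous (d₁ d₂ : ℕ) :
    IsHomogeneousFamily (pairDeg d₁ d₂) (pairDeg d₁ d₂) (-1) (fun h => pairF h d₁ d₂) := by
  have h1 : IsHomogeneousFamily (pairDeg d₁ d₂) (pairDeg d₁ d₂) (-1) (fun h => pairQ h d₁ d₂) := by
    simp only [pairQ, tensorQ, leftAct_mul_rightAct]
    exact ((lower_isHomogeneous d₁).kronecker
      ((geom_isHomogeneous d₂).mul (geom_isHomogeneous d₂))).add
      (((geom_neg_isHomogeneous d₁).mul (geom_neg_isHomogeneous d₁)).kronecker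
        (lower_isHomogeneous d₂))
  exact ((pairW_isHomogeneous d₁ d₂).mul h1).mul (pairW_isHomogeneous d₁ d₂)

theorem highestTwist_isHomogeneous (d₁ d₂ d : ℕ) :
    IsHomogeneousFamily (pairDeg d₁ d₂) (pairDeg d₁ d₂) 0 (fun h => highestTwist h d₁ d₂ d) := by
  have h1 : IsHomogeneousFamily (finDeg d₁) (finDeg d₁) 0
      (fun h => (2 * geom (h / 2) d₁ - 1) * geom (h / 2) d₁ ^ d) := by
    have h2 : ∀ h : ℂ, (2 * geom (h / 2) d₁ - 1) * geom (h / 2) d₁ ^ d =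
        (geom (h / 2) d₁ + geom (h / 2) d₁ + ((-1 : ℝ) : ℂ) • 1) * geom (h / 2) d₁ ^ d := by
      intro h
      rw [Complex.ofReal_neg, Complex.ofReal_one, neg_one_smul, two_mul, sub_eq_add_neg]
    simp only [h2]
    exact (((geom_isHomogeneous d₁).add (geom_isHomogeneous d₁)).add
      (IsHomogeneousFamily.one.real_smul (-1))).mul ((geom_isHomogeneous d₁).pow d)
  exact h1.kronecker IsHomogeneousFamily.one

/-- The vector is treated as a matrix with one column so that the rules for products of homogeneous
families apply. Each lowering reduces the degree of that column by one. -/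
theorem coupledVec_isHomogeneous {w : Fin (d₁ + 1) × Fin (d₂ + 1) → ℝ}
    (hw : ∀ x, pairDeg d₁ d₂ x ≠ d + r → w x = 0) (n : ℕ) :
    IsHomogeneousFamily (pairDeg d₁ d₂) (fun _ : Unit => (d + r - n : ℤ)) 0
      (fun h => Matrix.replicateCol Unit (coupledVec h d₁ d₂ d (fun x => (w x : ℂ)) n)) := by
  induction n with
  | zero =>
    have h1 : IsHomogeneousFamily (pairDeg d₁ d₂) (fun _ : Unit => (d + r : ℤ)) 0
        (fun _ => Matrix.replicateCol Unit (fun x => (w x : ℂ))) :=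
      IsHomogeneousFamily.const (m := Matrix.replicateCol Unit w) fun x _ hx => by
        rw [Matrix.replicateCol_apply]
        exact hw x (by simpa using hx)
    simp only [coupledVec, Matrix.replicateCol_mulVec]
    exact ((highestTwist_isHomogeneous d₁ d₂ d).mul h1).reindex (by simp)
  | succ n ih =>
    simp only [coupledVec, Matrix.replicateCol_mulVec, Matrix.replicateCol_smul]
    exact (((pairF_isHomogeneous d₁ d₂).mul ih).real_smul _).reindex (by intro _; push_cast; ring)

theorem coupledMatrix_isHomogeneous {w : Fin (d₁ + 1) × Fin (d₂ + 1) → ℝ}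
    (hw : ∀ x, pairDeg d₁ d₂ x ≠ d + r → w x = 0) :
    IsHomogeneousFamily (pairDeg d₁ d₂) (shiftDeg d r) 0
      (fun h => coupledMatrix h d₁ d₂ d (fun x => (w x : ℂ))) := by
  choose m hm using coupledVec_isHomogeneous hw
  refine ⟨Matrix.of fun x i => m (d - i) x (), fun h x i => ?_⟩
  have h1 := hm (d - i) h x ()
  beta_reduce at h1
  rw [Matrix.replicateCol_apply] at h1
  beta_reduce
  rw [coupledMatrix, Matrix.of_apply, h1, Matrix.of_apply]
  have h2 : ((d : ℤ) + r - (d - (i : ℕ) : ℕ)) = shiftDeg d r i := by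
    simp only [shiftDeg, finDeg]; omega
  rw [h2]

theorem exists_uhCG_family (hd : d₁ + d₂ = d + 2 * r) (h₁ : r ≤ d₁) (h₂ : r ≤ d₂) :
    ∃ C : ℂ → Matrix (Fin (d₁ + 1) × Fin (d₂ + 1)) (Fin (d + 1)) ℂ,
      (∀ h, IsUhCG h d₁ d₂ d (C h)) ∧
        IsHomogeneousFamily (pairDeg d₁ d₂) (shiftDeg d r) 0 C := by
  obtain ⟨w, hw, hE, hunit, htop⟩ := exists_classical_highest hd h₁ h₂
  refine ⟨_, fun h => ?_, coupledMatrix_isHomogeneous hw⟩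
  have hH : (lAct d₁ d₂ (uhH d₁) + rAct d₁ d₂ (uhH d₂)).mulVec (fun x => (w x : ℂ)) =
      (d : ℂ) • (fun x => (w x : ℂ)) := by
    have h2 : (d₁ + d₂ : ℂ) = d + 2 * r := by exact_mod_cast hd
    rw [lAct_uhH_add_rAct_uhH]
    funext x
    rw [Matrix.mulVec_diagonal, Pi.smul_apply, smul_eq_mul]
    by_cases hx : pairDeg d₁ d₂ x = d + r
    · rw [hx, h2]; push_cast; ring
    · rw [hw x hx]; simp
  -- The leading components are the classical ones for every `h`, so unit length and sign carry
  -- over.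
  have hlead : ∀ x, pairDeg d₁ d₂ x = d + r →
      coupledMatrix h d₁ d₂ d (fun x => (w x : ℂ)) x (Fin.last d) = w x := by
    intro x hx
    have h3 : ((highestTwist h d₁ d₂ d - 1).mulVec (fun x => (w x : ℂ))) x = 0 := by
      refine Finset.sum_eq_zero fun y _ => ?_
      beta_reduce
      by_cases hy : pairDeg d₁ d₂ y = d + r
      · rw [highestTwist_sub_one_isFiltered h d₁ d₂ d x y (by omega), zero_mul]
      · rw [hw y hy, Complex.ofReal_zero, mul_zero]
    rw [Matrix.sub_mulVec, Matrix.one_mulVec, Pi.sub_apply, sub_eq_zero] at h3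
    rw [coupledMatrix, Matrix.of_apply, Fin.val_last, Nat.sub_self, coupledVec, h3]
  have mH := coupledMatrix_map_H (h := h) hE hH
  have mE := coupledMatrix_map_E (h := h) hE hH
  have mF := coupledMatrix_map_F (h := h) hd h₁ hE hH
  refine ⟨mH, uhDeltaX_mul hd mH mE, uhDeltaY_mul hd mH mE mF, ?_, fun j hj => ?_⟩
  · rw [unit_leading_iff hd fun x => coupledMatrix h d₁ d₂ d (fun x => (w x : ℂ)) x (Fin.last d),
      ← hunit]
    refine Finset.sum_congr rfl fun x _ => ?_
    split_ifs with hx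
    · rw [hlead x hx, Complex.norm_real, Real.norm_eq_abs, sq_abs]
    · rw [hw x hx]; simp
  · rw [← wt_last d₁] at hj
    have hx := (wt_add_wt_eq_spin_iff hd (Fin.last d₁, j)).mp hj
    exact ⟨w (Fin.last d₁, j), htop j hx, hlead _ hx⟩

end Existence

/-! ### The case `h = 0` and the `su(2)` coefficients. -/

section Undeformed

variable {d₁ d₂ d r : ℕ}

theorem uhX_zero (d : ℕ) : uhX 0 d = raise d := by
  rw [uhX, Finset.sum_range_succ', Finset.sum_eq_zero fun k _ => by simp [mul_add]]
  simp

theorem uhY_zero (d : ℕ) : uhY 0 d = lower d := by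
  have : matCosh ((0 / 2 : ℂ) • uhX 0 d) = 1 := by
    rw [matCosh, zero_div, zero_smul, neg_zero, NormedSpace.exp_zero, ← two_smul ℂ, smul_smul]
    norm_num
  rw [uhY, this, inv_one, one_mul, mul_one]

theorem uhDeltaX_zero (d₁ d₂ : ℕ) : uhDeltaX 0 d₁ d₂ = lieCoproduct (raise d₁) (raise d₂) := by
  rw [uhDeltaX, uhX_zero, uhX_zero]

theorem uhDeltaH_zero (d₁ d₂ : ℕ) : uhDeltaH 0 d₁ d₂ = lieCoproduct (uhH d₁) (uhH d₂) := by
  rw [uhDeltaH, zero_smul, zero_smul, neg_zero, NormedSpace.exp_zero, NormedSpace.exp_zero,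
    lieCoproduct]

theorem uhDeltaY_zero (d₁ d₂ : ℕ) : uhDeltaY 0 d₁ d₂ = lieCoproduct (lower d₁) (lower d₂) := by
  rw [uhDeltaY, zero_smul, zero_smul, neg_zero, NormedSpace.exp_zero, NormedSpace.exp_zero,
    uhY_zero, uhY_zero, lieCoproduct]

theorem lieCoproduct_map {ι κ : Type} [DecidableEq ι] [DecidableEq κ] (A : Matrix ι ι ℝ)
    (B : Matrix κ κ ℝ) : (lieCoproduct A B).map Complex.ofReal =
      lieCoproduct (A.map Complex.ofReal) (B.map Complex.ofReal) := by
  have h1 : ∀ {α : Type} [DecidableEq α] (a b : α),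
      ((1 : Matrix α α ℂ) a b) = (((1 : Matrix α α ℝ) a b : ℝ) : ℂ) := fun a b => by
    rw [Matrix.one_apply, Matrix.one_apply]; split_ifs <;> simp
  ext x y
  rw [lieCoproduct, lieCoproduct, Matrix.map_apply, Matrix.add_apply, Matrix.add_apply,
    Matrix.kronecker_apply, Matrix.kronecker_apply, Matrix.kronecker_apply, Matrix.kronecker_apply,
    Matrix.map_apply, Matrix.map_apply, h1, h1]
  push_cast
  rfl

theorem lieCoproduct_transpose {ι κ : Type*} [DecidableEq ι] [DecidableEq κ] (A : Matrix ι ι ℝ)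
    (B : Matrix κ κ ℝ) : (lieCoproduct A B).transpose = lieCoproduct A.transpose B.transpose := by
  rw [lieCoproduct, lieCoproduct, Matrix.transpose_add, ← Matrix.kroneckerMap_transpose,
    ← Matrix.kroneckerMap_transpose, Matrix.transpose_one, Matrix.transpose_one]

theorem lieCoproduct_mul_map_iff {A : Matrix (Fin (d₁ + 1)) (Fin (d₁ + 1)) ℝ}
    {B : Matrix (Fin (d₂ + 1)) (Fin (d₂ + 1)) ℝ} {D : Matrix (Fin (d + 1)) (Fin (d + 1)) ℝ}
    {C : Matrix (Fin (d₁ + 1) × Fin (d₂ + 1)) (Fin (d + 1)) ℝ} :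
    lieCoproduct (A.map Complex.ofReal) (B.map Complex.ofReal) * C.map Complex.ofReal =
      C.map Complex.ofReal * D.map Complex.ofReal ↔ lieCoproduct A B * C = C * D := by
  have hmul : ∀ {l m n : Type} [Fintype m] (M : Matrix l m ℝ) (N : Matrix m n ℝ),
      (M * N).map Complex.ofReal = M.map Complex.ofReal * N.map Complex.ofReal := fun M N =>
    Matrix.map_mul (f := Complex.ofRealHom)
  rw [← lieCoproduct_map, ← hmul, ← hmul]
  exact (Matrix.map_injective Complex.ofReal_injective).eq_iff

theorem IsSU2CG.isUhCG_zero (hd : d₁ + d₂ = d + 2 * r)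
    {C : Matrix (Fin (d₁ + 1) × Fin (d₂ + 1)) (Fin (d + 1)) ℝ}
    (hC : IsSU2CG d₁ d₂ d C) : IsUhCG 0 d₁ d₂ d (C.map Complex.ofReal) := by
  have mH : uhDeltaH 0 d₁ d₂ * C.map Complex.ofReal = C.map Complex.ofReal * uhH d := by
    rw [uhDeltaH_zero]; exact lieCoproduct_mul_map_iff.mpr hC.map_H
  refine ⟨mH, ?_, ?_, ?_, fun j hj => ⟨_, hC.condon_shortley j hj, rfl⟩⟩
  · rw [uhDeltaX_zero, uhX_zero]; exact lieCoproduct_mul_map_iff.mpr hC.map_Zp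
  · rw [uhDeltaY_zero, uhY_zero]; exact lieCoproduct_mul_map_iff.mpr hC.map_Zm
  · rw [unit_leading_iff hd fun x => C.map Complex.ofReal x (Fin.last d)]
    have h1 := congrFun (congrFun hC.orthonormal (Fin.last d)) (Fin.last d)
    rw [Matrix.mul_apply, Matrix.one_apply_eq] at h1
    rw [← h1]
    refine Finset.sum_congr rfl fun x _ => ?_
    rw [Matrix.transpose_apply, Matrix.map_apply, Complex.norm_real, Real.norm_eq_abs, sq_abs,
      ← pow_two]
    split_ifs with hx
    · rfl
    · have h2 := congrFun (congrFun mH x) (Fin.last d)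
      have h3 : lieCoproduct (uhH d₁) (uhH d₂) =
        lAct d₁ d₂ (uhH d₁) + rAct d₁ d₂ (uhH d₂) := rfl
      rw [uhDeltaH_zero, h3, lAct_uhH_add_rAct_uhH, uhH_eq_diagonal, Matrix.diagonal_mul,
        Matrix.mul_diagonal, Matrix.map_apply, Fin.val_last] at h2
      have h4 : (d₁ + d₂ : ℂ) = d + 2 * r := by exact_mod_cast hd
      rw [h4] at h2
      have h5 : ((pairDeg d₁ d₂ x - (d + r) : ℤ) : ℂ) * (C x (Fin.last d) : ℂ) = 0 := by
        push_cast at h2 ⊢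
        linear_combination h2 / 2
      rcases mul_eq_zero.mp h5 with h6 | h6
      · exact absurd (by have : pairDeg d₁ d₂ x - (d + r) = 0 := by exact_mod_cast h6
                         omega) hx
      · rw [Complex.ofReal_eq_zero.mp h6]; simp

/-- A matrix commuting with `H` and `Z₋` is scalar. -/
theorem eq_one_of_commute {G : Matrix (Fin (d + 1)) (Fin (d + 1)) ℝ}
    (hH : sl2H d * G = G * sl2H d) (hZ : sl2Zm d * G = G * sl2Zm d)
    (hlast : G (Fin.last d) (Fin.last d) = 1) : G = 1 := by
  have hoff : ∀ i j, i ≠ j → G i j = 0 := fun i j hij => by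
    have h1 := congrFun (congrFun hH i) j
    rw [sl2H, Matrix.diagonal_mul, Matrix.mul_diagonal, wt, wt] at h1
    have h2 : ((i : ℕ) - (j : ℕ) : ℝ) * G i j = 0 := by linear_combination h1 / 2
    refine (mul_eq_zero.mp h2).resolve_left fun h3 => hij (Fin.ext ?_)
    exact_mod_cast sub_eq_zero.mp h3
  have hdiag : ∀ n : ℕ, ∀ i : Fin (d + 1), (i : ℕ) + n = d → G i i = 1 := by
    intro n
    induction n with
    | zero =>
      intro i hi
      rw [show i = Fin.last d from Fin.ext hi]; exact hlast
    | succ n ih =>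
      intro i hi
      set i' : Fin (d + 1) := ⟨i + 1, by omega⟩ with hi'
      have h1 := congrFun (congrFun hZ i) i'
      rw [Matrix.mul_apply, Matrix.mul_apply, Finset.sum_eq_single i', Finset.sum_eq_single i,
        sl2Zm_apply, if_pos rfl, ih i' (by simp only [hi']; omega)] at h1
      · have h2 := (ladder_pos (show (i : ℕ) < d by omega)).ne'
        rw [mul_comm] at h1
        exact (mul_right_cancel₀ h2 h1).symm
      · intro j _ hj; rw [hoff i j hj.symm, zero_mul]
      · simp
      · intro j _ hj; rw [hoff j i' hj, mul_zero]
      · simp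
  ext i j
  by_cases hij : i = j
  · subst hij
    rw [Matrix.one_apply_eq, hdiag (d - i) i (by omega)]
  · rw [Matrix.one_apply_ne hij, hoff i j hij]

/-- Only orthonormality needs an argument. Transposition exchanges `Z₊` and `Z₋`, so the Gram matrix
of the columns commutes with `H` and `Z₋` and is scalar; the norm of the highest vector makes it 1.
-/
theorem IsUhCG.isSU2CG_of_zero {C : Matrix (Fin (d₁ + 1) × Fin (d₂ + 1)) (Fin (d + 1)) ℝ}
    (hd : d₁ + d₂ = d + 2 * r) (hC : IsUhCG 0 d₁ d₂ d (C.map Complex.ofReal))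
    (hlow : ∀ x, pairDeg d₁ d₂ x ≠ d + r → C x (Fin.last d) = 0) : IsSU2CG d₁ d₂ d C := by
  have mH : lieCoproduct (sl2H d₁) (sl2H d₂) * C = C * sl2H d := by
    have := hC.map_H
    rw [uhDeltaH_zero] at this
    exact lieCoproduct_mul_map_iff.mp this
  have mE : lieCoproduct (sl2Zp d₁) (sl2Zp d₂) * C = C * sl2Zp d := by
    have := hC.map_X
    rw [uhDeltaX_zero, uhX_zero] at this
    exact lieCoproduct_mul_map_iff.mp this
  have mF : lieCoproduct (sl2Zm d₁) (sl2Zm d₂) * C = C * sl2Zm d := by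
    have := hC.map_Y
    rw [uhDeltaY_zero, uhY_zero] at this
    exact lieCoproduct_mul_map_iff.mp this
  have tH : C.transpose * lieCoproduct (sl2H d₁) (sl2H d₂) = sl2H d * C.transpose := by
    have := congrArg Matrix.transpose mH
    rw [Matrix.transpose_mul, Matrix.transpose_mul, lieCoproduct_transpose] at this
    simpa only [sl2H, Matrix.diagonal_transpose] using this
  have tF : C.transpose * lieCoproduct (sl2Zm d₁) (sl2Zm d₂) = sl2Zm d * C.transpose := by
    have := congrArg Matrix.transpose mE
    rwa [Matrix.transpose_mul, Matrix.transpose_mul, lieCoproduct_transpose,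
      ← sl2Zm_eq_transpose, ← sl2Zm_eq_transpose, ← sl2Zm_eq_transpose] at this
  refine ⟨mH, mE, mF, eq_one_of_commute ?_ ?_ ?_, fun j hj => ?_⟩
  · rw [← Matrix.mul_assoc, ← tH, Matrix.mul_assoc, mH, Matrix.mul_assoc]
  · rw [← Matrix.mul_assoc, ← tF, Matrix.mul_assoc, mF, Matrix.mul_assoc]
  · have h1 := hC.unit_leading
    rw [unit_leading_iff hd fun x => C.map Complex.ofReal x (Fin.last d)] at h1
    rw [Matrix.mul_apply, ← h1]
    refine Finset.sum_congr rfl fun x _ => ?_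
    rw [Matrix.transpose_apply, Matrix.map_apply, Complex.norm_real, Real.norm_eq_abs, sq_abs,
      ← pow_two]
    split_ifs with hx
    · rfl
    · rw [hlow x hx]; simp
  · obtain ⟨s, hs, h1⟩ := hC.condon_shortley j hj
    rw [Matrix.map_apply, Complex.ofReal_inj] at h1
    rwa [h1]

theorem exists_degree_shift (h_lower : |spin d₁ - spin d₂| ≤ spin d)
    (h_upper : spin d ≤ spin d₁ + spin d₂) (h_int : ∃ r : ℤ, spin d₁ + spin d₂ - spin d = (r : ℝ)) :
    ∃ r : ℕ, d₁ + d₂ = d + 2 * r ∧ r ≤ d₁ ∧ r ≤ d₂ := by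
  obtain ⟨z, hz⟩ := h_int
  obtain ⟨h1, h2⟩ := abs_le.mp h_lower
  simp only [spin] at *
  have hz0 : 0 ≤ z := by
    have : (0 : ℝ) ≤ z := by linarith
    exact_mod_cast this
  have e1 : (d₁ + d₂ : ℤ) = d + 2 * z := by
    have : (d₁ + d₂ : ℝ) = d + 2 * z := by linarith
    exact_mod_cast this
  have e2 : (d₁ : ℤ) ≤ d₂ + d := by
    have : (d₁ : ℝ) ≤ d₂ + d := by linarith
    exact_mod_cast this
  have e3 : (d₂ : ℤ) ≤ d₁ + d := by
    have : (d₂ : ℝ) ≤ d₁ + d := by linarith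
    exact_mod_cast this
  exact ⟨z.toNat, by omega, by omega, by omega⟩

end Undeformed

/-! ### The main theorem. -/

theorem proposition6 (d₁ d₂ d : ℕ)
    (h_lower : |spin d₁ - spin d₂| ≤ spin d) (h_upper : spin d ≤ spin d₁ + spin d₂)
    (h_int : ∃ r : ℤ, spin d₁ + spin d₂ - spin d = (r : ℝ)) :
    (∃! C : Matrix (Fin (d₁ + 1) × Fin (d₂ + 1)) (Fin (d + 1)) ℝ, IsSU2CG d₁ d₂ d C) ∧
    (∀ h : ℂ, ∃! C : Matrix (Fin (d₁ + 1) × Fin (d₂ + 1)) (Fin (d + 1)) ℂ,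
      IsUhCG h d₁ d₂ d C) ∧
    ∀ C : Matrix (Fin (d₁ + 1) × Fin (d₂ + 1)) (Fin (d + 1)) ℝ, IsSU2CG d₁ d₂ d C →
    ∀ 𝒞 : ℂ → Matrix (Fin (d₁ + 1) × Fin (d₂ + 1)) (Fin (d + 1)) ℂ,
      (∀ h : ℂ, IsUhCG h d₁ d₂ d (𝒞 h)) →
    ∀ (n₁ : Fin (d₁ + 1)) (n₂ : Fin (d₂ + 1)) (m : Fin (d + 1)),
      (wt d m = wt d₁ n₁ + wt d₂ n₂ →
        ∀ h : ℂ, 𝒞 h (n₁, n₂) m = (C (n₁, n₂) m : ℂ)) ∧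
      (wt d₁ n₁ + wt d₂ n₂ < wt d m → ∀ h : ℂ, 𝒞 h (n₁, n₂) m = 0) ∧
      (wt d m < wt d₁ n₁ + wt d₂ n₂ →
        ∃ k : ℕ, (k : ℝ) = wt d₁ n₁ + wt d₂ n₂ - wt d m ∧
          ∃ c : ℝ, ∀ h : ℂ, 𝒞 h (n₁, n₂) m = (c : ℂ) * h ^ k) := by
  obtain ⟨r, hd, h₁, h₂⟩ := exists_degree_shift h_lower h_upper h_int
  obtain ⟨D, hD, m, hm⟩ := exists_uhCG_family hd h₁ h₂
  have hu : ∀ h C, IsUhCG h d₁ d₂ d C → C = D h := fun h C hC => hC.unique hd h₂ (hD h)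
  have hm0 : ∀ h x i, pairDeg d₁ d₂ x = shiftDeg d r i → D h x i = (m x i : ℂ) :=
    fun h x i hx => by
      rw [hm, if_pos (by omega), hx]; simp
  -- The coefficients of exponent zero are the values at `h = 0`. Outside the diagonal of degrees
  -- `m` has to be cut off, since there it holds coefficients of positive powers of `h` or arbitrary
  -- numbers.
  set R : Matrix (Fin (d₁ + 1) × Fin (d₂ + 1)) (Fin (d + 1)) ℝ :=
    Matrix.of fun x i => if pairDeg d₁ d₂ x = shiftDeg d r i then m x i else 0 with hR
  have hRD : R.map Complex.ofReal = D 0 := by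
    ext x i
    rw [Matrix.map_apply, hR, Matrix.of_apply]
    split_ifs with hx
    · exact (hm0 0 x i hx).symm
    · rw [hm]
      split_ifs with hx'
      · rw [zero_pow (by omega), mul_zero, Complex.ofReal_zero]
      · exact Complex.ofReal_zero
  have hRcg : IsSU2CG d₁ d₂ d R := by
    refine IsUhCG.isSU2CG_of_zero hd (hRD ▸ hD 0) fun x hx => ?_
    rw [hR, Matrix.of_apply, if_neg]
    simpa only [shiftDeg, finDeg, Fin.val_last] using hx
  have hsu : ∀ C, IsSU2CG d₁ d₂ d C → C = R := fun C hC =>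
    Matrix.map_injective Complex.ofReal_injective
      ((hu 0 _ (hC.isUhCG_zero hd)).trans hRD.symm)
  refine ⟨⟨R, hRcg, hsu⟩, fun h => ⟨D h, hD h, hu h⟩, fun C hC 𝒞 h𝒞 n₁ n₂ i => ?_⟩
  have hwt := wt_add_wt_sub_wt hd (n₁, n₂) i
  dsimp only at hwt
  refine ⟨fun hi h => ?_, fun hi h => ?_, fun hi => ?_⟩
  · have hx : pairDeg d₁ d₂ (n₁, n₂) = shiftDeg d r i := by
      rw [hi, sub_self, eq_comm, Int.cast_eq_zero] at hwt
      omega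
    rw [hu h _ (h𝒞 h), hm0 h _ _ hx, hsu C hC, hR, Matrix.of_apply, if_pos hx]
  · have hx : pairDeg d₁ d₂ (n₁, n₂) < shiftDeg d r i := by
      have : ((pairDeg d₁ d₂ (n₁, n₂) - shiftDeg d r i : ℤ) : ℝ) < 0 := by rw [← hwt]; linarith
      have : pairDeg d₁ d₂ (n₁, n₂) - shiftDeg d r i < 0 := by exact_mod_cast this
      omega
    rw [hu h _ (h𝒞 h), hm, if_neg (by omega)]
  · have hx : shiftDeg d r i < pairDeg d₁ d₂ (n₁, n₂) := by
      have : 0 < ((pairDeg d₁ d₂ (n₁, n₂) - shiftDeg d r i : ℤ) : ℝ) := by rw [← hwt]; linarith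
      have : 0 < pairDeg d₁ d₂ (n₁, n₂) - shiftDeg d r i := by exact_mod_cast this
      omega
    refine ⟨(pairDeg d₁ d₂ (n₁, n₂) - shiftDeg d r i - 0).toNat, ?_, m (n₁, n₂) i, fun h => ?_⟩
    · rw [hwt, sub_zero]
      have : ((pairDeg d₁ d₂ (n₁, n₂) - shiftDeg d r i).toNat : ℤ) =
        pairDeg d₁ d₂ (n₁, n₂) - shiftDeg d r i := Int.toNat_of_nonneg (by omega)
      exact_mod_cast congrArg (Int.cast : ℤ → ℝ) this
    · rw [hu h _ (h𝒞 h), hm, if_pos (by omega)]
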